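/- Let $S$ be a finite set of prime numbers and let $\mathbb{Z}_S\subseteq\mathbb{Q}$ be the localization of $\mathbb{Z}$ at the set of nonzero integers not divisible by any prime in $S$. Let $A$ be a finite-dimensional semisimple $\mathbb{Q}$-algebra with irreducible central idempotents $e_1,\dots,e_m$, let $\mathfrak{O}$ be a maximal $\mathbb{Z}_S$-order in $A$ (so that $e_1,\dots,e_m\in\mathfrak{O}$), and let $u=(u_1,\dots,u_m)\in\mathbb{Q}^m$ with $u_i\ge 0$ for all $i$. For a finite (left) $\mathfrak{O}$-module $G$ put $|G|^u:=\prod_{i=1}^m|e_iG|^{u_i}$, let $\operatorname{Aut}_{\mathfrak O}(G)$ be its automorphism group, and let $\operatorname{Sur}_{\mathfrak O}(H,G)$ be the set of surjective $\mathfrak{O}$-module homomorphisms $H\to G$. Put \[ Z(u):=\sum_{G}\frac{1}{|G|^u\,|\operatorname{Aut}_{\mathfrak O}(G)|}, \] where $G$ runs over the isomorphism classes of finite $\mathfrak{O}$-modules. Let $(X_n)_{n\ge 0}$ be a sequence of random finite $\mathfrak{O}$-modules (possibly on different probability spaces) such that for every finite $\mathfrak{O}$-module $G$ \[ \lim_{n\to\infty}\mathbb{E}\big(|\operatorname{Sur}_{\mathfrak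 O}(X_n,G)|\big)=\frac{1}{|G|^u}. \] Then the series $Z(u)$ converges and, for every finite $\mathfrak{O}$-module $G$, the limit of $\mathbb{P}(X_n\cong G)$ exists and \[ \lim_{n\to\infty}\mathbb{P}(X_n\cong G)=\frac{1}{|\operatorname{Aut}_{\mathfrak O}(G)|\,|G|^u\,Z(u)}. \] That is, the limit is the Cohen--Lenstra--Martinet distribution: there is exactly one probability distribution $\mathbb{P}(X\cong\,\cdot\,)$ on the isomorphism classes of finite $\mathfrak{O}$-modules with \[ \frac{\mathbb{P}(X\cong G_1)}{\mathbb{P}(X\cong G_2)}=\frac{|G_2|^u\,|\operatorname{Aut}_{\mathfrak O}(G_2)|}{|G_1|^u\,|\operatorname{Aut}_{\mathfrak O}(G_1)|} \] for all finite $\mathfrak{O}$-modules $G_1,G_2$, and $\lim_{n\to\infty}\mathbb{P}(X_n\cong G)=\mathbb{P}(X\cong G)$ for every finite $\mathfrak{O}$-module $G$. -/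

import Mathlib

open Filter Topology MeasureTheory
open scoped ENNReal

noncomputable section

namespace CLM

/-- The nonzero integers that are not divisible by any prime in `S`. -/
def awayFrom (S : Set Nat.Primes) : Submonoid ℤ where
  carrier := {n | n ≠ 0 ∧ ∀ p ∈ S, ¬ ((p : ℕ) : ℤ) ∣ n}
  one_mem' := ⟨one_ne_zero, fun p _ h =>
    (Nat.prime_iff_prime_int.mp p.2).not_isUnit (isUnit_of_dvd_one h)⟩
  mul_mem' := fun ha hb => ⟨mul_ne_zero ha.1 hb.1, fun p hp h =>
    ((Nat.prime_iff_prime_int.mp p.2).dvd_or_dvd h).elim (ha.2 p hp) (hb.2 p hp)⟩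

theorem awayFrom_le (S : Set Nat.Primes) : awayFrom S ≤ nonZeroDivisors ℤ :=
  fun _ hn => mem_nonZeroDivisors_of_ne_zero hn.1

/-- `ℤ_S`: the localization of `ℤ` at the nonzero integers not divisible by any prime in `S`,
realized inside `ℚ`. -/
abbrev ZS (S : Set Nat.Primes) : Subalgebra ℤ ℚ :=
  Localization.subalgebra.ofField ℚ (awayFrom S) (awayFrom_le S)

section Orders

variable {A : Type*} [Ring A] [Algebra ℚ A] {S : Set Nat.Primes}

/-- A `ℤ_S`-order in `A`: a subring (with the same identity) that is finitely generated as a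
`ℤ_S`-module and spans `A` over `ℚ`. -/
structure IsOrder (O : Subalgebra (ZS S) A) : Prop where
  fg : (Subalgebra.toSubmodule O).FG
  span_eq_top : Submodule.span ℚ (O : Set A) = ⊤

/-- A maximal `ℤ_S`-order in `A`: an order not properly contained in any other order. -/
def IsMaximalOrder (O : Subalgebra (ZS S) A) : Prop :=
  Maximal IsOrder O

/-- An irreducible central idempotent: a nonzero central idempotent that is not the sum of two
nonzero orthogonal central idempotents. -/
structure IsIrreducibleCentralIdempotent (e : A) : Prop where
  idem : IsIdempotentElem e
  central : e ∈ Set.center A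
  ne_zero : e ≠ 0
  irreducible : ∀ f g : A, IsIdempotentElem f → f ∈ Set.center A →
    IsIdempotentElem g → g ∈ Set.center A → f * g = 0 → e = f + g → f = 0 ∨ g = 0

/-- The set of irreducible central idempotents of `A`. -/
def irreducibleCentralIdempotents (A : Type*) [Ring A] [Algebra ℚ A] : Set A :=
  {e | IsIrreducibleCentralIdempotent e}

/-- The subalgebra `O + e O` for a central idempotent `e`. -/
def adjoinIdem (O : Subalgebra (ZS S) A) (e : A) (he : IsIdempotentElem e)
    (hc : e ∈ Set.center A) : Subalgebra (ZS S) A where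
  carrier := {x | ∃ a ∈ O, ∃ b ∈ O, x = a + e * b}
  mul_mem' := by
    rintro x y ⟨a, ha, b, hb, rfl⟩ ⟨c, hcO, d, hd, rfl⟩
    refine ⟨a * c, O.mul_mem ha hcO, a * d + b * c + b * d,
      O.add_mem (O.add_mem (O.mul_mem ha hd) (O.mul_mem hb hcO)) (O.mul_mem hb hd), ?_⟩
    have h : ∀ z, z * e = e * z := fun z => (Set.mem_center_iff.mp hc).comm z |>.eq.symm
    have h1 : a * (e * d) = e * (a * d) := by rw [← mul_assoc, h a, mul_assoc]
    have h2 : e * b * (e * d) = e * (b * d) := by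
      rw [mul_assoc, ← mul_assoc b e d, h b, mul_assoc e b d, ← mul_assoc e e, he.eq]
    rw [add_mul, mul_add, mul_add, h1, h2, mul_add, mul_add, mul_assoc e b c]
    abel
  add_mem' := by
    rintro x y ⟨a, ha, b, hb, rfl⟩ ⟨c, hcO, d, hd, rfl⟩
    exact ⟨a + c, O.add_mem ha hcO, b + d, O.add_mem hb hd, by rw [mul_add]; abel⟩
  algebraMap_mem' := fun r => ⟨_, O.algebraMap_mem r, 0, O.zero_mem, by simp⟩

/-- A maximal order contains every central idempotent of the algebra. -/
theorem IsMaximalOrder.mem_of_central {O : Subalgebra (ZS S) A} (hO : IsMaximalOrder O) {e : A}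
    (he : IsIdempotentElem e) (hc : e ∈ Set.center A) : e ∈ O := by
  have hle : O ≤ adjoinIdem O e he hc := fun a ha => ⟨a, ha, 0, O.zero_mem, by simp⟩
  have hord : IsOrder (adjoinIdem O e he hc) := by
    refine ⟨?_, top_le_iff.mp (hO.prop.span_eq_top.ge.trans (Submodule.span_mono hle))⟩
    have : Subalgebra.toSubmodule (adjoinIdem O e he hc) =
        Subalgebra.toSubmodule O ⊔
          (Subalgebra.toSubmodule O).map (LinearMap.mulLeft (ZS S) e) := by
      ext x
      simp only [Submodule.mem_sup, Submodule.mem_map, Subalgebra.mem_toSubmodule,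
        LinearMap.mulLeft_apply]
      constructor
      · rintro ⟨a, ha, b, hb, rfl⟩
        exact ⟨a, ha, e * b, ⟨b, hb, rfl⟩, rfl⟩
      · rintro ⟨a, ha, _, ⟨b, hb, rfl⟩, rfl⟩
        exact ⟨a, ha, b, hb, rfl⟩
    rw [this]
    exact hO.prop.fg.sup (hO.prop.fg.map _)
  exact hO.le_of_ge hord hle ⟨0, O.zero_mem, 1, O.one_mem, by simp⟩

end Orders

/-- A finite left `R`-module. (Every finite module is isomorphic to one in `Type`.) -/
structure FiniteModule (R : Type*) [Ring R] where
  carrier : Type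
  [addCommGroup : AddCommGroup carrier]
  [module : Module R carrier]
  [finite : Finite carrier]

attribute [instance] FiniteModule.addCommGroup FiniteModule.module FiniteModule.finite

instance (R : Type*) [Ring R] : CoeSort (FiniteModule R) Type := ⟨FiniteModule.carrier⟩

/-- Isomorphism of finite `R`-modules. -/
def Iso {R : Type*} [Ring R] (G H : FiniteModule R) : Prop := Nonempty (G ≃ₗ[R] H)

/-- Isomorphism as an equivalence relation. -/
def isoSetoid (R : Type*) [Ring R] : Setoid (FiniteModule R) where
  r := Iso
  iseqv := ⟨fun _ => ⟨LinearEquiv.refl R _⟩, fun ⟨f⟩ => ⟨f.symm⟩, fun ⟨f⟩ ⟨g⟩ => ⟨f.trans g⟩⟩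

/-- The isomorphism classes of finite `R`-modules. -/
def IsoClass (R : Type*) [Ring R] := Quotient (isoSetoid R)

/-- The isomorphism class of `G`. -/
def isoClass {R : Type*} [Ring R] (G : FiniteModule R) : IsoClass R := Quotient.mk (isoSetoid R) G

/-- A chosen representative of an isomorphism class. -/
def IsoClass.rep {R : Type*} [Ring R] (c : IsoClass R) : FiniteModule R :=
  @Quotient.out _ (isoSetoid R) c

/-- `|Sur_R(G, H)|`. -/
def surCard {R : Type*} [Ring R] (G H : FiniteModule R) : ℕ :=
  Nat.card {f : G →ₗ[R] H // Function.Surjective f}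

/-- `|Aut_R(G)|`. -/
def autCard {R : Type*} [Ring R] (G : FiniteModule R) : ℕ := Nat.card (G ≃ₗ[R] G)

/-- A random finite `R`-module on a measurable space: a map to finite `R`-modules for which every
event `X ≅ G` is measurable. -/
def IsRandomModule {R : Type*} [Ring R] {Ω : Type*} [MeasurableSpace Ω]
    (X : Ω → FiniteModule R) : Prop :=
  ∀ G : FiniteModule R, MeasurableSet {ω | Iso (X ω) G}

section Weights

variable {A : Type*} [Ring A] [Algebra ℚ A] {S : Set Nat.Primes} {O : Subalgebra (ZS S) A}
  (hO : IsMaximalOrder O) {m : ℕ} (e : Fin m ≃ irreducibleCentralIdempotents A) (u : Fin m → ℚ)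

/-- `|G|^u = ∏ i, |e_i G| ^ u_i`, where `e_1, …, e_m` are the irreducible central idempotents. -/
def powU (G : FiniteModule O) : ℝ :=
  ∏ i, (Nat.card (Set.range fun g : G =>
    (⟨(e i : A), hO.mem_of_central (e i).2.idem (e i).2.central⟩ : O) • g) : ℝ) ^ (u i : ℝ)

/-- The sum `Z(u)` of `1 / (|G|^u |Aut G|)` over the isomorphism classes of finite `O`-modules. -/
def Z : ℝ := ∑' c : IsoClass O, 1 / (powU hO e u c.rep * autCard c.rep)

/-- `p` is the law of the Cohen-Lenstra-Martinet random module `X(A, u, O)`. -/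
def IsCohenLenstraMartinet (p : PMF (IsoClass O)) : Prop :=
  ∀ G₁ G₂ : FiniteModule O,
    (p (isoClass G₁)).toReal / (p (isoClass G₂)).toReal =
      (powU hO e u G₂ * autCard G₂) / (powU hO e u G₁ * autCard G₁)

end Weights

end CLM

end

/-! A surjection `φ : X → F` is an isomorphism exactly when its kernel has no nonzero map to a
simple module, so `|Aut F| · 1[X ≅ F]` counts the surjections `φ` with `Hom(ker φ, K) = 0` for all
simple `K`. The proof evaluates this count by a sieve whose terms are moments, and then shows that
no mass escapes.

Kernel moments. Let `M` be semisimple and let `p : Q → F` be a surjection from a finite free module.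
Surjections from `X` to the extensions of `F` by `M` obtained by pushing out along `η : ker p → M`
lie above surjections `φ : X → F`. Summed over all `η`, they number `∑_φ |Sur(ker φ, M)|` times
`|Hom(Q, M)|` (`sum_card_surjective_pushout`). Each pushout has weight `W F * W M`, where `W` is
`|·|^u`. Over a maximal order, `|Hom(ker p, M)| = |Hom(Q, M)|`, so the two factors cancel and `∑_φ
|Sur(ker φ, M)|` has limiting expectation `1 / (W F * W M)` (`momentLimit_kernel`).

The equality of Hom counts is the arithmetic input (`card_hom_eq_of_finite_quotient`). Maximal
two-sided ideals of a maximal order are invertible and commute, so multiplication by such an ideal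
`P` preserves indices of lattices. Hence `N / P N` has the same order for commensurable `N`. For `P
= Ann K` this quotient is a power of `K`, and its order determines `|Hom(N, K)|`.

Sieve. If `|Hom(ker φ, K)| = q ^ r` with `q = |End K|`, the alternating sums of the terms `∏_{j<d}
(q^r - q^j)/(q^(j+1) - 1)` approximate `1[r = 0]` with an error at most the next term
(`abs_indicator_sub_sieveSum_le`). There are finitely many simple modules, and the limiting
expectations of the terms tend to zero, so the limits in `n` and in the truncation level can be
exchanged. The result is a limit `C / (W F * |Aut F|)` with `C > 0` independent of `F`
(`exists_tendsto_iso`).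

Tightness. Modules with many maps to simple modules are rare by Markov's inequality. A module with
few such maps either belongs to a finite list or surjects onto a member of a finite list of classes
of small total weight (`one_le_sum_iso_add`). So the limits sum to `1`, which gives `C = 1 / Z`
(`hasSum_one_of_tendsto`). -/

noncomputable section

namespace CLM

/-! ### Modules killed by the annihilator of a finite simple module -/

section SimpleModules

variable {R : Type*} [Ring R] (K : Type*) [AddCommGroup K] [Module R K]

/-- The map sending a scalar to the associated homothety of `K`. -/
def homothety (R K : Type*) [Ring R] [AddCommGroup K] [Module R K] : R →ₗ[R] (K → K) :=
  LinearMap.pi fun k => LinearMap.toSpanSingleton R K k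

theorem ker_homothety : LinearMap.ker (homothety R K) = Module.annihilator R K := by
  ext r
  simp [homothety, Module.mem_annihilator, funext_iff]

/-- The quotient embeds in `K → K`, which is a finite power of a simple module because `K` is
finite. -/
theorem isSemisimpleModule_quotient_ker_homothety [IsSimpleModule R K] [Finite K] :
    IsSemisimpleModule R (R ⧸ LinearMap.ker (homothety R K)) :=
  IsSemisimpleModule.congr (homothety R K).quotKerEquivRange

variable {K}

/-- Each element of `Y` generates a quotient of the semisimple module `R / Ann K`, and `Y` is the
sum of these cyclic submodules. -/
theorem isSemisimpleModule_of_annihilator_le [IsSimpleModule R K] [Finite K] {Y : Type*}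
    [AddCommGroup Y] [Module R Y] (h : Module.annihilator R K ≤ Module.annihilator R Y) :
    IsSemisimpleModule R Y := by
  have := isSemisimpleModule_quotient_ker_homothety (R := R) K
  let f : Y → (R ⧸ LinearMap.ker (homothety R K)) →ₗ[R] Y := fun y =>
    Submodule.liftQ _ (LinearMap.toSpanSingleton R Y y) fun r hr => by
      rw [ker_homothety] at hr
      simpa using Module.mem_annihilator.mp (h hr) y
  refine isSemisimpleModule_of_isSemisimpleModule_submodule' (p := fun y => LinearMap.range (f y))
    (fun y => IsSemisimpleModule.range (f y)) ?_
  refine eq_top_iff.mpr fun y _ => Submodule.mem_iSup_of_mem y ⟨Submodule.Quotient.mk 1, ?_⟩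
  simp [f]

theorem nonempty_linearEquiv_of_injective_pi [IsSimpleModule R K] {ι : Type*} {K' : Type*}
    [AddCommGroup K'] [Module R K'] [IsSimpleModule R K'] (f : K' →ₗ[R] (ι → K)) (hf : f ≠ 0) :
    Nonempty (K' ≃ₗ[R] K) := by
  obtain ⟨x, hx⟩ : ∃ x, f x ≠ 0 := by
    by_contra! h
    exact hf (LinearMap.ext h)
  obtain ⟨i, hi⟩ := Function.ne_iff.mp hx
  have : LinearMap.proj i ∘ₗ f ≠ 0 := fun h => hi (by simpa using LinearMap.congr_fun h x)
  exact ⟨LinearEquiv.ofBijective _ (LinearMap.bijective_of_ne_zero this)⟩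

/-- `K'` is a quotient of the semisimple module `R / Ann K`, hence also a submodule of it, hence
embeds in `K → K`. Some coordinate is then nonzero on `K'` and is an isomorphism by Schur's lemma.
-/
theorem nonempty_linearEquiv_of_annihilator_le [IsSimpleModule R K] [Finite K] {K' : Type*}
    [AddCommGroup K'] [Module R K'] [IsSimpleModule R K']
    (h : Module.annihilator R K ≤ Module.annihilator R K') : Nonempty (K' ≃ₗ[R] K) := by
  have := isSemisimpleModule_quotient_ker_homothety (R := R) K
  have := IsSimpleModule.nontrivial R K'
  obtain ⟨y, hy⟩ := exists_ne (0 : K')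
  let f : (R ⧸ LinearMap.ker (homothety R K)) →ₗ[R] K' :=
    Submodule.liftQ _ (LinearMap.toSpanSingleton R K' y) fun r hr => by
      rw [ker_homothety] at hr
      simpa using Module.mem_annihilator.mp (h hr) y
  have hf : f ≠ 0 := fun h0 => hy (by simpa [f] using LinearMap.congr_fun h0 (Submodule.Quotient.mk 1))
  obtain ⟨T, ⟨g⟩⟩ := LinearMap.linearEquiv_of_ne_zero hf
  let j : K' →ₗ[R] (K → K) :=
    (LinearMap.range (homothety R K)).subtype ∘ₗ
      (homothety R K).quotKerEquivRange.toLinearMap ∘ₗ T.subtype ∘ₗ g.toLinearMap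
  have hj : Function.Injective j := by
    simp only [j, LinearMap.coe_comp]
    exact Subtype.val_injective.comp ((LinearEquiv.injective _).comp
      (Subtype.val_injective.comp g.injective))
  refine nonempty_linearEquiv_of_injective_pi j fun h0 => hy (hj ?_)
  rw [h0]; rfl

/-- A finite module killed by the annihilator of a finite simple module `K` is a power of `K`. -/
theorem exists_linearEquiv_fun_of_annihilator_le [IsSimpleModule R K] [Finite K] {Y : Type*}
    [AddCommGroup Y] [Module R Y] [Finite Y]
    (h : Module.annihilator R K ≤ Module.annihilator R Y) : ∃ n : ℕ, Nonempty (Y ≃ₗ[R] Fin n → K) := by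
  have := isSemisimpleModule_of_annihilator_le h
  have : IsIsotypicOfType R Y K := fun m _ => nonempty_linearEquiv_of_annihilator_le
    (h.trans fun r hr => Module.mem_annihilator.mpr fun x =>
      Subtype.ext (by simpa using Module.mem_annihilator.mp hr (x : Y)))
  exact this.linearEquiv_fun

theorem card_hom_congr {X Y M : Type*} [AddCommGroup X] [Module R X] [AddCommGroup Y] [Module R Y]
    [AddCommGroup M] [Module R M] (e : X ≃ₗ[R] Y) : Nat.card (X →ₗ[R] M) = Nat.card (Y →ₗ[R] M) :=
  Nat.card_congr
    { toFun := fun f => f ∘ₗ e.symm.toLinearMap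
      invFun := fun f => f ∘ₗ e.toLinearMap
      left_inv := fun f => by ext; simp
      right_inv := fun f => by ext; simp }

/-- The order of the endomorphism ring of `K`. -/
def endCard (R K : Type*) [Ring R] [AddCommGroup K] [Module R K] : ℕ := Nat.card (K →ₗ[R] K)

instance {X Y : Type*} [AddCommGroup X] [Module R X] [AddCommGroup Y] [Module R Y] [Finite X]
    [Finite Y] : Finite (X →ₗ[R] Y) := Finite.of_injective _ DFunLike.coe_injective

theorem one_lt_endCard [IsSimpleModule R K] [Finite K] : 1 < endCard R K := by
  have := IsSimpleModule.nontrivial R K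
  exact Finite.one_lt_card

/-- By Schur's lemma `End K` is a division ring, and the homomorphisms to `K` form a vector space
over it. -/
theorem exists_card_hom_eq_pow [IsSimpleModule R K] [Finite K] {X : Type*} [AddCommGroup X]
    [Module R X] [Finite X] : ∃ r : ℕ, Nat.card (X →ₗ[R] K) = endCard R K ^ r := by
  classical
  have : Finite (Module.End R K) := inferInstanceAs (Finite (K →ₗ[R] K))
  exact ⟨_, Module.natCard_eq_pow_finrank (K := Module.End R K) (V := X →ₗ[R] K)⟩

/-- Homomorphisms to `K` out of a module `N` factor through `N / N'` where `N'` is generated by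
the products with the annihilator of `K`. -/
theorem card_hom_quotient {N : Type*} [AddCommGroup N] [Module R N] (N' : Submodule R N)
    (h : ∀ f : N →ₗ[R] K, N' ≤ LinearMap.ker f) :
    Nat.card (N →ₗ[R] K) = Nat.card ((N ⧸ N') →ₗ[R] K) :=
  Nat.card_congr
    { toFun := fun f => N'.liftQ f (h f)
      invFun := fun f => f ∘ₗ N'.mkQ
      left_inv := fun f => by ext; simp
      right_inv := fun f => by ext; simp }

/-- For finite quotients killed by the annihilator of `K`, the order determines the number of
homomorphisms to `K`. -/
theorem card_hom_eq_of_card_eq [IsSimpleModule R K] [Finite K] {Y Y' : Type*}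
    [AddCommGroup Y] [Module R Y] [Finite Y] [AddCommGroup Y'] [Module R Y'] [Finite Y']
    (h : Module.annihilator R K ≤ Module.annihilator R Y)
    (h' : Module.annihilator R K ≤ Module.annihilator R Y') (hc : Nat.card Y = Nat.card Y') :
    Nat.card (Y →ₗ[R] K) = Nat.card (Y' →ₗ[R] K) := by
  obtain ⟨n, ⟨f⟩⟩ := exists_linearEquiv_fun_of_annihilator_le h
  obtain ⟨n', ⟨f'⟩⟩ := exists_linearEquiv_fun_of_annihilator_le h'
  have := IsSimpleModule.nontrivial R K
  rw [Nat.card_congr f.toEquiv, Nat.card_congr f'.toEquiv, Nat.card_fun, Nat.card_fun, Nat.card_fin,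
    Nat.card_fin] at hc
  have : n = n' := Nat.pow_right_injective (Finite.one_lt_card (α := K)) hc
  subst this
  rw [card_hom_congr f, card_hom_congr f']

end SimpleModules

/-! ### Orders, their two-sided ideals and maximal ideals -/

section Orders

variable {A : Type*} [Ring A] [Algebra ℚ A] {S : Set Nat.Primes} {O : Subalgebra (ZS S) A}

instance isNoetherianRing_ZS : IsNoetherianRing (ZS S) :=
  have := Localization.subalgebra.isLocalization_ofField ℚ (awayFrom S) (awayFrom_le S)
  IsLocalization.isNoetherianRing (awayFrom S) _ inferInstance

theorem isUnit_intCast_ZS {s : ℤ} (hs : s ∈ awayFrom S) : IsUnit ((s : ℤ) : ZS S) := by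
  have := Localization.subalgebra.isLocalization_ofField ℚ (awayFrom S) (awayFrom_le S)
  simpa using IsLocalization.map_units (ZS S) (⟨s, hs⟩ : awayFrom S)

theorem exists_mul_intCast_eq (x : ZS S) : ∃ n : ℤ, ∃ s ∈ awayFrom S, x * (s : ZS S) = n := by
  have := Localization.subalgebra.isLocalization_ofField ℚ (awayFrom S) (awayFrom_le S)
  obtain ⟨⟨n, s⟩, h⟩ := IsLocalization.surj (awayFrom S) x
  exact ⟨n, s, s.2, by simpa using h⟩

/-- The image of `ℤ` in `B` is finite. A denominator `s` is a unit with all its powers in this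
image, so it has finite multiplicative order and its inverse is again an integer. Thus `B` equals
the image of `ℤ`. -/
theorem finite_of_intCast_eq_zero {B : Type*} [CommRing B] {a : ℤ} (ha : a ≠ 0)
    (ha0 : (a : B) = 0) (h : ∀ y : B, ∃ n s : ℤ, IsUnit (s : B) ∧ y * s = n) : Finite B := by
  have hfin : (Set.range (fun n : ℤ => (n : B))).Finite := by
    refine ((Set.finite_Icc (0 : ℤ) |a|).image (fun n : ℤ => (n : B))).subset ?_
    rintro _ ⟨n, rfl⟩
    refine ⟨n % a, ⟨Int.emod_nonneg _ ha, (Int.emod_lt_abs _ ha).le⟩, ?_⟩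
    have h := congrArg (fun z : ℤ => (z : B)) (Int.emod_add_mul_ediv n a)
    simpa [ha0] using h
  refine Set.finite_univ_iff.mp (hfin.subset fun y _ => ?_)
  obtain ⟨n, s, hu, hx⟩ := h y
  obtain ⟨i, j, hij, h⟩ : ∃ i j : ℕ, i < j ∧ (s : B) ^ i = (s : B) ^ j := by
    have : ¬ Function.Injective (fun i : ℕ => (s : B) ^ i) := fun hinj =>
      Set.infinite_range_of_injective hinj (hfin.subset (by
        rintro _ ⟨i, rfl⟩; exact ⟨s ^ i, by simp⟩))
    simp only [Function.Injective, not_forall] at this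
    obtain ⟨i, j, h, hne⟩ := this
    rcases lt_or_gt_of_ne hne with h' | h'
    exacts [⟨i, j, h', h⟩, ⟨j, i, h', h.symm⟩]
  obtain ⟨k, rfl⟩ := Nat.exists_eq_add_of_lt hij
  have h1 : (s : B) ^ (k + 1) = 1 := by
    rw [add_assoc, pow_add] at h
    exact (hu.pow i).mul_left_cancel (by rw [← h, mul_one])
  refine ⟨n * s ^ k, ?_⟩
  push_cast
  rw [← hx, mul_assoc, ← pow_succ', h1, mul_one]

theorem finite_quotient_span_intCast {a : ℤ} (ha : a ≠ 0) :
    Finite (ZS S ⧸ Ideal.span {(a : ZS S)}) := by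
  refine finite_of_intCast_eq_zero ha ?_ fun y => ?_
  · rw [← map_intCast (Ideal.Quotient.mk (Ideal.span {(a : ZS S)}))]
    exact Ideal.Quotient.eq_zero_iff_mem.mpr (Ideal.mem_span_singleton_self _)
  · obtain ⟨x, rfl⟩ := Ideal.Quotient.mk_surjective y
    obtain ⟨n, s, hs, hx⟩ := exists_mul_intCast_eq x
    refine ⟨n, s, ?_, ?_⟩
    · rw [← map_intCast (Ideal.Quotient.mk (Ideal.span {(a : ZS S)}))]
      exact (isUnit_intCast_ZS hs).map _
    · rw [← map_intCast (Ideal.Quotient.mk (Ideal.span {(a : ZS S)})), ← map_mul, hx, map_intCast]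

theorem finite_of_finite_quotient_span {Z : Type*} [CommRing Z] (a : Z)
    [Finite (Z ⧸ Ideal.span {a})] {M : Type*} [AddCommGroup M] [Module Z M] [Module.Finite Z M]
    (h : ∀ x : M, a • x = 0) : Finite M := by
  obtain ⟨n, s, hs⟩ := Module.Finite.exists_fin (R := Z) (M := M)
  refine Finite.of_surjective
    (fun c : Fin n → Z ⧸ Ideal.span {a} => ∑ i, (c i).out • s i) fun x => ?_
  obtain ⟨c, rfl⟩ := (Submodule.mem_span_range_iff_exists_fun Z).mp (hs ▸ Submodule.mem_top (x := x))
  refine ⟨fun i => Ideal.Quotient.mk _ (c i), Finset.sum_congr rfl fun i _ => ?_⟩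
  have h1 : Ideal.Quotient.mk (Ideal.span {a}) (Ideal.Quotient.mk (Ideal.span {a}) (c i)).out =
      Ideal.Quotient.mk _ (c i) := Quotient.out_eq _
  obtain ⟨y, hy⟩ := Ideal.mem_span_singleton'.mp (Ideal.Quotient.eq.mp h1)
  rw [← sub_eq_zero, ← sub_smul, ← hy, mul_smul, h, smul_zero]

theorem finite_of_algebra_finite {Z R : Type*} [CommRing Z] [Ring R] [Algebra Z R]
    [Module.Finite Z R] {n : ℤ} (hn : Finite (Z ⧸ Ideal.span {(n : Z)})) {Y : Type*}
    [AddCommGroup Y] [Module R Y] [Module.Finite R Y] (h : ∀ y : Y, n • y = 0) : Finite Y := by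
  let _ := Module.compHom Y (algebraMap Z R)
  have : IsScalarTower Z R Y := ⟨fun z r y => by
    rw [Algebra.smul_def, mul_smul]; rfl⟩
  have : Module.Finite Z Y := Module.Finite.trans R Y
  refine finite_of_finite_quotient_span (n : Z) fun x => ?_
  rw [Int.cast_smul_eq_zsmul, h]

/-- A finitely generated module over an order that is killed by a nonzero integer is finite. -/
theorem finite_of_fg_of_smul_eq_zero (hfg : (Subalgebra.toSubmodule O).FG) {n : ℤ} (hn : n ≠ 0)
    {Y : Type*} [AddCommGroup Y] [Module O Y] [Module.Finite O Y] (h : ∀ y : Y, n • y = 0) :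
    Finite Y :=
  have : Module.Finite (ZS S) O := Module.Finite.iff_fg.mpr hfg
  finite_of_algebra_finite (finite_quotient_span_intCast (S := S) hn) (R := O) h

variable (O) in
/-- A two-sided ideal of `O` that contains a nonzero integer. -/
structure IsFullIdeal (B : Submodule (ZS S) A) : Prop where
  le : B ≤ Subalgebra.toSubmodule O
  left : Subalgebra.toSubmodule O * B ≤ B
  right : B * Subalgebra.toSubmodule O ≤ B
  exists_int : ∃ n : ℤ, n ≠ 0 ∧ (n : A) ∈ B

local notation "𝒪" => Subalgebra.toSubmodule O

theorem one_mem_toSubmodule : (1 : A) ∈ 𝒪 := O.one_mem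

theorem le_order_mul (B : Submodule (ZS S) A) : B ≤ 𝒪 * B := fun b hb => by
  simpa using Submodule.mul_mem_mul (one_mem_toSubmodule (O := O)) hb

theorem le_mul_order (B : Submodule (ZS S) A) : B ≤ B * 𝒪 := fun b hb => by
  simpa using Submodule.mul_mem_mul hb (one_mem_toSubmodule (O := O))

namespace IsFullIdeal

theorem left_eq {B : Submodule (ZS S) A} (h : IsFullIdeal O B) : 𝒪 * B = B :=
  le_antisymm h.left (le_order_mul B)

theorem right_eq {B : Submodule (ZS S) A} (h : IsFullIdeal O B) : B * 𝒪 = B :=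
  le_antisymm h.right (le_mul_order B)

theorem of_le {B C : Submodule (ZS S) A} (hB : IsFullIdeal O B) (hBC : B ≤ C) (hC : C ≤ 𝒪)
    (hl : 𝒪 * C ≤ C) (hr : C * 𝒪 ≤ C) : IsFullIdeal O C :=
  ⟨hC, hl, hr, let ⟨n, hn, h⟩ := hB.exists_int; ⟨n, hn, hBC h⟩⟩

theorem self : IsFullIdeal O 𝒪 :=
  ⟨le_rfl, (Subalgebra.mul_toSubmodule_le O O).trans (by simp),
    (Subalgebra.mul_toSubmodule_le O O).trans (by simp), 1, one_ne_zero, by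
      simp⟩

theorem mul {B C : Submodule (ZS S) A} (hB : IsFullIdeal O B) (hC : IsFullIdeal O C) :
    IsFullIdeal O (B * C) := by
  refine ⟨(mul_le_mul' hB.le hC.le).trans self.left, ?_, ?_, ?_⟩
  · rw [← mul_assoc, hB.left_eq]
  · rw [mul_assoc, hC.right_eq]
  · obtain ⟨n, hn, h⟩ := hB.exists_int
    obtain ⟨k, hk, h'⟩ := hC.exists_int
    exact ⟨n * k, mul_ne_zero hn hk, by push_cast; exact Submodule.mul_mem_mul h h'⟩

theorem inf {B C : Submodule (ZS S) A} (hB : IsFullIdeal O B) (hC : IsFullIdeal O C) :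
    IsFullIdeal O (B ⊓ C) :=
  (hB.mul hC).of_le (le_inf ((mul_le_mul_right hC.le B).trans hB.right)
      ((mul_le_mul_left hB.le C).trans hC.left)) (inf_le_left.trans hB.le)
    (le_inf ((mul_le_mul_right inf_le_left _).trans hB.left)
      ((mul_le_mul_right inf_le_right _).trans hC.left))
    (le_inf ((mul_le_mul_left inf_le_left _).trans hB.right)
      ((mul_le_mul_left inf_le_right _).trans hC.right))

theorem sup {B C : Submodule (ZS S) A} (hB : IsFullIdeal O B) (hC : IsFullIdeal O C) :
    IsFullIdeal O (B ⊔ C) :=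
  hB.of_le le_sup_left (sup_le hB.le hC.le)
    (by rw [Submodule.mul_sup, hB.left_eq, hC.left_eq])
    (by rw [Submodule.sup_mul, hB.right_eq, hC.right_eq])

end IsFullIdeal

theorem intCast_mul_inv {n : ℤ} (hn : n ≠ 0) : (n : A) * algebraMap ℚ A (n : ℚ)⁻¹ = 1 := by
  have : (n : A) = algebraMap ℚ A n := by simp
  rw [this, ← map_mul, mul_inv_cancel₀ (Int.cast_ne_zero.mpr hn), map_one]

/-- `L` lies in the lattice `n⁻¹ O`, which is finitely generated over the Noetherian ring `ℤ_S`. -/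
theorem isOrder_of_mul_intCast_mem (hO : IsOrder O) {L : Subalgebra (ZS S) A} (hL : O ≤ L) {n : ℤ}
    (hn : n ≠ 0) (h : ∀ x ∈ L, x * n ∈ O) : IsOrder L := by
  refine ⟨?_, top_le_iff.mp (hO.span_eq_top.ge.trans (Submodule.span_mono hL))⟩
  have hle : Subalgebra.toSubmodule L ≤
      (Subalgebra.toSubmodule O).map (LinearMap.mulRight (ZS S) (algebraMap ℚ A (n : ℚ)⁻¹)) := by
    intro x hx
    refine ⟨x * n, h x hx, ?_⟩
    simp only [LinearMap.mulRight_apply]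
    rw [mul_assoc, intCast_mul_inv hn, mul_one]
  have hfg := hO.fg.map (LinearMap.mulRight (ZS S) (algebraMap ℚ A (n : ℚ)⁻¹))
  exact isNoetherian_submodule.mp (isNoetherian_of_fg_of_noetherian _ hfg) _ hle

/-- The left multiplier ring of `B` contains `O`. It is an order because `B` contains a nonzero
integer, so maximality forces it to be `O`. -/
theorem IsMaximalOrder.mem_of_left (hO : IsMaximalOrder O) {B X : Submodule (ZS S) A}
    (hB : IsFullIdeal O B) (h : X * B ≤ B) : X ≤ 𝒪 := by
  let L : Subalgebra (ZS S) A :=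
    { carrier := {x | ∀ b ∈ B, x * b ∈ B}
      mul_mem' := fun {x y} hx hy b hb => by rw [mul_assoc]; exact hx _ (hy _ hb)
      add_mem' := fun {x y} hx hy b hb => by rw [add_mul]; exact B.add_mem (hx _ hb) (hy _ hb)
      algebraMap_mem' := fun r b hb => by rw [← Algebra.smul_def]; exact B.smul_mem _ hb }
  have hOL : O ≤ L := fun x hx b hb => hB.left (Submodule.mul_mem_mul hx hb)
  obtain ⟨n, hn, hnB⟩ := hB.exists_int
  have hL : IsOrder L := isOrder_of_mul_intCast_mem hO.prop hOL hn fun x hx => hB.le (hx _ hnB)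
  exact fun x hx => hO.le_of_ge hL hOL fun b hb => h (Submodule.mul_mem_mul hx hb)

theorem IsMaximalOrder.mem_of_right (hO : IsMaximalOrder O) {B X : Submodule (ZS S) A}
    (hB : IsFullIdeal O B) (h : B * X ≤ B) : X ≤ 𝒪 := by
  let L : Subalgebra (ZS S) A :=
    { carrier := {x | ∀ b ∈ B, b * x ∈ B}
      mul_mem' := fun {x y} hx hy b hb => by rw [← mul_assoc]; exact hy _ (hx _ hb)
      add_mem' := fun {x y} hx hy b hb => by rw [mul_add]; exact B.add_mem (hx _ hb) (hy _ hb)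
      algebraMap_mem' := fun r b hb => by
        rw [← Algebra.commutes, ← Algebra.smul_def]; exact B.smul_mem _ hb }
  have hOL : O ≤ L := fun x hx b hb => hB.right (Submodule.mul_mem_mul hb hx)
  obtain ⟨n, hn, hnB⟩ := hB.exists_int
  have hL : IsOrder L := isOrder_of_mul_intCast_mem hO.prop hOL hn fun x hx => by
    rw [← Int.cast_comm]; exact hB.le (hx _ hnB)
  exact fun x hx => hO.le_of_ge hL hOL fun b hb => h (Submodule.mul_mem_mul hb hx)

variable (O) in
/-- A maximal two-sided ideal of `O` that contains a nonzero integer. -/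
structure IsMaxIdeal (P : Submodule (ZS S) A) : Prop extends IsFullIdeal O P where
  ne : P ≠ 𝒪
  eq_or_eq : ∀ B, IsFullIdeal O B → P ≤ B → B = P ∨ B = 𝒪

/-- Maximal two-sided ideals are prime: if `P + B = O`, then `C = (P + B) C ≤ P`. -/
theorem IsMaxIdeal.le_or_le {P B C : Submodule (ZS S) A} (hP : IsMaxIdeal O P)
    (hB : IsFullIdeal O B) (hC : IsFullIdeal O C) (h : B * C ≤ P) : B ≤ P ∨ C ≤ P := by
  rcases hP.eq_or_eq _ (hP.toIsFullIdeal.sup hB) le_sup_left with h1 | h1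
  · exact Or.inl (by rw [← h1]; exact le_sup_right)
  · right
    rw [← hC.left_eq, ← h1, Submodule.sup_mul]
    exact sup_le ((mul_le_mul_right hC.le P).trans hP.right) h

variable (O) in
/-- The product of a list of ideals of `O`. -/
def idealProd (l : List (Submodule (ZS S) A)) : Submodule (ZS S) A := l.foldr (· * ·) 𝒪

@[simp] theorem idealProd_nil : idealProd O [] = 𝒪 := rfl

@[simp] theorem idealProd_cons (P : Submodule (ZS S) A) (l) :
    idealProd O (P :: l) = P * idealProd O l := rfl

theorem isFullIdeal_idealProd {l : List (Submodule (ZS S) A)} (h : ∀ P ∈ l, IsMaxIdeal O P) :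
    IsFullIdeal O (idealProd O l) := by
  induction l with
  | nil => exact IsFullIdeal.self
  | cons P l ih =>
    simp only [List.mem_cons, forall_eq_or_imp] at h
    exact h.1.toIsFullIdeal.mul (ih h.2)

theorem idealProd_append {l l' : List (Submodule (ZS S) A)} (h : ∀ P ∈ l', IsMaxIdeal O P) :
    idealProd O (l ++ l') = idealProd O l * idealProd O l' := by
  induction l with
  | nil => simp [(isFullIdeal_idealProd h).left_eq]
  | cons P l ih => simp [ih, mul_assoc]

theorem IsMaxIdeal.mem_of_idealProd_le {P : Submodule (ZS S) A} (hP : IsMaxIdeal O P)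
    {l : List (Submodule (ZS S) A)} (h : ∀ P ∈ l, IsMaxIdeal O P) (hl : idealProd O l ≤ P) :
    P ∈ l := by
  induction l with
  | nil => exact absurd (le_antisymm hP.le hl) hP.ne
  | cons Q l ih =>
    simp only [List.mem_cons, forall_eq_or_imp] at h
    rcases hP.le_or_le h.1.toIsFullIdeal (isFullIdeal_idealProd h.2) hl with h1 | h1
    · rcases h.1.eq_or_eq _ hP.toIsFullIdeal h1 with h2 | h2
      · simp [h2]
      · exact absurd h2 hP.ne
    · exact List.mem_cons_of_mem _ (ih h.2 h1)

variable (O) in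
/-- The annihilator in `O` of an `O`-module, as a subset of `A`. -/
def annIdeal (K : Type*) [AddCommGroup K] [Module O K] : Submodule (ZS S) A :=
  ((Module.annihilator O K).restrictScalars (ZS S)).map O.val.toLinearMap

theorem mem_annIdeal {K : Type*} [AddCommGroup K] [Module O K] {x : A} :
    x ∈ annIdeal O K ↔ ∃ y ∈ Module.annihilator O K, (y : A) = x := by
  simp [annIdeal]

theorem coe_mem_annIdeal {K : Type*} [AddCommGroup K] [Module O K] {x : O} :
    (x : A) ∈ annIdeal O K ↔ x ∈ Module.annihilator O K := by
  rw [mem_annIdeal]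
  exact ⟨fun ⟨y, hy, h⟩ => Subtype.ext h ▸ hy, fun h => ⟨x, h, rfl⟩⟩

theorem isFullIdeal_annIdeal {K : Type*} [AddCommGroup K] [Module O K] [Finite K] :
    IsFullIdeal O (annIdeal O K) := by
  refine ⟨?_, ?_, ?_, Nat.card K, by exact_mod_cast Nat.card_pos.ne', ?_⟩
  · rintro _ ⟨y, -, rfl⟩
    exact y.2
  · rw [Submodule.mul_le]
    rintro r hr _ ⟨y, hy, rfl⟩
    exact coe_mem_annIdeal.mpr (Ideal.mul_mem_left _ (⟨r, hr⟩ : O) hy)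
  · rw [Submodule.mul_le]
    rintro _ ⟨y, hy, rfl⟩ r hr
    exact coe_mem_annIdeal.mpr (Ideal.mul_mem_right (⟨r, hr⟩ : O) _ hy)
  · have : ((Nat.card K : O) : A) ∈ annIdeal O K := coe_mem_annIdeal.mpr
      (Module.mem_annihilator.mpr fun k => by rw [Nat.cast_smul_eq_nsmul]; exact card_nsmul_eq_zero')
    simpa using this

/-- The left ideal of `O` given by a two-sided ideal. -/
def IsFullIdeal.toIdeal {B : Submodule (ZS S) A} (h : IsFullIdeal O B) : Ideal O where
  carrier := {x | (x : A) ∈ B}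
  add_mem' := fun ha hb => B.add_mem ha hb
  zero_mem' := B.zero_mem
  smul_mem' := fun c _ hx => h.left (Submodule.mul_mem_mul c.2 hx)

/-- A proper two-sided `B` above `Ann K` lies in a maximal left ideal `m`, and being two-sided it
kills `O / m`. Then `Ann K` kills the simple module `O / m`, so `O / m ≃ K` and `B ≤ Ann K`. -/
theorem isMaxIdeal_annIdeal {K : Type*} [AddCommGroup K] [Module O K] [Finite K]
    [IsSimpleModule O K] : IsMaxIdeal O (annIdeal O K) := by
  refine ⟨isFullIdeal_annIdeal, fun h => ?_, fun B hB hle => ?_⟩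
  · have := IsSimpleModule.nontrivial O K
    obtain ⟨k, hk⟩ := exists_ne (0 : K)
    have h1 : ((1 : O) : A) ∈ annIdeal O K := by rw [h]; exact O.one_mem
    exact hk (by simpa using Module.mem_annihilator.mp (coe_mem_annIdeal.mp h1) k)
  · by_cases h1 : hB.toIdeal = ⊤
    · right
      refine le_antisymm hB.le fun x hx => ?_
      have : (⟨x, hx⟩ : O) ∈ hB.toIdeal := h1 ▸ Submodule.mem_top
      exact this
    · left
      obtain ⟨m, hm, hBm⟩ := Ideal.exists_le_maximal _ h1
      have : IsSimpleModule O (O ⧸ m) := isSimpleModule_iff_isCoatom.mpr hm.out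
      have hann : hB.toIdeal ≤ Module.annihilator O (O ⧸ m) := fun b hb =>
        Module.mem_annihilator.mpr fun k => by
          obtain ⟨r, rfl⟩ := Submodule.Quotient.mk_surjective _ k
          rw [← Submodule.Quotient.mk_smul, Submodule.Quotient.mk_eq_zero]
          exact hBm (hB.right (Submodule.mul_mem_mul hb r.2))
      have hKB : Module.annihilator O K ≤ hB.toIdeal := fun x hx =>
        hle (coe_mem_annIdeal.mpr hx)
      obtain ⟨f⟩ := nonempty_linearEquiv_of_annihilator_le (hKB.trans hann)
      refine le_antisymm (fun x hx => ?_) hle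
      have : (⟨x, hB.le hx⟩ : O) ∈ Module.annihilator O K := by
        rw [← f.annihilator_eq]; exact hann hx
      exact coe_mem_annIdeal.mpr this

/-- The factors are the annihilators of the simple quotients in a composition series, found by
induction on the order of `Y`. -/
theorem exists_idealProd_le_annIdeal (Y : Type*) [AddCommGroup Y] [Module O Y] [Finite Y] :
    ∃ l : List (Submodule (ZS S) A), (∀ P ∈ l, IsMaxIdeal O P) ∧ idealProd O l ≤ annIdeal O Y := by
  induction h : Nat.card Y using Nat.strong_induction_on generalizing Y with
  | _ n ih =>
    rcases subsingleton_or_nontrivial Y with hY | hY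
    · exact ⟨[], by simp, fun x hx => coe_mem_annIdeal (x := ⟨x, hx⟩).mpr
        (Module.mem_annihilator.mpr fun y => Subsingleton.elim _ _)⟩
    · obtain ⟨m, hm⟩ := IsCoatomic.exists_coatom (Submodule O Y)
      have : IsSimpleModule O (Y ⧸ m) := isSimpleModule_iff_isCoatom.mpr hm
      have hlt : Nat.card m < n := by
        rw [← h]
        obtain ⟨x, hx⟩ : ∃ x, x ∉ m := by
          by_contra! hx
          exact hm.1 (eq_top_iff.mpr fun x _ => hx x)
        exact Finite.card_subtype_lt hx
      have : Finite (Y ⧸ m) := Finite.of_surjective _ m.mkQ_surjective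
      obtain ⟨l, hl, hle⟩ := ih _ hlt m rfl
      refine ⟨l ++ [annIdeal O (Y ⧸ m)], ?_, ?_⟩
      · simp only [List.mem_append, List.mem_singleton]
        rintro P (hP | rfl)
        exacts [hl P hP, isMaxIdeal_annIdeal]
      · rw [idealProd_append (by simpa using isMaxIdeal_annIdeal), idealProd_cons, idealProd_nil,
          isFullIdeal_annIdeal.right_eq]
        refine (mul_le_mul_left hle _).trans ?_
        rw [Submodule.mul_le]
        rintro _ ⟨x, hx, rfl⟩ _ ⟨y, hy, rfl⟩
        refine (coe_mem_annIdeal (x := x * y)).mpr (Module.mem_annihilator.mpr fun k => ?_)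
        rw [mul_smul]
        have h1 : y • k ∈ m := by
          rw [← Submodule.Quotient.mk_eq_zero, Submodule.Quotient.mk_smul]
          exact Module.mem_annihilator.mp hy _
        exact congrArg Subtype.val (Module.mem_annihilator.mp hx (⟨_, h1⟩ : m))

end Orders

/-! ### Invertibility and commutativity of maximal two-sided ideals -/

section Orders

variable {A : Type*} [Ring A] [Algebra ℚ A] {S : Set Nat.Primes} {O : Subalgebra (ZS S) A}

local notation "𝒪" => Subalgebra.toSubmodule O

/-- The principal fractional ideal of `ℤ_S` in `A` generated by a rational number. -/
def scalarIdeal (A : Type*) [Ring A] [Algebra ℚ A] (S : Set Nat.Primes) (q : ℚ) :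
    Submodule (ZS S) A := Submodule.span (ZS S) {algebraMap ℚ A q}

theorem scalarIdeal_mul (q r : ℚ) : scalarIdeal A S q * scalarIdeal A S r = scalarIdeal A S (q * r) := by
  simp [scalarIdeal, Submodule.span_mul_span]

theorem scalarIdeal_one : scalarIdeal A S 1 = 1 := by
  simp [scalarIdeal, Submodule.one_eq_span]

theorem scalarIdeal_comm (q : ℚ) (B : Submodule (ZS S) A) :
    scalarIdeal A S q * B = B * scalarIdeal A S q := by
  have : ∀ x ∈ scalarIdeal A S q, ∀ b : A, x * b = b * x := by
    intro x hx b
    obtain ⟨c, rfl⟩ := Submodule.mem_span_singleton.mp hx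
    rw [smul_mul_assoc, mul_smul_comm, Algebra.commutes]
  apply le_antisymm <;> rw [Submodule.mul_le] <;> intro x hx y hy
  · rw [this x hx]; exact Submodule.mul_mem_mul hy hx
  · rw [← this y hy]; exact Submodule.mul_mem_mul hy hx

theorem scalarIdeal_inv_mul {n : ℤ} (hn : n ≠ 0) :
    scalarIdeal A S (n : ℚ)⁻¹ * scalarIdeal A S n = 1 := by
  rw [scalarIdeal_mul, inv_mul_cancel₀ (Int.cast_ne_zero.mpr hn), scalarIdeal_one]

theorem IsFullIdeal.scalarIdeal_mul_le {P : Submodule (ZS S) A} (hP : IsFullIdeal O P) {n : ℤ}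
    (hn : (n : A) ∈ P) : scalarIdeal A S n * 𝒪 ≤ P := by
  refine (mul_le_mul_left ?_ _).trans hP.right
  rw [scalarIdeal, Submodule.span_singleton_le_iff_mem]
  simpa using hn

theorem finite_quotient_intCast_smul (hfg : (𝒪).FG) {n : ℤ} (hn : n ≠ 0) :
    Finite (O ⧸ Ideal.span {(n : O)}) := by
  refine finite_of_fg_of_smul_eq_zero hfg hn fun x => ?_
  obtain ⟨y, rfl⟩ := Submodule.Quotient.mk_surjective _ x
  rw [← Submodule.Quotient.mk_smul, Submodule.Quotient.mk_eq_zero, zsmul_eq_mul, Int.cast_comm]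
  exact Ideal.mul_mem_left _ _ (Ideal.mem_span_singleton_self _)

/-- An element that kills the finite module `O / O n` kills the class of `1`, so it lies in `n O`.
-/
theorem exists_idealProd_le (hfg : (𝒪).FG) {n : ℤ} (hn : n ≠ 0) :
    ∃ l : List (Submodule (ZS S) A), (∀ P ∈ l, IsMaxIdeal O P) ∧
      idealProd O l ≤ scalarIdeal A S n * 𝒪 := by
  have := finite_quotient_intCast_smul hfg hn
  obtain ⟨l, hl, hle⟩ := exists_idealProd_le_annIdeal (O := O) (O ⧸ Ideal.span {(n : O)})
  refine ⟨l, hl, hle.trans ?_⟩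
  rintro _ ⟨y, hy, rfl⟩
  have h1 := Module.mem_annihilator.mp hy (Submodule.Quotient.mk 1)
  rw [← Submodule.Quotient.mk_smul, Submodule.Quotient.mk_eq_zero, smul_eq_mul, mul_one] at h1
  obtain ⟨z, rfl⟩ := Ideal.mem_span_singleton'.mp h1
  rw [← Int.cast_comm]
  refine Submodule.mul_mem_mul ?_ z.2
  simp [scalarIdeal]

/-- Maximal two-sided ideals of a maximal order are invertible. -/
theorem IsMaxIdeal.exists_inverse (hO : IsMaximalOrder O) {P : Submodule (ZS S) A}
    (hP : IsMaxIdeal O P) : ∃ D : Submodule (ZS S) A, 𝒪 ≤ D ∧ 𝒪 * D ≤ D ∧ D * 𝒪 ≤ D ∧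
      P * D = 𝒪 ∧ D * P = 𝒪 := by
  obtain ⟨n, hn, hnP⟩ := hP.exists_int
  set α := scalarIdeal A S n with hα
  set β := scalarIdeal A S (n : ℚ)⁻¹ with hβ
  have hβα : β * α = 1 := scalarIdeal_inv_mul hn
  have hαβ : α * β = 1 := by rw [← scalarIdeal_comm, hβα]
  have hex : ∃ k, ∃ l : List (Submodule (ZS S) A), l.length = k ∧ (∀ P ∈ l, IsMaxIdeal O P) ∧
      idealProd O l ≤ α * 𝒪 := by
    obtain ⟨l, h1, h2⟩ := exists_idealProd_le hO.prop.fg hn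
    exact ⟨_, l, rfl, h1, h2⟩
  classical
  obtain ⟨l, hlk, hl, hle⟩ := Nat.find_spec hex
  -- The list has minimal length among those with product inside `n O`. As `n O ≤ P` and `P` is
  -- prime, `P` is one of its factors. Removing it leaves `B` and `C`, and minimality says that `C *
  -- B` is not inside `n O`.
  have hmem : P ∈ l := hP.mem_of_idealProd_le hl
    (hle.trans (hP.toIsFullIdeal.scalarIdeal_mul_le hnP))
  obtain ⟨l₁, l₂, rfl⟩ := List.append_of_mem hmem
  have hl₁ : ∀ Q ∈ l₁, IsMaxIdeal O Q := fun Q hQ => hl Q (by simp [hQ])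
  have hl₂ : ∀ Q ∈ l₂, IsMaxIdeal O Q := fun Q hQ => hl Q (by simp [hQ])
  set B := idealProd O l₁ with hBdef
  set C := idealProd O l₂ with hCdef
  have hB : IsFullIdeal O B := isFullIdeal_idealProd hl₁
  have hC : IsFullIdeal O C := isFullIdeal_idealProd hl₂
  have hBPC : B * (P * C) ≤ α * 𝒪 := by
    rwa [idealProd_append (fun Q hQ => hl Q (List.mem_append_right _ hQ))] at hle
  have hCB : ¬ C * B ≤ α * 𝒪 := fun h => by
    refine Nat.find_min hex (m := (l₂ ++ l₁).length) ?_ ⟨l₂ ++ l₁, rfl, ?_, ?_⟩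
    · rw [← hlk]; simp; omega
    · intro Q hQ
      rcases List.mem_append.mp hQ with h | h
      exacts [hl₂ Q h, hl₁ Q h]
    · rwa [idealProd_append hl₁]
  -- `D = n⁻¹ C B` is not contained in `O`. Yet `B (P D) ≤ B` and `(D P) C ≤ C`, so maximality of
  -- the order puts both `P D` and `D P` in `O`.
  set D := C * β * B with hD
  have hBβ : β * B = B * β := scalarIdeal_comm _ _
  have hCβ : β * C = C * β := scalarIdeal_comm _ _
  have hPD : P * D ≤ 𝒪 := by
    refine hO.mem_of_right hB ?_
    have : B * (P * D) = B * (P * C) * (β * B) := by simp only [hD, mul_assoc]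
    rw [this]
    refine (mul_le_mul_left hBPC _).trans ?_
    rw [scalarIdeal_comm, mul_assoc, ← mul_assoc α, hαβ, one_mul]
    exact hB.left
  have hDP : D * P ≤ 𝒪 := by
    refine hO.mem_of_left hC ?_
    have : D * P * C = C * β * (B * (P * C)) := by simp only [hD, mul_assoc]
    rw [this]
    refine (mul_le_mul_right hBPC _).trans ?_
    rw [mul_assoc, ← mul_assoc β, hβα, one_mul]
    exact hC.right
  have hDO : ¬ D ≤ 𝒪 := fun h => hCB <| by
    have : C * B = α * D := by
      rw [hD, ← hCβ, ← mul_assoc, ← mul_assoc, hαβ, one_mul]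
    rw [this]
    exact mul_le_mul_right h α
  have hDl : 𝒪 * D ≤ D := by
    rw [hD, ← mul_assoc, ← mul_assoc, hC.left_eq]
  have hDr : D * 𝒪 ≤ D := by
    rw [hD, mul_assoc, hB.right_eq]
  have h𝒪 := IsFullIdeal.self (O := O)
  -- Adding `O` makes both products contain `P`, so each is `P` or `O`. If one were `P`, the
  -- multiplier argument would give `D ≤ O`.
  refine ⟨D ⊔ 𝒪, le_sup_right, ?_, ?_, ?_, ?_⟩
  · rw [Submodule.mul_sup]; exact sup_le_sup hDl h𝒪.left
  · rw [Submodule.sup_mul]; exact sup_le_sup hDr h𝒪.right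
  · have hfull : IsFullIdeal O (P * (D ⊔ 𝒪)) := by
      rw [Submodule.mul_sup, hP.toIsFullIdeal.right_eq]
      refine hP.toIsFullIdeal.of_le le_sup_right (sup_le hPD hP.le) ?_ ?_
      · rw [Submodule.mul_sup, hP.toIsFullIdeal.left_eq, ← mul_assoc, hP.toIsFullIdeal.left_eq]
      · rw [Submodule.sup_mul, hP.toIsFullIdeal.right_eq, mul_assoc]
        exact sup_le_sup_right (mul_le_mul_right hDr P) _
    refine (hP.eq_or_eq _ hfull ?_).resolve_left fun h => hDO ?_
    · rw [Submodule.mul_sup, hP.toIsFullIdeal.right_eq]; exact le_sup_right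
    · exact le_sup_left.trans (hO.mem_of_right hP.toIsFullIdeal h.le)
  · have hfull : IsFullIdeal O ((D ⊔ 𝒪) * P) := by
      rw [Submodule.sup_mul, hP.toIsFullIdeal.left_eq]
      refine hP.toIsFullIdeal.of_le le_sup_right (sup_le hDP hP.le) ?_ ?_
      · rw [Submodule.mul_sup, hP.toIsFullIdeal.left_eq, ← mul_assoc]
        exact sup_le_sup_right (mul_le_mul_left hDl P) _
      · rw [Submodule.sup_mul, hP.toIsFullIdeal.right_eq, mul_assoc, hP.toIsFullIdeal.right_eq]
    refine (hP.eq_or_eq _ hfull ?_).resolve_left fun h => hDO ?_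
    · rw [Submodule.sup_mul, hP.toIsFullIdeal.left_eq]; exact le_sup_right
    · exact le_sup_left.trans (hO.mem_of_left hP.toIsFullIdeal h.le)

/-- With `D` the inverse of `P`, the ideal `D (P ∩ Q)` is integral and its product with `P` lies in
`Q`. Since `Q` is prime and does not contain `P`, it contains `D (P ∩ Q)`. Multiplying back by `P`
gives the nontrivial inclusion. -/
theorem IsMaxIdeal.mul_eq_inf (hO : IsMaximalOrder O) {P Q : Submodule (ZS S) A}
    (hP : IsMaxIdeal O P) (hQ : IsMaxIdeal O Q) (hne : P ≠ Q) : P * Q = P ⊓ Q := by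
  have hPf := hP.toIsFullIdeal
  have hQf := hQ.toIsFullIdeal
  refine le_antisymm (le_inf ((mul_le_mul_right hQ.le P).trans hPf.right)
    ((mul_le_mul_left hP.le Q).trans hQf.left)) ?_
  obtain ⟨D, hOD, hDl, hDr, hPD, hDP⟩ := hP.exists_inverse hO
  have hinf := hPf.inf hQf
  have hle : P ⊓ Q ≤ D * (P ⊓ Q) := (le_order_mul _).trans (mul_le_mul_left hOD _)
  have hfull : IsFullIdeal O (D * (P ⊓ Q)) := by
    refine hinf.of_le hle ((mul_le_mul_right inf_le_left _).trans hDP.le) ?_ ?_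
    · rw [← mul_assoc]; exact mul_le_mul_left hDl _
    · rw [mul_assoc]; exact mul_le_mul_right hinf.right _
  have h1 : P * (D * (P ⊓ Q)) ≤ Q := by
    rw [← mul_assoc, hPD, hinf.left_eq]; exact inf_le_right
  have h2 : D * (P ⊓ Q) ≤ Q := (hQ.le_or_le hPf hfull h1).resolve_left fun h =>
    (hP.eq_or_eq _ hQf h).elim (fun h => hne h.symm) hQ.ne
  calc P ⊓ Q = P * (D * (P ⊓ Q)) := by rw [← mul_assoc, hPD, hinf.left_eq]
    _ ≤ P * Q := mul_le_mul_right h2 P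

theorem IsMaxIdeal.mul_comm (hO : IsMaximalOrder O) {P Q : Submodule (ZS S) A}
    (hP : IsMaxIdeal O P) (hQ : IsMaxIdeal O Q) : P * Q = Q * P := by
  by_cases hne : P = Q
  · rw [hne]
  · rw [hP.mul_eq_inf hO hQ hne, hQ.mul_eq_inf hO hP (Ne.symm hne), inf_comm]

end Orders

/-! ### The action of ideals on submodules of an `A`-module -/

section IdealAction

variable {Z A : Type*} [CommRing Z] [Ring A] [Algebra Z A] {O : Subalgebra Z A} {V : Type*}
  [AddCommGroup V] [Module A V] [Module Z V] [IsScalarTower Z A V]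

local notation "𝒪" => Subalgebra.toSubmodule O

/-- The product of a left-stable lattice in `A` with an `O`-submodule of an `A`-module. -/
def idealSMul (P : Submodule Z A) (hP : 𝒪 * P ≤ P) (N : Submodule O V) : Submodule O V :=
  { (P • N.restrictScalars Z).toAddSubmonoid with
    smul_mem' := fun c x hx => by
      have h : (c : A) • x ∈ 𝒪 • (P • N.restrictScalars Z) :=
        Submodule.smul_mem_smul c.2 hx
      rw [← Submodule.smul_assoc] at h
      exact Submodule.smul_mono_left hP h }

theorem mem_idealSMul {P : Submodule Z A} {hP : 𝒪 * P ≤ P} {N : Submodule O V} {x : V} :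
    x ∈ idealSMul P hP N ↔ x ∈ P • N.restrictScalars Z := Iff.rfl

theorem smul_mem_idealSMul {P : Submodule Z A} {hP : 𝒪 * P ≤ P} {N : Submodule O V} {r : A}
    (hr : r ∈ P) {x : V} (hx : x ∈ N) : r • x ∈ idealSMul P hP N :=
  mem_idealSMul.mpr (Submodule.smul_mem_smul hr (N := N.restrictScalars Z) hx)

theorem idealSMul_le_of_forall {P : Submodule Z A} {hP : 𝒪 * P ≤ P} {N N' : Submodule O V}
    (h : ∀ r ∈ P, ∀ x ∈ N, r • x ∈ N') : idealSMul P hP N ≤ N' :=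
  fun _ hx => (Submodule.smul_le (P := N'.restrictScalars Z)).mpr h hx

theorem idealSMul_mul {P Q : Submodule Z A} {hP : 𝒪 * P ≤ P} {hQ : 𝒪 * Q ≤ Q}
    (hPQ : 𝒪 * (P * Q) ≤ P * Q) (N : Submodule O V) :
    idealSMul (P * Q) hPQ N = idealSMul P hP (idealSMul Q hQ N) :=
  Submodule.restrictScalars_injective Z _ _ (Submodule.smul_assoc P Q (N.restrictScalars Z))

theorem hom_eq_zero_of_mem_idealSMul {P : Submodule Z A} {hP : 𝒪 * P ≤ P} {K : Type*}
    [AddCommGroup K] [Module O K] (h : ∀ r ∈ P, ∃ s ∈ Module.annihilator O K, (s : A) = r)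
    {N : Submodule O V} (f : N →ₗ[O] K) (x : N) (hx : (x : V) ∈ idealSMul P hP N) : f x = 0 := by
  have key : ∀ x ∈ P • N.restrictScalars Z, ∃ hx : x ∈ N, f ⟨x, hx⟩ = 0 := by
    intro x hx
    refine Submodule.smul_induction_on hx ?_ ?_
    · intro r hr n hn
      obtain ⟨s, hs, rfl⟩ := h r hr
      exact ⟨N.smul_mem s hn, (f.map_smul s ⟨n, hn⟩).trans (Module.mem_annihilator.mp hs _)⟩
    · rintro x y ⟨hx, h1⟩ ⟨hy, h2⟩
      refine ⟨N.add_mem hx hy, ?_⟩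
      have := f.map_add ⟨x, hx⟩ ⟨y, hy⟩
      rw [h1, h2, add_zero] at this
      exact this
  exact (key x hx).2

theorem restrictScalars_idealSMul {P : Submodule Z A} {hP : 𝒪 * P ≤ P} {N : Submodule O V} :
    (idealSMul P hP N).restrictScalars Z = P • N.restrictScalars Z := rfl

theorem idealSMul_mono {P : Submodule Z A} {hP : 𝒪 * P ≤ P} {N N' : Submodule O V}
    (h : N ≤ N') : idealSMul P hP N ≤ idealSMul P hP N' :=
  fun _ hx => Submodule.smul_mono le_rfl (show N.restrictScalars Z ≤ N'.restrictScalars Z from h) hx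

theorem order_smul (N : Submodule O V) : 𝒪 • N.restrictScalars Z = N.restrictScalars Z := by
  refine le_antisymm (Submodule.smul_le.mpr fun r hr x hx => N.smul_mem (⟨r, hr⟩ : O) hx)
    fun x hx => ?_
  rw [← one_smul A x]
  exact Submodule.smul_mem_smul O.one_mem hx

theorem idealSMul_idealSMul_of_mul_eq {P D : Submodule Z A} {hP : 𝒪 * P ≤ P} {hD : 𝒪 * D ≤ D}
    (h : D * P = 𝒪) (N : Submodule O V) : idealSMul D hD (idealSMul P hP N) = N := by
  refine Submodule.restrictScalars_injective Z _ _ ?_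
  rw [restrictScalars_idealSMul, restrictScalars_idealSMul, ← Submodule.smul_assoc,
    smul_eq_mul, h, order_smul]

/-- Multiplication by an invertible ideal permutes the submodules. -/
def idealSMulOrderIso {P D : Submodule Z A} (hP : 𝒪 * P ≤ P) (hD : 𝒪 * D ≤ D)
    (h : D * P = 𝒪) (h' : P * D = 𝒪) : Submodule O V ≃o Submodule O V where
  toFun := idealSMul P hP
  invFun := idealSMul D hD
  left_inv := idealSMul_idealSMul_of_mul_eq h
  right_inv := idealSMul_idealSMul_of_mul_eq h'
  map_rel_iff' := fun {N N'} => by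
    refine ⟨fun hle => ?_, idealSMul_mono (hP := hP)⟩
    have := idealSMul_mono (hP := hD) hle
    rwa [Equiv.coe_fn_mk, idealSMul_idealSMul_of_mul_eq h, idealSMul_idealSMul_of_mul_eq h] at this

theorem idealSMul_le {P : Submodule Z A} {hP : 𝒪 * P ≤ P} (hle : P ≤ 𝒪)
    (N : Submodule O V) : idealSMul P hP N ≤ N := fun x hx => by
  have h : x ∈ 𝒪 • N.restrictScalars Z := Submodule.smul_mono_left hle hx
  rwa [order_smul] at h

end IdealAction

/-! ### Relative indices of submodules -/

section RelativeIndex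

universe v

variable {R : Type*} {V : Type v} [Ring R] [AddCommGroup V] [Module R V]

/-- The index of a submodule in another one. -/
def relIdx (N' N : Submodule R V) : ℕ := N'.toAddSubgroup.relIndex N.toAddSubgroup

theorem relIdx_eq_card (N' N : Submodule R V) : relIdx N' N = Nat.card (N ⧸ N'.submoduleOf N) := rfl

theorem relIdx_mul_relIdx {L M N : Submodule R V} (h : L ≤ M) (h' : M ≤ N) :
    relIdx L M * relIdx M N = relIdx L N := AddSubgroup.relIndex_mul_relIndex _ _ _ h h'

theorem relIdx_self (N : Submodule R V) : relIdx N N = 1 := AddSubgroup.relIndex_self _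

theorem relIdx_eq_one {N' N : Submodule R V} : relIdx N' N = 1 ↔ N ≤ N' :=
  AddSubgroup.relIndex_eq_one

/-- An intermediate proper submodule of least index works: indices multiply, so anything strictly
between it and `N` would have smaller index. -/
theorem exists_covBy_of_relIdx_ne_zero {N' N : Submodule R V} (h : N' < N) (h0 : relIdx N' N ≠ 0) :
    ∃ M, N' ≤ M ∧ M ⋖ N := by
  classical
  have hex : ∃ k, ∃ M, N' ≤ M ∧ M < N ∧ relIdx M N = k := ⟨_, N', le_rfl, h, rfl⟩
  obtain ⟨M, h1, h2, h3⟩ := Nat.find_spec hex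
  refine ⟨M, h1, h2, fun L hML hLN => ?_⟩
  have hmul := relIdx_mul_relIdx hML.le hLN.le
  have hM0 : relIdx M N ≠ 0 := fun h => h0 (by rw [← relIdx_mul_relIdx h1 h2.le, h, mul_zero])
  have hL0 : relIdx L N ≠ 0 := fun h => hM0 (by rw [← hmul, h, mul_zero])
  have hm0 : relIdx M L ≠ 0 := fun h => hM0 (by rw [← hmul, h, zero_mul])
  have hm1 : relIdx M L ≠ 1 := fun h => hML.not_ge (relIdx_eq_one.mp h)
  refine Nat.find_min hex (m := relIdx L N) ?_ ⟨L, h1.trans hML.le, hLN, rfl⟩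
  rw [← h3, ← hmul]
  exact lt_mul_of_one_lt_left (Nat.pos_of_ne_zero hL0) (by omega)

theorem mem_annihilator_quotient_submoduleOf {N' N : Submodule R V} {r : R} :
    r ∈ Module.annihilator R (N ⧸ N'.submoduleOf N) ↔ ∀ x ∈ N, r • x ∈ N' := by
  rw [Module.mem_annihilator]
  constructor
  · intro h x hx
    have h1 := h (Submodule.Quotient.mk ⟨x, hx⟩)
    rw [← Submodule.Quotient.mk_smul, Submodule.Quotient.mk_eq_zero] at h1
    exact h1
  · intro h y
    obtain ⟨⟨x, hx⟩, rfl⟩ := Submodule.Quotient.mk_surjective _ y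
    rw [← Submodule.Quotient.mk_smul, Submodule.Quotient.mk_eq_zero]
    exact h x hx

/-- Two covering pairs have the same index if the factors have comparable annihilators. -/
theorem relIdx_eq_of_covBy {N' N M' M : Submodule R V} (h : N' ⋖ N) (h' : M' ⋖ M)
    (h0 : relIdx N' N ≠ 0) (hann : ∀ r : R, (∀ x ∈ N, r • x ∈ N') → ∀ x ∈ M, r • x ∈ M') :
    relIdx M' M = relIdx N' N := by
  rw [relIdx_eq_card] at h0 ⊢
  rw [relIdx_eq_card]
  have : IsSimpleModule R (N ⧸ N'.submoduleOf N) := (covBy_iff_quot_is_simple h.le).mp h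
  have : IsSimpleModule R (M ⧸ M'.submoduleOf M) := (covBy_iff_quot_is_simple h'.le).mp h'
  have : Finite (N ⧸ N'.submoduleOf N) := Nat.finite_of_card_ne_zero h0
  obtain ⟨f⟩ := nonempty_linearEquiv_of_annihilator_le (K := N ⧸ N'.submoduleOf N)
    (K' := M ⧸ M'.submoduleOf M) fun r hr => mem_annihilator_quotient_submoduleOf.mpr
      (hann r (mem_annihilator_quotient_submoduleOf.mp hr))
  exact Nat.card_congr f.toEquiv

theorem exists_simple_of_covBy {N' N : Submodule R V} (h : N' ⋖ N) (h0 : relIdx N' N ≠ 0) :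
    ∃ (K : Type v) (_ : AddCommGroup K) (_ : Module R K), Finite K ∧ IsSimpleModule R K ∧
      ∀ r, r ∈ Module.annihilator R K ↔ ∀ x ∈ N, r • x ∈ N' :=
  ⟨N ⧸ N'.submoduleOf N, inferInstance, inferInstance, Nat.finite_of_card_ne_zero h0,
    (covBy_iff_quot_is_simple h.le).mp h, fun _ => mem_annihilator_quotient_submoduleOf⟩

theorem card_hom_eq_of_relIdx_eq {K : Type*} [AddCommGroup K] [Module R K] [Finite K]
    [IsSimpleModule R K] {N N₁ M M₁ : Submodule R V}
    (hN : ∀ (f : N →ₗ[R] K) (x : N), (x : V) ∈ N₁ → f x = 0)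
    (hM : ∀ (f : M →ₗ[R] K) (x : M), (x : V) ∈ M₁ → f x = 0)
    (hN' : ∀ r ∈ Module.annihilator R K, ∀ x ∈ N, r • x ∈ N₁)
    (hM' : ∀ r ∈ Module.annihilator R K, ∀ x ∈ M, r • x ∈ M₁)
    (h0 : relIdx M₁ M ≠ 0) (h : relIdx N₁ N = relIdx M₁ M) :
    Nat.card (N →ₗ[R] K) = Nat.card (M →ₗ[R] K) := by
  have h0' : relIdx N₁ N ≠ 0 := h ▸ h0
  rw [relIdx_eq_card] at h0 h0'
  rw [relIdx_eq_card, relIdx_eq_card] at h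
  have := Nat.finite_of_card_ne_zero h0
  have := Nat.finite_of_card_ne_zero h0'
  rw [card_hom_quotient (N₁.submoduleOf N) (fun f x hx => hN f x hx),
    card_hom_quotient (M₁.submoduleOf M) (fun f x hx => hM f x hx)]
  exact card_hom_eq_of_card_eq
    (fun r hr => mem_annihilator_quotient_submoduleOf.mpr (hN' r hr))
    (fun r hr => mem_annihilator_quotient_submoduleOf.mpr (hM' r hr)) h

theorem relIdx_ne_zero_of_smul_mem {Z : Type*} [CommRing Z] [Algebra Z R] [Module.Finite Z R]
    {n : ℤ} (hn : Finite (Z ⧸ Ideal.span {(n : Z)})) {N N₁ : Submodule R V} (hfg : N.FG)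
    (h : ∀ x ∈ N, n • x ∈ N₁) : relIdx N₁ N ≠ 0 := by
  have : Module.Finite R N := Module.Finite.iff_fg.mpr hfg
  have : Finite (N ⧸ N₁.submoduleOf N) := by
    refine finite_of_algebra_finite (Z := Z) (R := R) hn fun y => ?_
    obtain ⟨⟨x, hx⟩, rfl⟩ := Submodule.Quotient.mk_surjective _ y
    rw [← Submodule.Quotient.mk_smul, Submodule.Quotient.mk_eq_zero]
    exact h x hx
  rw [relIdx_eq_card]
  exact Nat.card_pos.ne'

theorem relIdx_map_ne_zero {W : Type*} [AddCommGroup W] [Module R W] (j : W →ₗ[R] V)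
    (N : Submodule R W) [Finite (W ⧸ N)] : relIdx (N.map j) ((⊤ : Submodule R W).map j) ≠ 0 := by
  have : Finite (((⊤ : Submodule R W).map j) ⧸
      (N.map j).submoduleOf ((⊤ : Submodule R W).map j)) := by
    refine Finite.of_surjective (fun y : W ⧸ N => Submodule.Quotient.mk
      ⟨j y.out, Submodule.mem_map_of_mem Submodule.mem_top⟩) fun y => ?_
    obtain ⟨⟨_, ⟨x, -, rfl⟩⟩, rfl⟩ := Submodule.Quotient.mk_surjective _ y
    refine ⟨Submodule.Quotient.mk x, ?_⟩
    rw [Submodule.Quotient.eq]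
    have h1 : Submodule.Quotient.mk (p := N) (Submodule.Quotient.mk (p := N) x).out =
        Submodule.Quotient.mk x := Quotient.out_eq _
    refine ⟨_, (Submodule.Quotient.eq _).mp h1, ?_⟩
    rw [map_sub]; rfl
  rw [relIdx_eq_card]
  exact Nat.card_pos.ne'

theorem card_hom_map {W K : Type*} [AddCommGroup W] [Module R W] [AddCommGroup K] [Module R K]
    (j : W →ₗ[R] V) (hj : Function.Injective j) (N : Submodule R W) :
    Nat.card (N.map j →ₗ[R] K) = Nat.card (N →ₗ[R] K) :=
  (card_hom_congr (N.equivMapOfInjective j hj)).symm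

theorem card_hom_top {W K : Type*} [AddCommGroup W] [Module R W] [AddCommGroup K] [Module R K] :
    Nat.card ((⊤ : Submodule R W) →ₗ[R] K) = Nat.card (W →ₗ[R] K) :=
  card_hom_congr Submodule.topEquiv

end RelativeIndex

/-! ### Homomorphisms from commensurable lattices to a simple module -/

section Lattices

variable {A : Type*} [Ring A] [Algebra ℚ A] {S : Set Nat.Primes} {O : Subalgebra (ZS S) A}
  {V : Type*} [AddCommGroup V] [Module A V] [Module (ZS S) V] [IsScalarTower (ZS S) A V]

/-- Let `Q` be the annihilator of the simple module `N / N'`. Since ideals commute, `Q P N = P Q N ≤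
P N'`, so `Q` also kills `P N / P N'`. The latter is simple because multiplication by `P` is an
automorphism of the lattice of submodules, so the two factors are isomorphic. -/
theorem relIdx_idealSMul_of_covBy (hO : IsMaximalOrder O) {P : Submodule (ZS S) A}
    (hP : IsMaxIdeal O P) {N' N : Submodule O V} (h : N' ⋖ N) (h0 : relIdx N' N ≠ 0) :
    relIdx (idealSMul P hP.left N') (idealSMul P hP.left N) = relIdx N' N := by
  obtain ⟨D, -, hD, -, hPD, hDP⟩ := hP.exists_inverse hO
  have hcov : idealSMul P hP.left N' ⋖ idealSMul P hP.left N :=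
    (apply_covBy_apply_iff (idealSMulOrderIso hP.left hD hDP hPD)).mpr h
  obtain ⟨K, _, _, _, _, hK⟩ := exists_simple_of_covBy h h0
  refine relIdx_eq_of_covBy h hcov h0 fun r hr x hx => ?_
  have hQ : IsMaxIdeal O (annIdeal O K) := isMaxIdeal_annIdeal
  have hQN : idealSMul _ hQ.left N ≤ N' := idealSMul_le_of_forall (by
    rintro _ ⟨r, hr, rfl⟩ x hx
    exact (hK r).mp hr x hx)
  refine idealSMul_mono hQN ?_
  have hPQ := (hP.toIsFullIdeal.mul hQ.toIsFullIdeal).left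
  have hQP := (hQ.toIsFullIdeal.mul hP.toIsFullIdeal).left
  have hcomm : idealSMul _ hQP N = idealSMul _ hPQ N := by
    simp only [hP.mul_comm hO hQ]
  rw [← idealSMul_mul hPQ, ← hcomm, idealSMul_mul (hP := hQ.left) (hQ := hP.left)]
  exact smul_mem_idealSMul (coe_mem_annIdeal.mpr ((hK r).mpr hr)) hx

/-- Multiplication by an invertible ideal preserves indices. -/
theorem relIdx_idealSMul (hO : IsMaximalOrder O) {P : Submodule (ZS S) A}
    (hP : IsMaxIdeal O P) {N' N : Submodule O V} (h : N' ≤ N) (h0 : relIdx N' N ≠ 0) :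
    relIdx (idealSMul P hP.left N') (idealSMul P hP.left N) = relIdx N' N := by
  induction hk : relIdx N' N using Nat.strong_induction_on generalizing N with
  | _ k ih =>
    subst hk
    rcases h.eq_or_lt with rfl | hlt
    · rw [relIdx_self, relIdx_self]
    · obtain ⟨M, h1, h2⟩ := exists_covBy_of_relIdx_ne_zero hlt h0
      have hmul := relIdx_mul_relIdx h1 h2.le
      have ha : relIdx N' M ≠ 0 := fun h => h0 (by rw [← hmul, h, zero_mul])
      have hb : relIdx M N ≠ 0 := fun h => h0 (by rw [← hmul, h, mul_zero])
      have hb1 : relIdx M N ≠ 1 := fun h => h2.lt.not_ge (relIdx_eq_one.mp h)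
      have hlt' : relIdx N' M < relIdx N' N := by
        rw [← hmul]
        exact lt_mul_of_one_lt_right (Nat.pos_of_ne_zero ha) (by omega)
      rw [← relIdx_mul_relIdx (idealSMul_mono h1) (idealSMul_mono h2.le), ih _ hlt' h1 ha rfl,
        relIdx_idealSMul_of_covBy hO hP h2 hb, hmul]

theorem relIdx_idealSMul_ne_zero (hO : IsMaximalOrder O) {P : Submodule (ZS S) A}
    (hP : IsFullIdeal O P) {N : Submodule O V} (hfg : N.FG) :
    relIdx (idealSMul P hP.left N) N ≠ 0 := by
  obtain ⟨n, hn, hnP⟩ := hP.exists_int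
  have : Module.Finite (ZS S) O := Module.Finite.iff_fg.mpr hO.prop.fg
  refine relIdx_ne_zero_of_smul_mem (finite_quotient_span_intCast (S := S) hn) hfg fun x hx => ?_
  have h1 : (n : A) • x ∈ idealSMul P hP.left N := smul_mem_idealSMul hnP hx
  rwa [Int.cast_smul_eq_zsmul] at h1

/-- The index `[N : P N']` is computed through `P N` and through `N'`, and the common factor `[P N :
P N'] = [N : N']` cancels. -/
theorem relIdx_idealSMul_self (hO : IsMaximalOrder O) {P : Submodule (ZS S) A}
    (hP : IsMaxIdeal O P) {N' N : Submodule O V} (h : N' ≤ N) (h0 : relIdx N' N ≠ 0) :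
    relIdx (idealSMul P hP.left N') N' = relIdx (idealSMul P hP.left N) N := by
  have e1 := relIdx_idealSMul hO hP h h0
  have e2 := relIdx_mul_relIdx (idealSMul_mono (hP := hP.left) h) (idealSMul_le hP.le N)
  have e3 := relIdx_mul_relIdx (idealSMul_le (hP := hP.left) hP.le N') h
  rw [e1, ← e3, mul_comm] at e2
  exact (mul_right_cancel₀ h0 e2).symm

/-- Commensurable lattices have equally many homomorphisms to a finite simple module. -/
theorem card_hom_eq_of_relIdx_ne_zero (hO : IsMaximalOrder O) {K : Type*} [AddCommGroup K]
    [Module O K] [Finite K] [IsSimpleModule O K] {N' N : Submodule O V} (h : N' ≤ N)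
    (h0 : relIdx N' N ≠ 0) (hfg : N.FG) : Nat.card (N' →ₗ[O] K) = Nat.card (N →ₗ[O] K) := by
  have hP : IsMaxIdeal O (annIdeal O K) := isMaxIdeal_annIdeal
  have hann : ∀ r ∈ annIdeal O K, ∃ s ∈ Module.annihilator O K, (s : A) = r :=
    fun _ => mem_annIdeal.mp
  have hsmul : ∀ M : Submodule O V, ∀ r ∈ Module.annihilator O K, ∀ x ∈ M,
      r • x ∈ idealSMul _ hP.left M := fun M r hr x hx =>
    smul_mem_idealSMul (coe_mem_annIdeal.mpr hr) hx
  have hhom : ∀ (M : Submodule O V) (f : M →ₗ[O] K) (x : M),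
      (x : V) ∈ idealSMul _ hP.left M → f x = 0 := fun M f x hx =>
    hom_eq_zero_of_mem_idealSMul hann f x hx
  exact card_hom_eq_of_relIdx_eq (R := O) (hhom N') (hhom N) (hsmul N') (hsmul N)
    (relIdx_idealSMul_ne_zero hO hP.toIsFullIdeal hfg) (relIdx_idealSMul_self hO hP h h0)

variable (O) in
/-- The inclusion of `O ^ d` in `A ^ d`. -/
def freeInclusion (d : ℕ) : (Fin d → O) →ₗ[O] (Fin d → A) where
  toFun x i := x i
  map_add' _ _ := rfl
  map_smul' _ _ := rfl

theorem freeInclusion_injective (d : ℕ) : Function.Injective (freeInclusion O d) :=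
  fun _ _ h => funext fun i => Subtype.ext (congrFun h i)

/-- A submodule of finite index in a free module has as many homomorphisms to a finite simple
module as the free module. -/
theorem card_hom_eq_of_finite_quotient (hO : IsMaximalOrder O) {K : Type*} [AddCommGroup K]
    [Module O K] [Finite K] [IsSimpleModule O K] {d : ℕ} (N : Submodule O (Fin d → O))
    [Finite ((Fin d → O) ⧸ N)] : Nat.card (N →ₗ[O] K) = Nat.card ((Fin d → O) →ₗ[O] K) := by
  have hj := freeInclusion_injective (O := O) d
  have h0 := relIdx_map_ne_zero (freeInclusion O d) N
  rw [← card_hom_map _ hj N, ← card_hom_top, ← card_hom_map _ hj ⊤]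
  exact card_hom_eq_of_relIdx_ne_zero hO (Submodule.map_mono le_top) h0
    (Module.Finite.fg_top.map _)

end Lattices

/-! ### Counting surjections to extensions -/

section Extensions

variable {R : Type*} [Ring R] {Q F M X E : Type*} [AddCommGroup Q] [Module R Q]
  [AddCommGroup F] [Module R F] [AddCommGroup M] [Module R M] [AddCommGroup X] [Module R X]
  [AddCommGroup E] [Module R E]

theorem exists_comp_eq_of_ker_le {σ : Q →ₗ[R] X} (hσ : Function.Surjective σ) (f : Q →ₗ[R] E)
    (h : LinearMap.ker σ ≤ LinearMap.ker f) : ∃ g : X →ₗ[R] E, ∀ y, g (σ y) = f y := by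
  refine ⟨(LinearMap.ker σ).liftQ f h ∘ₗ (σ.quotKerEquivOfSurjective hσ).symm.toLinearMap,
    fun y => ?_⟩
  have : (σ.quotKerEquivOfSurjective hσ).symm (σ y) = Submodule.Quotient.mk y := by
    rw [LinearEquiv.symm_apply_eq]; rfl
  simp only [LinearMap.comp_apply, LinearEquiv.coe_coe, this]
  rfl

theorem exists_comp_eq_of_range_le {ι : M →ₗ[R] E} (hι : Function.Injective ι) (f : X →ₗ[R] E)
    (h : ∀ x, f x ∈ LinearMap.range ι) : ∃ g : X →ₗ[R] M, ∀ x, ι (g x) = f x := by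
  refine ⟨(LinearEquiv.ofInjective ι hι).symm.toLinearMap ∘ₗ f.codRestrict _ h, fun x => ?_⟩
  have := (LinearEquiv.ofInjective ι hι).apply_symm_apply (f.codRestrict _ h x)
  exact congrArg Subtype.val this

/-- Given an extension `E` of `F` by `M` with class `η`, the surjections `X → E` above a surjection
`φ : X → F` correspond to pairs of maps `ker φ → M`, `Q → M`. -/
theorem card_surjective_lifts {p : Q →ₗ[R] F} {φ : X →ₗ[R] F} (hφ : Function.Surjective φ)
    {s : Q →ₗ[R] X} (hs : ∀ y, φ (s y) = p y) (hp : Function.Surjective p)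
    {ι : M →ₗ[R] E} (hι : Function.Injective ι) {π : E →ₗ[R] F}
    (hker : LinearMap.range ι = LinearMap.ker π) {κ : Q →ₗ[R] E} (hκ : ∀ y, π (κ y) = p y)
    {η : LinearMap.ker p →ₗ[R] M} (hη : ∀ y : LinearMap.ker p, κ y = ι (η y)) :
    Nat.card {θ : X →ₗ[R] E // Function.Surjective θ ∧ ∀ x, π (θ x) = φ x} =
      Nat.card {q : (LinearMap.ker φ →ₗ[R] M) × (Q →ₗ[R] M) // Function.Surjective q.1 ∧
        ∀ y : LinearMap.ker p, η y = q.1 ⟨s y, by rw [LinearMap.mem_ker, hs]; exact y.2⟩ - q.2 y} := by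
  have hmem : ∀ z, π z = 0 → z ∈ LinearMap.range ι := fun z hz => hker ▸ hz
  have hπι : ∀ m, π (ι m) = 0 := fun m => by
    have : ι m ∈ LinearMap.ker π := hker ▸ ⟨m, rfl⟩
    exact this
  have h1 : ∀ θ : {θ : X →ₗ[R] E // Function.Surjective θ ∧ ∀ x, π (θ x) = φ x},
      ∃ ψ : LinearMap.ker φ →ₗ[R] M, ∀ k, ι (ψ k) = θ.1 k := fun θ =>
    exists_comp_eq_of_range_le hι (θ.1 ∘ₗ (LinearMap.ker φ).subtype) fun k =>
      hmem _ (by rw [LinearMap.comp_apply, θ.2.2]; exact k.2)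
  have h2 : ∀ θ : {θ : X →ₗ[R] E // Function.Surjective θ ∧ ∀ x, π (θ x) = φ x},
      ∃ h : Q →ₗ[R] M, ∀ y, ι (h y) = θ.1 (s y) - κ y := fun θ =>
    exists_comp_eq_of_range_le hι (θ.1 ∘ₗ s - κ) fun y =>
      hmem _ (by simp [θ.2.2, hs, hκ])
  choose ψ hψ using h1
  choose h hh using h2
  have hσ : ∀ x, ∃ y : Q, ∃ k : LinearMap.ker φ, x = s y + k := fun x => by
    obtain ⟨y, hy⟩ := hp (φ x)
    exact ⟨y, ⟨x - s y, by simp [hs, hy]⟩, by simp⟩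
  refine Nat.card_congr (Equiv.ofBijective (fun θ => ⟨(ψ θ, h θ), ?_, ?_⟩) ⟨?_, ?_⟩)
  · intro m
    obtain ⟨x, hx⟩ := θ.2.1 (ι m)
    have hxk : φ x = 0 := by rw [← θ.2.2, hx, hπι]
    exact ⟨⟨x, hxk⟩, hι (by rw [hψ, hx])⟩
  · intro y
    apply hι
    rw [map_sub, hψ, hh, ← hη]
    simp
  · intro θ θ' heq
    simp only [Subtype.mk.injEq, Prod.mk.injEq] at heq
    refine Subtype.ext (LinearMap.ext fun x => ?_)
    obtain ⟨y, k, rfl⟩ := hσ x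
    rw [map_add, map_add, ← hψ, ← hψ, heq.1]
    have e1 := hh θ y
    have e2 := hh θ' y
    rw [heq.2, e2] at e1
    rw [sub_left_injective e1]
  · rintro ⟨⟨ψ', h'⟩, hsurj, hc⟩
    have hsig : Function.Surjective (s.coprod (LinearMap.ker φ).subtype) := fun x => by
      obtain ⟨y, k, rfl⟩ := hσ x
      exact ⟨(y, k), by simp⟩
    -- `Q × ker φ → X` is onto, with kernel the pairs `(y, -s y)` for `y ∈ ker p`. The map built
    -- from `h'` and `ψ'` vanishes on these exactly when `η y = ψ' (s y) - h' y`.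
    obtain ⟨θ, hθ⟩ := exists_comp_eq_of_ker_le hsig ((κ + ι ∘ₗ h').coprod (ι ∘ₗ ψ')) (by
      intro ⟨y, k⟩ hyk
      simp only [LinearMap.mem_ker, LinearMap.coprod_apply, Submodule.subtype_apply] at hyk ⊢
      have hy : p y = 0 := by
        have := congrArg φ hyk
        rw [map_add, hs, k.2, add_zero, map_zero] at this
        exact this
      have hk : k = -(⟨s y, by rw [LinearMap.mem_ker, hs, hy]⟩ : LinearMap.ker φ) :=
        Subtype.ext (eq_neg_of_add_eq_zero_right hyk)
      have e1 := hc ⟨y, hy⟩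
      have e2 := hη ⟨y, hy⟩
      simp only [LinearMap.add_apply, LinearMap.comp_apply] at e1 e2 ⊢
      rw [hk, map_neg, e2, e1, ← map_add, ← map_add]
      simp)
    have hθ' : ∀ (y : Q) (k : LinearMap.ker φ), θ (s y + k) = κ y + ι (h' y) + ι (ψ' k) := fun y k => by
      simpa using hθ (y, k)
    have hπθ : ∀ x, π (θ x) = φ x := fun x => by
      obtain ⟨y, k, rfl⟩ := hσ x
      rw [hθ', map_add, map_add, hπι, hπι, hκ, map_add, hs, k.2]
      simp
    have hθk : ∀ k : LinearMap.ker φ, θ k = ι (ψ' k) := fun k => by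
      simpa using hθ' 0 k
    have hθs : ∀ y, θ (s y) = κ y + ι (h' y) := fun y => by
      simpa using hθ' y 0
    have hθsurj : Function.Surjective θ := fun z => by
      obtain ⟨x, hx⟩ := hφ (π z)
      obtain ⟨m, hm⟩ := hmem (z - θ x) (by rw [map_sub, hπθ, hx, sub_self])
      obtain ⟨k, rfl⟩ := hsurj m
      exact ⟨x + k, by rw [map_add, hθk, hm]; abel⟩
    refine ⟨⟨θ, hθsurj, hπθ⟩, Subtype.ext (Prod.ext ?_ ?_)⟩
    · ext k
      exact hι (by rw [hψ, hθk])
    · ext y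
      exact hι (by rw [hh, hθs]; simp)

variable (p : Q →ₗ[R] F)

/-- The relations defining the pushout of `Q ← ker p → M`. -/
def pushoutRel (η : LinearMap.ker p →ₗ[R] M) : Submodule R (Q × M) :=
  LinearMap.range ((LinearMap.ker p).subtype.prod (-η))

/-- The extension of `F` by `M` obtained by pushing out `ker p → Q → F` along `η`. -/
abbrev Pushout (η : LinearMap.ker p →ₗ[R] M) : Type _ := (Q × M) ⧸ pushoutRel p η

/-- The inclusion of `M` in the extension. -/
def Pushout.inl (η : LinearMap.ker p →ₗ[R] M) : M →ₗ[R] Pushout p η :=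
  (pushoutRel p η).mkQ ∘ₗ LinearMap.inr R Q M

/-- The canonical map from `Q` to the extension. -/
def Pushout.lift (η : LinearMap.ker p →ₗ[R] M) : Q →ₗ[R] Pushout p η :=
  (pushoutRel p η).mkQ ∘ₗ LinearMap.inl R Q M

/-- The projection of the extension to `F`. -/
def Pushout.proj (η : LinearMap.ker p →ₗ[R] M) : Pushout p η →ₗ[R] F :=
  (pushoutRel p η).liftQ (p ∘ₗ LinearMap.fst R Q M) (by
    rintro _ ⟨y, rfl⟩
    simp)

variable {p}

theorem Pushout.inl_injective (η : LinearMap.ker p →ₗ[R] M) :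
    Function.Injective (Pushout.inl p η) := by
  rw [← LinearMap.ker_eq_bot, LinearMap.ker_eq_bot']
  intro m hm
  rw [Pushout.inl, LinearMap.comp_apply, Submodule.mkQ_apply, Submodule.Quotient.mk_eq_zero] at hm
  obtain ⟨y, hy⟩ := hm
  have h1 : (y : Q) = 0 := congrArg Prod.fst hy
  have h2 : -η y = m := congrArg Prod.snd hy
  have : y = 0 := Subtype.ext h1
  rw [← h2, this, map_zero, neg_zero]

theorem Pushout.lift_apply_ker (η : LinearMap.ker p →ₗ[R] M) (y : LinearMap.ker p) :
    Pushout.lift p η y = Pushout.inl p η (η y) := by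
  simp only [Pushout.lift, Pushout.inl, LinearMap.comp_apply, Submodule.mkQ_apply]
  rw [Submodule.Quotient.eq]
  exact ⟨y, by simp⟩

theorem Pushout.proj_lift (η : LinearMap.ker p →ₗ[R] M) (y : Q) :
    Pushout.proj p η (Pushout.lift p η y) = p y := by
  simp [Pushout.proj, Pushout.lift]

theorem Pushout.range_inl (η : LinearMap.ker p →ₗ[R] M) :
    LinearMap.range (Pushout.inl p η) = LinearMap.ker (Pushout.proj p η) := by
  apply le_antisymm
  · rintro _ ⟨m, rfl⟩
    simp [Pushout.proj, Pushout.inl]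
  · intro z hz
    obtain ⟨⟨y, m⟩, rfl⟩ := Submodule.Quotient.mk_surjective _ z
    have hy : p y = 0 := by simpa [Pushout.proj] using hz
    have h1 := Pushout.lift_apply_ker η ⟨y, hy⟩
    refine ⟨η ⟨y, hy⟩ + m, ?_⟩
    rw [map_add, ← h1]
    simp only [Pushout.lift, Pushout.inl, LinearMap.comp_apply, Submodule.mkQ_apply]
    rw [← Submodule.Quotient.mk_add]
    simp

theorem Pushout.proj_surjective (hp : Function.Surjective p) (η : LinearMap.ker p →ₗ[R] M) :
    Function.Surjective (Pushout.proj p η) := fun z => by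
  obtain ⟨y, rfl⟩ := hp z
  exact ⟨_, Pushout.proj_lift η y⟩

theorem Pushout.finite [Finite F] [Finite M] (hp : Function.Surjective p)
    (η : LinearMap.ker p →ₗ[R] M) : Finite (Pushout p η) := by
  choose t ht using hp
  refine Finite.of_surjective
    (fun z : F × M => Pushout.lift p η (t z.1) + Pushout.inl p η z.2) fun z => ?_
  obtain ⟨m, hm⟩ : z - Pushout.lift p η (t (Pushout.proj p η z)) ∈
      LinearMap.range (Pushout.inl p η) := by
    rw [Pushout.range_inl, LinearMap.mem_ker, map_sub, Pushout.proj_lift, ht, sub_self]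
  exact ⟨(Pushout.proj p η z, m), by simp [hm]⟩

theorem card_surjective_eq_sum_lifts [Finite X] [Finite E] [Finite F] {π : E →ₗ[R] F}
    (hπ : Function.Surjective π) [Fintype {φ : X →ₗ[R] F // Function.Surjective φ}] :
    Nat.card {θ : X →ₗ[R] E // Function.Surjective θ} =
      ∑ φ : {φ : X →ₗ[R] F // Function.Surjective φ},
        Nat.card {θ : X →ₗ[R] E // Function.Surjective θ ∧ ∀ x, π (θ x) = φ.1 x} := by
  let f : {θ : X →ₗ[R] E // Function.Surjective θ} → {φ : X →ₗ[R] F // Function.Surjective φ} :=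
    fun θ => ⟨π ∘ₗ θ.1, by rw [LinearMap.coe_comp]; exact hπ.comp θ.2⟩
  rw [← Nat.card_congr (Equiv.sigmaFiberEquiv f), Nat.card_sigma]
  refine Finset.sum_congr rfl fun φ _ => Nat.card_congr
    { toFun := fun θ => ⟨θ.1.1, θ.1.2, fun x => LinearMap.congr_fun (congrArg Subtype.val θ.2) x⟩
      invFun := fun θ => ⟨⟨θ.1, θ.2.1⟩, Subtype.ext (LinearMap.ext θ.2.2)⟩
      left_inv := fun θ => rfl
      right_inv := fun θ => rfl }

/-- The number of surjections `X → E` for all extensions `E` of `F` by `M`, in terms of the kernels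
of the surjections `X → F`. -/
theorem sum_card_surjective_pushout [Module.Projective R Q] (hp : Function.Surjective p)
    [Finite X] [Finite M] [Finite F] [Fintype (LinearMap.ker p →ₗ[R] M)]
    [Fintype {φ : X →ₗ[R] F // Function.Surjective φ}] [Finite (Q →ₗ[R] M)] :
    ∑ η : LinearMap.ker p →ₗ[R] M, Nat.card {θ : X →ₗ[R] Pushout p η // Function.Surjective θ} =
      (∑ φ : {φ : X →ₗ[R] F // Function.Surjective φ},
        Nat.card {ψ : LinearMap.ker φ.1 →ₗ[R] M // Function.Surjective ψ}) *
          Nat.card (Q →ₗ[R] M) := by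
  have hlift : ∀ φ : {φ : X →ₗ[R] F // Function.Surjective φ}, ∃ s : Q →ₗ[R] X,
      ∀ y, φ.1 (s y) = p y := fun φ => by
    obtain ⟨s, hs⟩ := Module.projective_lifting_property φ.1 p φ.2
    exact ⟨s, fun y => LinearMap.congr_fun hs y⟩
  choose s hs using hlift
  have h1 : ∀ η : LinearMap.ker p →ₗ[R] M,
      Nat.card {θ : X →ₗ[R] Pushout p η // Function.Surjective θ} =
        ∑ φ : {φ : X →ₗ[R] F // Function.Surjective φ},
          Nat.card {q : (LinearMap.ker φ.1 →ₗ[R] M) × (Q →ₗ[R] M) // Function.Surjective q.1 ∧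
            ∀ y : LinearMap.ker p,
              η y = q.1 ⟨s φ y, by rw [LinearMap.mem_ker, hs]; exact y.2⟩ - q.2 y} := by
    intro η
    have := Pushout.finite hp η
    rw [card_surjective_eq_sum_lifts (Pushout.proj_surjective hp η)]
    exact Finset.sum_congr rfl fun φ _ => card_surjective_lifts φ.2 (hs φ) hp
      (Pushout.inl_injective η) (Pushout.range_inl η) (Pushout.proj_lift η)
      (Pushout.lift_apply_ker η)
  rw [Finset.sum_congr rfl fun η _ => h1 η, Finset.sum_comm, Finset.sum_mul]
  refine Finset.sum_congr rfl fun φ _ => ?_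
  have hmem : ∀ y : LinearMap.ker p, s φ y ∈ LinearMap.ker φ.1 := fun y => by
    rw [LinearMap.mem_ker, hs]; exact y.2
  -- Every pair `(ψ, h)` is compatible with exactly one `η`, so summing over `η` removes the
  -- compatibility condition and leaves a free product.
  let g : {ψ : LinearMap.ker φ.1 →ₗ[R] M // Function.Surjective ψ} × (Q →ₗ[R] M) →
      (LinearMap.ker p →ₗ[R] M) := fun q =>
    q.1.1 ∘ₗ (s φ ∘ₗ (LinearMap.ker p).subtype).codRestrict _ hmem - q.2 ∘ₗ (LinearMap.ker p).subtype
  rw [← Nat.card_prod, ← Nat.card_congr (Equiv.sigmaFiberEquiv g), Nat.card_sigma]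
  refine Finset.sum_congr rfl fun η _ => Nat.card_congr
    { toFun := fun q => ⟨(⟨q.1.1, q.2.1⟩, q.1.2), LinearMap.ext fun y => (q.2.2 y).symm⟩
      invFun := fun q => ⟨(q.1.1.1, q.1.2), q.1.1.2, fun y => (LinearMap.congr_fun q.2 y).symm⟩
      left_inv := fun θ => rfl
      right_inv := fun θ => rfl }

end Extensions

/-! ### Surjections to a product with a simple factor -/

section Surjections

variable {R : Type*} [Ring R] {N M K : Type*} [AddCommGroup N] [Module R N]
  [AddCommGroup M] [Module R M] [AddCommGroup K] [Module R K]

/-- If `f` is nonzero on `ker ψ`, its restriction there is already onto the simple module `K`, so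
the first coordinate can be corrected without changing the second. -/
theorem surjective_prod_iff [IsSimpleModule R K] {f : N →ₗ[R] K} {ψ : N →ₗ[R] M} :
    Function.Surjective (f.prod ψ) ↔
      Function.Surjective ψ ∧ ¬ LinearMap.ker ψ ≤ LinearMap.ker f := by
  have := IsSimpleModule.nontrivial R K
  constructor
  · intro h
    refine ⟨fun m => ?_, fun hle => ?_⟩
    · obtain ⟨x, hx⟩ := h (0, m)
      exact ⟨x, congrArg Prod.snd hx⟩
    · obtain ⟨k, hk⟩ := exists_ne (0 : K)
      obtain ⟨x, hx⟩ := h (k, 0)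
      have h1 : f x = k := congrArg Prod.fst hx
      have h2 : ψ x = 0 := congrArg Prod.snd hx
      exact hk (h1.symm.trans (hle h2))
  · rintro ⟨hψ, hle⟩ ⟨k, m⟩
    obtain ⟨x, rfl⟩ := hψ m
    have h0 : f ∘ₗ (LinearMap.ker ψ).subtype ≠ 0 := fun h => hle fun z hz =>
      LinearMap.congr_fun h ⟨z, hz⟩
    obtain ⟨z, hz⟩ := LinearMap.surjective_of_ne_zero h0 (k - f x)
    refine ⟨x + z, Prod.ext ?_ ?_⟩
    · change f (x + z) = k
      have : f z = k - f x := hz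
      rw [map_add, this]
      abel
    · change ψ (x + z) = ψ x
      rw [map_add, z.2, add_zero]

theorem card_hom_ker_le {ψ : N →ₗ[R] M} (hψ : Function.Surjective ψ) :
    Nat.card {f : N →ₗ[R] K // LinearMap.ker ψ ≤ LinearMap.ker f} = Nat.card (M →ₗ[R] K) := by
  symm
  refine Nat.card_congr (Equiv.ofBijective (fun g => ⟨g ∘ₗ ψ, fun x hx => ?_⟩) ⟨?_, ?_⟩)
  · rw [LinearMap.mem_ker] at hx ⊢
    simp [hx]
  · intro g g' h
    ext m
    obtain ⟨x, rfl⟩ := hψ m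
    exact LinearMap.congr_fun (congrArg Subtype.val h) x
  · rintro ⟨f, hf⟩
    obtain ⟨g, hg⟩ := exists_comp_eq_of_ker_le hψ f hf
    exact ⟨g, Subtype.ext (LinearMap.ext hg)⟩

/-- The number of surjections to `K × M`, where `K` is simple. -/
theorem card_surjective_prod [IsSimpleModule R K] [Finite N] [Finite K] [Finite M] :
    (Nat.card {θ : N →ₗ[R] K × M // Function.Surjective θ} : ℝ) =
      Nat.card {ψ : N →ₗ[R] M // Function.Surjective ψ} *
        ((Nat.card (N →ₗ[R] K) : ℝ) - Nat.card (M →ₗ[R] K)) := by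
  classical
  have := Fintype.ofFinite {ψ : N →ₗ[R] M // Function.Surjective ψ}
  have hsurj : ∀ θ : {θ : N →ₗ[R] K × M // Function.Surjective θ},
      Function.Surjective (LinearMap.snd R K M ∘ₗ θ.1) ∧
        ¬ LinearMap.ker (LinearMap.snd R K M ∘ₗ θ.1) ≤ LinearMap.ker (LinearMap.fst R K M ∘ₗ θ.1) :=
    fun θ => surjective_prod_iff.mp θ.2
  have e : {θ : N →ₗ[R] K × M // Function.Surjective θ} ≃
      Σ ψ : {ψ : N →ₗ[R] M // Function.Surjective ψ},
        {f : N →ₗ[R] K // ¬ LinearMap.ker ψ.1 ≤ LinearMap.ker f} :=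
    { toFun := fun θ => ⟨⟨LinearMap.snd R K M ∘ₗ θ.1, (hsurj θ).1⟩,
        LinearMap.fst R K M ∘ₗ θ.1, (hsurj θ).2⟩
      invFun := fun q => ⟨q.2.1.prod q.1.1, surjective_prod_iff.mpr ⟨q.1.2, q.2.2⟩⟩
      left_inv := fun θ => rfl
      right_inv := fun q => rfl }
  have h1 : ∀ ψ : {ψ : N →ₗ[R] M // Function.Surjective ψ},
      (Nat.card {f : N →ₗ[R] K // ¬ LinearMap.ker ψ.1 ≤ LinearMap.ker f} : ℝ) =
        (Nat.card (N →ₗ[R] K) : ℝ) - Nat.card (M →ₗ[R] K) := by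
    intro ψ
    have := Nat.card_congr (Equiv.sumCompl
      (fun f : N →ₗ[R] K => LinearMap.ker ψ.1 ≤ LinearMap.ker f))
    rw [Nat.card_sum, card_hom_ker_le ψ.2] at this
    rw [← this]
    push_cast
    ring
  rw [Nat.card_congr e, Nat.card_sigma]
  push_cast
  rw [Finset.sum_congr rfl fun ψ _ => h1 ψ]
  simp only [Nat.card_eq_fintype_card, Finset.sum_const, Finset.card_univ, nsmul_eq_mul]

end Surjections

/-! ### Surjections to semisimple modules -/

section SemisimpleModules

variable {R : Type*} [Ring R] {ι : Type*} (K : ι → FiniteModule R)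

/-- The direct sum of the modules `K i`, for `i` in a list. -/
def sumOfList : List ι → FiniteModule R
  | [] => ⟨PUnit⟩
  | i :: l => ⟨K i × sumOfList l⟩

theorem card_hom_sumOfList {Q : Type*} [AddCommGroup Q] [Module R Q] (l : List ι) :
    Nat.card (Q →ₗ[R] sumOfList K l) = (l.map fun i => Nat.card (Q →ₗ[R] K i)).prod := by
  induction l with
  | nil =>
    have : Unique (Q →ₗ[R] sumOfList K []) :=
      ⟨⟨0⟩, fun f => LinearMap.ext fun x => Subsingleton.elim (α := PUnit) _ _⟩
    simp
  | cons i l ih =>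
    rw [List.map_cons, List.prod_cons, ← ih, ← Nat.card_prod]
    exact Nat.card_congr (LinearMap.prodEquiv (R := R) (M := Q) (M₂ := K i) (M₃ := sumOfList K l) ℕ).symm.toEquiv

variable {K} [DecidableEq ι]

theorem card_hom_of_sumOfList (hK : ∀ i, IsSimpleModule R (K i))
    (hne : ∀ i j, Iso (K i) (K j) → i = j) (l : List ι) (i : ι) :
    Nat.card (sumOfList K l →ₗ[R] K i) = endCard R (K i) ^ l.count i := by
  induction l with
  | nil =>
    have : Unique (sumOfList K [] →ₗ[R] K i) :=
      ⟨⟨0⟩, fun f => LinearMap.ext fun x => by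
        rw [Subsingleton.elim (α := PUnit) x (0 : sumOfList K []), map_zero, map_zero]⟩
    simp
  | cons j l ih =>
    have h1 : Nat.card (sumOfList K (j :: l) →ₗ[R] K i) =
        Nat.card (K j →ₗ[R] K i) * Nat.card (sumOfList K l →ₗ[R] K i) := by
      rw [← Nat.card_prod]
      exact Nat.card_congr (LinearMap.coprodEquiv (R := R) (M := K j) (M₂ := sumOfList K l)
        (M₃ := K i) ℕ).symm.toEquiv
    rw [h1, ih, List.count_cons]
    by_cases hij : j = i
    · subst hij
      simp [endCard, pow_succ']
    · have : Unique (K j →ₗ[R] K i) :=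
        ⟨⟨0⟩, fun f => by
          by_contra hf
          have := hK i
          have := hK j
          exact hij (hne j i ⟨LinearEquiv.ofBijective f (LinearMap.bijective_of_ne_zero hf)⟩)⟩
      simp [hij]

/-- The number of surjections to a semisimple module. -/
theorem card_surjective_sumOfList (hK : ∀ i, IsSimpleModule R (K i))
    (hne : ∀ i j, Iso (K i) (K j) → i = j) [Fintype ι] {N : Type*} [AddCommGroup N] [Module R N] [Finite N]
    (l : List ι) :
    (Nat.card {θ : N →ₗ[R] sumOfList K l // Function.Surjective θ} : ℝ) =
      ∏ i, ∏ j ∈ Finset.range (l.count i),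
        ((Nat.card (N →ₗ[R] K i) : ℝ) - (endCard R (K i) : ℝ) ^ j) := by
  induction l with
  | nil =>
    have : Unique {θ : N →ₗ[R] sumOfList K [] // Function.Surjective θ} :=
      ⟨⟨0, fun x => ⟨0, Subsingleton.elim (α := PUnit) _ _⟩⟩,
        fun f => Subtype.ext (LinearMap.ext fun x => Subsingleton.elim (α := PUnit) _ _)⟩
    simp
  | cons i l ih =>
    have := hK i
    have h1 := card_surjective_prod (R := R) (N := N) (K := K i) (M := sumOfList K l)
    rw [ih, card_hom_of_sumOfList hK hne] at h1
    refine h1.trans ?_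
    have h2 : ∀ k, ∏ j ∈ Finset.range ((i :: l).count k),
        ((Nat.card (N →ₗ[R] K k) : ℝ) - (endCard R (K k) : ℝ) ^ j) =
      (∏ j ∈ Finset.range (l.count k),
        ((Nat.card (N →ₗ[R] K k) : ℝ) - (endCard R (K k) : ℝ) ^ j)) *
          if k = i then ((Nat.card (N →ₗ[R] K i) : ℝ) - (endCard R (K i) : ℝ) ^ l.count i) else 1 := by
      intro k
      by_cases hk : k = i
      · subst hk
        simp [Finset.prod_range_succ]
      · simp [hk, Ne.symm hk]
    rw [Finset.prod_congr rfl fun k _ => h2 k, Finset.prod_mul_distrib, Finset.prod_ite_eq']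
    simp

end SemisimpleModules

/-! ### The `q`-analogue of the Bonferroni inequalities -/

section Sieve

/-- The `q`-binomial type product `∏_{j < d} (Q - q ^ j) / (q ^ (j + 1) - 1)`. -/
def sieveTerm (q Q : ℝ) (d : ℕ) : ℝ := ∏ j ∈ Finset.range d, (Q - q ^ j) / (q ^ (j + 1) - 1)

/-- The alternating partial sums of `sieveTerm`. -/
def sieveSum (q Q : ℝ) (D : ℕ) : ℝ := ∑ d ∈ Finset.range (D + 1), (-1) ^ d * sieveTerm q Q d

theorem pow_sub_one_pos {q : ℝ} (hq : 1 < q) (j : ℕ) : 0 < q ^ (j + 1) - 1 :=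
  sub_pos.mpr (one_lt_pow₀ hq (Nat.succ_ne_zero j))

/-- A `q`-analogue of `∑_{d ≤ D} (-1)^d (r choose d) = (-1)^D (r - 1 choose D)`, proved by induction
on `D`. -/
theorem sieveSum_eq {q : ℝ} (hq : 1 < q) (Q : ℝ) (D : ℕ) :
    sieveSum q Q D = ∏ j ∈ Finset.range D, (-((Q - q ^ (j + 1)) / (q ^ (j + 1) - 1))) := by
  induction D with
  | zero => simp [sieveSum, sieveTerm]
  | succ D ih =>
    have h1 : sieveSum q Q (D + 1) = sieveSum q Q D + (-1) ^ (D + 1) * sieveTerm q Q (D + 1) := by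
      rw [sieveSum, Finset.sum_range_succ]; rfl
    have h2 : sieveTerm q Q (D + 1) =
        (Q - 1) / (q ^ (D + 1) - 1) * ∏ j ∈ Finset.range D, ((Q - q ^ (j + 1)) / (q ^ (j + 1) - 1)) := by
      rw [sieveTerm, Finset.prod_div_distrib, Finset.prod_range_succ', Finset.prod_range_succ,
        Finset.prod_div_distrib]
      simp only [pow_zero]
      rw [mul_comm, mul_comm (∏ j ∈ Finset.range D, (q ^ (j + 1) - 1)), mul_div_mul_comm]
    rw [h1, ih, h2, Finset.prod_range_succ, Finset.prod_neg]
    have := (pow_sub_one_pos hq D).ne'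
    simp only [Finset.card_range]
    field_simp
    ring

theorem sieveTerm_nonneg {q : ℝ} (hq : 1 < q) (r d : ℕ) : 0 ≤ sieveTerm q (q ^ r) d := by
  by_cases h : r < d
  · rw [sieveTerm, Finset.prod_eq_zero (Finset.mem_range.mpr h) (by simp)]
  · refine Finset.prod_nonneg fun j hj => div_nonneg (sub_nonneg.mpr ?_) (pow_sub_one_pos hq j).le
    exact pow_le_pow_right₀ hq.le (by have := Finset.mem_range.mp hj; omega)

/-- By the product formula the alternating sum is `1` for `r = 0` and has a zero factor for `1 ≤ r ≤
D`. For `r > D`, the next term is its absolute value times `(q^r - 1) / (q^(D+1) - 1) ≥ 1`. -/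
theorem abs_indicator_sub_sieveSum_le {q : ℝ} (hq : 1 < q) (r D : ℕ) :
    |(if r = 0 then 1 else 0) - sieveSum q (q ^ r) D| ≤ sieveTerm q (q ^ r) (D + 1) := by
  rw [sieveSum_eq hq]
  rcases Nat.eq_zero_or_pos r with rfl | hr
  · have : ∏ j ∈ Finset.range D, (-((q ^ 0 - q ^ (j + 1)) / (q ^ (j + 1) - 1))) = 1 := by
      refine Finset.prod_eq_one fun j _ => ?_
      have := (pow_sub_one_pos hq j).ne'
      field_simp
      ring
    rw [this]
    simpa using sieveTerm_nonneg hq 0 (D + 1)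
  · rw [if_neg hr.ne', zero_sub, abs_neg]
    by_cases hD : r ≤ D
    · rw [Finset.prod_eq_zero (Finset.mem_range.mpr (show r - 1 < D by omega))
        (by rw [Nat.sub_add_cancel hr]; simp), abs_zero]
      exact sieveTerm_nonneg hq _ _
    · have hnn : ∀ j ∈ Finset.range D, 0 ≤ (q ^ r - q ^ (j + 1)) / (q ^ (j + 1) - 1) := fun j hj =>
        div_nonneg (sub_nonneg.mpr (pow_le_pow_right₀ hq.le
          (by have := Finset.mem_range.mp hj; omega))) (pow_sub_one_pos hq j).le
      have h2 : sieveTerm q (q ^ r) (D + 1) = (q ^ r - 1) / (q ^ (D + 1) - 1) *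
          ∏ j ∈ Finset.range D, ((q ^ r - q ^ (j + 1)) / (q ^ (j + 1) - 1)) := by
        rw [sieveTerm, Finset.prod_div_distrib, Finset.prod_range_succ', Finset.prod_range_succ,
          Finset.prod_div_distrib]
        simp only [pow_zero]
        rw [mul_comm, mul_comm (∏ j ∈ Finset.range D, (q ^ (j + 1) - 1)), mul_div_mul_comm]
      rw [h2, Finset.abs_prod, Finset.prod_congr rfl fun j hj => by
        rw [abs_neg, abs_of_nonneg (hnn j hj)]]
      refine le_mul_of_one_le_left (Finset.prod_nonneg hnn) ?_
      rw [one_le_div (pow_sub_one_pos hq D)]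
      exact sub_le_sub_right (pow_le_pow_right₀ hq.le (by omega)) 1

/-- Used to pass from one simple module to all of them. The second bound is carried along because
replacing one factor at a time leaves a partial product of the `a i` to estimate. -/
theorem abs_prod_sub_prod_le {ι : Type*} (s : Finset ι) {a b ε : ι → ℝ}
    (hb : ∀ i ∈ s, |b i| ≤ 1) (h : ∀ i ∈ s, |b i - a i| ≤ ε i) :
    |∏ i ∈ s, b i - ∏ i ∈ s, a i| ≤ ∏ i ∈ s, (1 + ε i) - 1 ∧ |∏ i ∈ s, a i| ≤ ∏ i ∈ s, (1 + ε i) := by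
  classical
  induction s using Finset.induction_on with
  | empty => simp
  | insert i s hi ih =>
    simp only [Finset.mem_insert, forall_eq_or_imp] at hb h
    obtain ⟨ih1, ih2⟩ := ih hb.2 h.2
    have hε : 0 ≤ ε i := (abs_nonneg _).trans h.1
    have ha : |a i| ≤ 1 + ε i := by
      have := abs_sub_abs_le_abs_sub (a i) (b i)
      rw [abs_sub_comm] at this
      linarith [h.1, hb.1]
    rw [Finset.prod_insert hi, Finset.prod_insert hi, Finset.prod_insert hi]
    refine ⟨?_, ?_⟩
    · calc |b i * ∏ i ∈ s, b i - a i * ∏ i ∈ s, a i|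
          = |b i * (∏ i ∈ s, b i - ∏ i ∈ s, a i) + (b i - a i) * ∏ i ∈ s, a i| := by ring_nf
        _ ≤ |b i| * |∏ i ∈ s, b i - ∏ i ∈ s, a i| + |b i - a i| * |∏ i ∈ s, a i| := by
          rw [← abs_mul, ← abs_mul]; exact abs_add_le _ _
        _ ≤ 1 * (∏ i ∈ s, (1 + ε i) - 1) + ε i * ∏ i ∈ s, (1 + ε i) := by
          gcongr
          · exact hb.1
          · exact h.1
        _ = (1 + ε i) * ∏ i ∈ s, (1 + ε i) - 1 := by ring
    · rw [abs_mul]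
      exact mul_le_mul ha ih2 (abs_nonneg _) (by linarith)

/-- The limiting expectation of `sieveTerm`. -/
def limitTerm (q x : ℝ) (d : ℕ) : ℝ := ∏ j ∈ Finset.range d, x / (q ^ (j + 1) - 1)

variable {q x : ℝ}

theorem limitTerm_succ (q x : ℝ) (d : ℕ) :
    limitTerm q x (d + 1) = limitTerm q x d * (x / (q ^ (d + 1) - 1)) := Finset.prod_range_succ _ _

theorem limitTerm_pos (hq : 2 ≤ q) (hx : 0 < x) (d : ℕ) : 0 < limitTerm q x d :=
  Finset.prod_pos fun j _ => div_pos hx (pow_sub_one_pos (by linarith) j)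

theorem limit_factor_le (hq : 2 ≤ q) (hx1 : x ≤ 1) (d : ℕ) :
    x / (q ^ (d + 1) - 1) ≤ (1 / 2) ^ d := by
  have h1 : (2 : ℝ) ^ d ≤ q ^ (d + 1) - 1 := by
    have h2 : (2 : ℝ) ^ (d + 1) ≤ q ^ (d + 1) := pow_le_pow_left₀ (by norm_num) hq _
    have h3 : (1 : ℝ) ≤ 2 ^ d := one_le_pow₀ (by norm_num)
    rw [pow_succ] at h2
    linarith
  rw [one_div, inv_pow, ← one_div]
  exact div_le_div₀ zero_le_one hx1 (by positivity) h1

theorem limitTerm_antitone (hq : 2 ≤ q) (hx : 0 < x) (hx1 : x ≤ 1) : Antitone (limitTerm q x) := by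
  refine antitone_nat_of_succ_le fun d => ?_
  rw [limitTerm_succ]
  refine mul_le_of_le_one_right (limitTerm_pos hq hx d).le ?_
  exact (limit_factor_le hq hx1 d).trans (pow_le_one₀ (by norm_num) (by norm_num))

theorem limitTerm_le (hq : 2 ≤ q) (hx : 0 < x) (hx1 : x ≤ 1) (d : ℕ) :
    limitTerm q x (d + 1) ≤ (1 / 2) ^ d := by
  rw [limitTerm_succ]
  have h1 : limitTerm q x d ≤ 1 := by
    simpa [limitTerm] using limitTerm_antitone hq hx hx1 (Nat.zero_le d)
  calc _ ≤ 1 * (1 / 2 : ℝ) ^ d := mul_le_mul h1 (limit_factor_le hq hx1 d)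
        (div_pos hx (pow_sub_one_pos (by linarith) d)).le zero_le_one
    _ = _ := one_mul _

theorem tendsto_limitTerm (hq : 2 ≤ q) (hx : 0 < x) (hx1 : x ≤ 1) :
    Tendsto (limitTerm q x) atTop (𝓝 0) := by
  rw [← tendsto_add_atTop_iff_nat 1]
  exact squeeze_zero (fun d => (limitTerm_pos hq hx _).le) (limitTerm_le hq hx hx1)
    (tendsto_pow_atTop_nhds_zero_of_lt_one (by norm_num) (by norm_num))

theorem exists_pos_tendsto_sum_limitTerm (hq : 2 ≤ q) (hx : 0 < x) (hx1 : x ≤ 1) :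
    ∃ c : ℝ, 0 < c ∧
      Tendsto (fun D => ∑ d ∈ Finset.range (D + 1), (-1) ^ d * limitTerm q x d) atTop (𝓝 c) := by
  have ha := limitTerm_antitone hq hx hx1
  obtain ⟨c, hc⟩ := ha.tendsto_alternating_series_of_tendsto_zero (tendsto_limitTerm hq hx hx1)
  refine ⟨c, ?_, (tendsto_add_atTop_iff_nat 1).mpr hc⟩
  -- Four terms are needed: for `q = 2` and `x = 1` the first two terms are equal and give only `c ≥
  -- 0`. The third is strictly larger than the fourth.
  have h4 := ha.alternating_series_le_tendsto hc 2
  have h0 : limitTerm q x 0 = 1 := by simp [limitTerm]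
  have h01 : limitTerm q x 1 ≤ limitTerm q x 0 := ha (by norm_num)
  have h23 : limitTerm q x 3 ≤ limitTerm q x 2 * (1 / 2) ^ 2 := by
    rw [limitTerm_succ q x 2]
    exact mul_le_mul_of_nonneg_left (limit_factor_le hq hx1 2) (limitTerm_pos hq hx 2).le
  have h2 := limitTerm_pos hq hx 2
  simp only [Finset.sum_range_succ, Nat.reduceMul, Finset.sum_range_zero] at h4
  norm_num at h4 h23
  linarith

end Sieve

universe u

/-! ### Finiteness of sets of isomorphism classes -/

section FiniteModules

variable {R : Type u} [Ring R]

variable (R) in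
/-- A copy in `Type` of a finite module. -/
def ofFinite (E : Type*) [AddCommGroup E] [Module R E] [Finite E] : FiniteModule R :=
  ⟨Shrink.{0} E⟩

/-- The copy in `Type` of a finite module is isomorphic to the module. -/
def ofFiniteEquiv (E : Type*) [AddCommGroup E] [Module R E] [Finite E] : ofFinite R E ≃ₗ[R] E :=
  Equiv.linearEquiv R (equivShrink.{0} E).symm

theorem Iso.symm {G H : FiniteModule R} (h : Iso G H) : Iso H G := h.map LinearEquiv.symm

theorem Iso.trans {G H L : FiniteModule R} (h : Iso G H) (h' : Iso H L) : Iso G L :=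
  ⟨h.some.trans h'.some⟩

theorem isoClass_eq_iff {G H : FiniteModule R} : isoClass G = isoClass H ↔ Iso G H :=
  Quotient.eq (r := isoSetoid R)

theorem isoClass_rep (c : IsoClass R) : isoClass c.rep = c := Quotient.out_eq _

theorem iso_rep_isoClass (G : FiniteModule R) : Iso (isoClass G).rep G :=
  isoClass_eq_iff.mp (isoClass_rep _)

variable (R) in
/-- The properties of a ring used to determine the distributions from the moments. -/
structure IsCohenLenstraRing : Prop where
  finite_of_smul : ∀ n : ℤ, n ≠ 0 → ∀ (Y : Type u) [AddCommGroup Y] [Module R Y] [Module.Finite R Y],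
    (∀ y : Y, n • y = 0) → Finite Y
  card_hom : ∀ K : FiniteModule R, IsSimpleModule R K → ∀ (d : ℕ) (N : Submodule R (Fin d → R)),
    Finite ((Fin d → R) ⧸ N) → Nat.card (N →ₗ[R] K) = Nat.card ((Fin d → R) →ₗ[R] K)
  exists_radical : ∃ a : ℤ, a ≠ 0 ∧
    (∀ K : FiniteModule R, IsSimpleModule R K → ∀ k : K, a • k = 0) ∧
    ∀ Y : FiniteModule R, (∀ y : Y, ∃ y' : Y, a • y' = y) → Subsingleton Y

/-- The isomorphism classes of modules with bounded number of generators and exponent. -/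
theorem IsCohenLenstraRing.finite_isoClass (hR : IsCohenLenstraRing R) {n : ℤ} (hn : n ≠ 0)
    (d : ℕ) : {c : IsoClass R | (∃ f : (Fin d → R) →ₗ[R] c.rep, Function.Surjective f) ∧
      ∀ x : c.rep, n • x = 0}.Finite := by
  let U : Submodule R (Fin d → R) := LinearMap.range (n • (LinearMap.id : (Fin d → R) →ₗ[R] (Fin d → R)))
  have hB : Finite ((Fin d → R) ⧸ U) := by
    refine hR.finite_of_smul n hn _ fun y => ?_
    obtain ⟨x, rfl⟩ := Submodule.Quotient.mk_surjective _ y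
    rw [← Submodule.Quotient.mk_smul, Submodule.Quotient.mk_eq_zero]
    exact ⟨x, rfl⟩
  have : Finite (Submodule R ((Fin d → R) ⧸ U)) := Finite.of_injective _ SetLike.coe_injective
  have hq : ∀ W : Submodule R ((Fin d → R) ⧸ U), Finite (((Fin d → R) ⧸ U) ⧸ W) := fun W =>
    Finite.of_surjective _ W.mkQ_surjective
  refine (Set.finite_range fun W : Submodule R ((Fin d → R) ⧸ U) =>
    isoClass (ofFinite R (((Fin d → R) ⧸ U) ⧸ W))).subset ?_
  rintro c ⟨⟨f, hf⟩, hc⟩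
  have hle : U ≤ LinearMap.ker f := by
    rintro _ ⟨x, rfl⟩
    rw [LinearMap.mem_ker, LinearMap.smul_apply, map_zsmul, hc]
  have hg : Function.Surjective (U.liftQ f hle) := fun z => by
    obtain ⟨x, rfl⟩ := hf z
    exact ⟨Submodule.Quotient.mk x, by simp⟩
  refine ⟨LinearMap.ker (U.liftQ f hle), ?_⟩
  exact (isoClass_eq_iff.mpr ⟨(ofFiniteEquiv _).trans
    ((U.liftQ f hle).quotKerEquivOfSurjective hg)⟩).trans (isoClass_rep c)

theorem exists_surjective_of_span_eq_top {X : Type*} [AddCommGroup X] [Module R X] {d : ℕ}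
    {v : Fin d → X} (hv : Submodule.span R (Set.range v) = ⊤) :
    ∃ f : (Fin d → R) →ₗ[R] X, Function.Surjective f :=
  ⟨Fintype.linearCombination R v, by
    rw [← LinearMap.range_eq_top, Fintype.range_linearCombination, hv]⟩

theorem exists_surjective_card (X : Type*) [AddCommGroup X] [Module R X] [Finite X] :
    ∃ f : (Fin (Nat.card X) → R) →ₗ[R] X, Function.Surjective f :=
  exists_surjective_of_span_eq_top (v := (Finite.equivFin X).symm) (by
    rw [(Finite.equivFin X).symm.surjective.range_eq, Submodule.span_univ])

theorem IsCohenLenstraRing.countable_isoClass (hR : IsCohenLenstraRing R) :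
    Countable (IsoClass R) := by
  rw [← Set.countable_univ_iff]
  refine (Set.countable_iUnion fun n : ℕ =>
    (hR.finite_isoClass (n := (n + 1 : ℕ)) (by positivity) (n + 1)).countable).mono fun c _ => ?_
  have hpos : 0 < Nat.card c.rep := Nat.card_pos
  refine Set.mem_iUnion.mpr ⟨Nat.card c.rep - 1, ?_⟩
  rw [Nat.sub_add_cancel hpos]
  exact ⟨exists_surjective_card _, fun x => by rw [natCast_zsmul]; exact card_nsmul_eq_zero'⟩

variable (R) in
/-- The isomorphism classes of finite simple modules. -/
abbrev SimpleClass := {c : IsoClass R // IsSimpleModule R c.rep}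

/-- A representative of an isomorphism class of finite simple modules. -/
def SimpleClass.rep (i : SimpleClass R) : FiniteModule R := i.1.rep

theorem SimpleClass.isSimpleModule (i : SimpleClass R) : IsSimpleModule R i.rep := i.2

theorem SimpleClass.eq_of_iso (i j : SimpleClass R) (h : Iso i.rep j.rep) : i = j :=
  Subtype.ext (by rw [← isoClass_rep i.1, ← isoClass_rep j.1]; exact isoClass_eq_iff.mpr h)

theorem exists_simpleClass (K : Type) [AddCommGroup K] [Module R K] [Finite K]
    [IsSimpleModule R K] : ∃ i : SimpleClass R, Nonempty (K ≃ₗ[R] i.rep) := by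
  obtain ⟨f⟩ := iso_rep_isoClass (⟨K⟩ : FiniteModule R)
  exact ⟨⟨isoClass ⟨K⟩, IsSimpleModule.congr f⟩, ⟨f.symm⟩⟩

theorem IsCohenLenstraRing.finite_simpleClass (hR : IsCohenLenstraRing R) :
    Finite (SimpleClass R) := by
  obtain ⟨a, ha, h1, -⟩ := hR.exists_radical
  refine Set.Finite.to_subtype ((hR.finite_isoClass ha 1).subset fun c hc => ?_)
  have hc' : IsSimpleModule R c.rep := hc
  have := IsSimpleModule.nontrivial R c.rep
  obtain ⟨x, hx⟩ := exists_ne (0 : c.rep)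
  refine ⟨exists_surjective_of_span_eq_top (v := fun _ => x) ?_, h1 _ hc'⟩
  rw [Set.range_const]
  exact IsSimpleModule.span_singleton_eq_top R hx

theorem card_hom_le_of_surjective {X Y K : Type*} [AddCommGroup X] [Module R X] [AddCommGroup Y]
    [Module R Y] [AddCommGroup K] [Module R K] [Finite X] [Finite K] {ψ : X →ₗ[R] Y}
    (hψ : Function.Surjective ψ) : Nat.card (Y →ₗ[R] K) ≤ Nat.card (X →ₗ[R] K) := by
  rw [← card_hom_ker_le hψ]
  exact Finite.card_subtype_le _

variable [Fintype (SimpleClass R)]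

variable (R) in
/-- The total number of homomorphisms to the finite simple modules. -/
def homCount (X : Type*) [AddCommGroup X] [Module R X] : ℕ :=
  ∑ i : SimpleClass R, Nat.card (X →ₗ[R] i.rep)

theorem homCount_le_of_surjective {X Y : Type*} [AddCommGroup X] [Module R X] [AddCommGroup Y]
    [Module R Y] [Finite X] {ψ : X →ₗ[R] Y} (hψ : Function.Surjective ψ) :
    homCount R Y ≤ homCount R X :=
  Finset.sum_le_sum fun _ _ => card_hom_le_of_surjective hψ

/-- Dividing by an element outside a maximal submodule destroys a nonzero map to a simple module, so
`homCount` drops by at least one with each generator. -/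
theorem exists_span_eq_top_of_homCount_le (k : ℕ) (X : Type) [AddCommGroup X] [Module R X]
    [Finite X] (hk : homCount R X ≤ k) :
    ∃ v : Fin k → X, Submodule.span R (Set.range v) = ⊤ := by
  induction k generalizing X with
  | zero =>
    rcases subsingleton_or_nontrivial X with hX | hX
    · exact ⟨Fin.elim0, Subsingleton.elim _ _⟩
    · obtain ⟨m, hm⟩ := IsCoatomic.exists_coatom (Submodule R X)
      have : IsSimpleModule R (X ⧸ m) := isSimpleModule_iff_isCoatom.mpr hm
      have : Finite (X ⧸ m) := Finite.of_surjective _ m.mkQ_surjective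
      obtain ⟨i, -⟩ := exists_simpleClass (R := R) (X ⧸ m)
      have h1 := (Finset.sum_eq_zero_iff.mp (Nat.le_zero.mp hk)) i (Finset.mem_univ _)
      -- The zero map already makes each summand positive, so the existence of one simple class is
      -- enough.
      exact absurd h1 Nat.card_pos.ne'
  | succ k ih =>
    rcases subsingleton_or_nontrivial X with hX | hX
    · exact ⟨fun _ => 0, Subsingleton.elim _ _⟩
    · obtain ⟨m, hm⟩ := IsCoatomic.exists_coatom (Submodule R X)
      have : IsSimpleModule R (X ⧸ m) := isSimpleModule_iff_isCoatom.mpr hm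
      have : Finite (X ⧸ m) := Finite.of_surjective _ m.mkQ_surjective
      obtain ⟨i, ⟨g⟩⟩ := exists_simpleClass (R := R) (X ⧸ m)
      obtain ⟨x, hx⟩ : ∃ x, x ∉ m := by
        by_contra! hx
        exact hm.1 (eq_top_iff.mpr fun x _ => hx x)
      set U := Submodule.span R {x} with hU
      have : Finite (X ⧸ U) := Finite.of_surjective _ U.mkQ_surjective
      have hlt : homCount R (X ⧸ U) < homCount R X := by
        refine Finset.sum_lt_sum (fun j _ => card_hom_le_of_surjective U.mkQ_surjective)
          ⟨i, Finset.mem_univ _, ?_⟩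
        rw [← card_hom_ker_le U.mkQ_surjective]
        refine Finite.card_subtype_lt (x := g.toLinearMap ∘ₗ m.mkQ) fun hle => hx ?_
        have h1 : x ∈ LinearMap.ker (g.toLinearMap ∘ₗ m.mkQ) := hle (by
          rw [Submodule.ker_mkQ]; exact Submodule.mem_span_singleton_self x)
        simpa using h1
      obtain ⟨v, hv⟩ := ih (X ⧸ U) (by omega)
      choose w hw using fun j => U.mkQ_surjective (v j)
      refine ⟨Fin.cons x w, ?_⟩
      rw [Fin.range_cons, Submodule.span_insert, ← hU]
      have h2 : (Submodule.span R (Set.range w)).map U.mkQ = ⊤ := by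
        rw [Submodule.map_span, ← Set.range_comp, ← hv]
        congr 2
        ext j
        simp [← hw]
      rw [← Submodule.ker_mkQ U, sup_comm, ← Submodule.comap_map_eq, h2,
        Submodule.comap_top]

theorem IsCohenLenstraRing.finite_homCount_le (hR : IsCohenLenstraRing R) {n : ℤ} (hn : n ≠ 0)
    (T : ℕ) : {c : IsoClass R | homCount R c.rep ≤ T ∧ ∀ x : c.rep, n • x = 0}.Finite :=
  (hR.finite_isoClass hn T).subset fun c hc => by
    obtain ⟨v, hv⟩ := exists_span_eq_top_of_homCount_le T c.rep hc.1
    exact ⟨exists_surjective_of_span_eq_top hv, hc.2⟩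

end FiniteModules

/-! ### Multiplicative weights -/

section Weight

variable {R : Type u} [Ring R]

/-- A multiplicative weight on finite modules with values in `[1, ∞)`. -/
structure IsWeight (W : FiniteModule R → ℝ) : Prop where
  one_le : ∀ G, 1 ≤ W G
  mul : ∀ (M E F : FiniteModule R) (ι : M →ₗ[R] E) (π : E →ₗ[R] F), Function.Injective ι →
    Function.Surjective π → LinearMap.range ι = LinearMap.ker π → W E = W F * W M

variable {W : FiniteModule R → ℝ}

theorem IsWeight.pos (hW : IsWeight W) (G : FiniteModule R) : 0 < W G :=
  zero_lt_one.trans_le (hW.one_le G)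

theorem IsWeight.punit (hW : IsWeight W) : W ⟨PUnit⟩ = 1 := by
  have h := hW.mul ⟨PUnit⟩ ⟨PUnit⟩ ⟨PUnit⟩ LinearMap.id LinearMap.id (fun _ _ h => h)
    (fun x => ⟨x, rfl⟩) (Submodule.ext fun x => ⟨fun _ => rfl, fun _ => ⟨x, rfl⟩⟩)
  exact (mul_eq_left₀ (hW.pos _).ne').mp h.symm

theorem IsWeight.congr (hW : IsWeight W) {G H : FiniteModule R} (h : Iso G H) : W G = W H := by
  obtain ⟨f⟩ := h
  have := hW.mul ⟨PUnit⟩ G H 0 f.toLinearMap (fun _ _ _ => rfl) f.surjective (by simp)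
  rw [this, hW.punit, mul_one]

theorem IsWeight.pushout (hW : IsWeight W) {Q : Type*} [AddCommGroup Q] [Module R Q]
    {F M : FiniteModule R} {p : Q →ₗ[R] F} (hp : Function.Surjective p)
    (η : LinearMap.ker p →ₗ[R] M) [Finite (Pushout p η)] :
    W (ofFinite R (Pushout p η)) = W F * W M := by
  refine hW.mul M _ F ((ofFiniteEquiv (Pushout p η)).symm.toLinearMap ∘ₗ Pushout.inl p η)
    (Pushout.proj p η ∘ₗ (ofFiniteEquiv (Pushout p η)).toLinearMap) ?_ ?_ ?_
  · rw [LinearMap.coe_comp]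
    exact (LinearEquiv.injective _).comp (Pushout.inl_injective η)
  · rw [LinearMap.coe_comp]
    exact (Pushout.proj_surjective hp η).comp (LinearEquiv.surjective _)
  · rw [LinearMap.ker_comp, ← Pushout.range_inl, LinearMap.range_comp]
    exact Submodule.map_equiv_eq_comap_symm _ _

theorem IsWeight.sumOfList (hW : IsWeight W) {ι : Type*} [Fintype ι] [DecidableEq ι]
    (K : ι → FiniteModule R) (l : List ι) :
    W (sumOfList K l) = ∏ i, W (K i) ^ l.count i := by
  induction l with
  | nil =>
    simp only [List.count_nil, pow_zero, Finset.prod_const_one]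
    exact hW.punit
  | cons i l ih =>
    have h1 : W (CLM.sumOfList K (i :: l)) = W (K i) * W (CLM.sumOfList K l) :=
      hW.mul (CLM.sumOfList K l) (CLM.sumOfList K (i :: l)) (K i)
        (LinearMap.inr R (K i) (CLM.sumOfList K l)) (LinearMap.fst R (K i) (CLM.sumOfList K l))
        LinearMap.inr_injective LinearMap.fst_surjective (LinearMap.range_inr R _ _)
    have h2 : ∀ k, W (K k) ^ (i :: l).count k = W (K k) ^ l.count k * if k = i then W (K i) else 1 := by
      intro k
      by_cases hk : k = i
      · subst hk; simp [pow_succ]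
      · simp [hk, Ne.symm hk]
    rw [h1, ih, Finset.prod_congr rfl fun k _ => h2 k, Finset.prod_mul_distrib, Finset.prod_ite_eq',
      mul_comm]
    simp

end Weight

/-! ### Convergence of expectations -/

section Limits

variable {R : Type u} [Ring R] {Ω : ℕ → Type*} [∀ n, MeasurableSpace (Ω n)]
  {P : ∀ n, Measure (Ω n)} {X : ∀ n, Ω n → FiniteModule R}

variable (P X) in
/-- The expectations of `g (X n)` converge to `L`. -/
def MomentLimit (g : FiniteModule R → ℝ) (L : ℝ) : Prop :=
  (∀ᶠ n in atTop, Integrable (fun ω => g (X n ω)) (P n)) ∧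
    Tendsto (fun n => ∫ ω, g (X n ω) ∂P n) atTop (𝓝 L)

theorem MomentLimit.const_mul {g : FiniteModule R → ℝ} {L : ℝ} (h : MomentLimit P X g L) (c : ℝ) :
    MomentLimit P X (fun G => c * g G) (c * L) :=
  ⟨h.1.mono fun _ hn => hn.const_mul c, by
    simpa only [integral_const_mul] using h.2.const_mul c⟩

theorem MomentLimit.sum {ι : Type*} (s : Finset ι) {g : ι → FiniteModule R → ℝ} {L : ι → ℝ}
    (h : ∀ i ∈ s, MomentLimit P X (g i) (L i)) :
    MomentLimit P X (fun G => ∑ i ∈ s, g i G) (∑ i ∈ s, L i) := by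
  have h1 : ∀ᶠ n in atTop, ∀ i ∈ s, Integrable (fun ω => g i (X n ω)) (P n) :=
    (eventually_all_finset s).mpr fun i hi => (h i hi).1
  refine ⟨h1.mono fun n hn => integrable_finsetSum _ hn, ?_⟩
  refine (tendsto_finsetSum _ fun i hi => (h i hi).2).congr' ?_
  filter_upwards [h1] with n hn
  rw [integral_finsetSum _ hn]

theorem MomentLimit.sub {g g' : FiniteModule R → ℝ} {L L' : ℝ} (h : MomentLimit P X g L)
    (h' : MomentLimit P X g' L') : MomentLimit P X (fun G => g G - g' G) (L - L') := by
  refine ⟨by filter_upwards [h.1, h'.1] with n hn hn' using hn.sub hn', ?_⟩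
  refine (h.2.sub h'.2).congr' ?_
  filter_upwards [h.1, h'.1] with n hn hn'
  rw [integral_sub hn hn']

theorem MomentLimit.congr {g g' : FiniteModule R → ℝ} {L L' : ℝ} (h : MomentLimit P X g L)
    (hg : ∀ G, g G = g' G) (hL : L = L') : MomentLimit P X g' L' := by
  rwa [← hL, ← funext hg]

/-- There are only countably many isomorphism classes, so every preimage is a countable union of
measurable events. -/
theorem measurable_of_isRandomModule (hR : IsCohenLenstraRing R) {Ω : Type*} [MeasurableSpace Ω]
    {X : Ω → FiniteModule R} (hX : IsRandomModule X) {β : Type*} [MeasurableSpace β]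
    {g : FiniteModule R → β} (hg : ∀ G H, Iso G H → g G = g H) : Measurable fun ω => g (X ω) := by
  have := hR.countable_isoClass
  intro s _
  have : (fun ω => g (X ω)) ⁻¹' s =
      ⋃ c ∈ {c : IsoClass R | g c.rep ∈ s}, {ω | Iso (X ω) c.rep} := by
    ext ω
    simp only [Set.mem_preimage, Set.mem_iUnion, Set.mem_ofPred_eq, exists_prop]
    constructor
    · intro h
      refine ⟨isoClass (X ω), ?_, (iso_rep_isoClass _).symm⟩
      rwa [hg _ _ (iso_rep_isoClass (X ω))]
    · rintro ⟨c, hc, h⟩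
      rwa [hg _ _ h]
  rw [this]
  exact MeasurableSet.biUnion (Set.to_countable _) fun c _ => hX c.rep

/-- Precomposition with an isomorphism. -/
def surjectiveEquiv {G G' H : FiniteModule R} (f : G ≃ₗ[R] G') :
    {θ : G →ₗ[R] H // Function.Surjective θ} ≃ {θ : G' →ₗ[R] H // Function.Surjective θ} where
  toFun θ := ⟨θ.1 ∘ₗ f.symm.toLinearMap, by
    rw [LinearMap.coe_comp]; exact θ.2.comp f.symm.surjective⟩
  invFun θ := ⟨θ.1 ∘ₗ f.toLinearMap, by
    rw [LinearMap.coe_comp]; exact θ.2.comp f.surjective⟩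
  left_inv θ := by ext; simp
  right_inv θ := by ext; simp

theorem surCard_congr {G G' : FiniteModule R} (h : Iso G G') (H : FiniteModule R) :
    surCard G H = surCard G' H :=
  Nat.card_congr (surjectiveEquiv h.some)

/-- A finite limit forces the extended expectations to be finite eventually. Integrability for every
`n` cannot be expected, which is why `MomentLimit` asks for it only eventually. -/
theorem momentLimit_surCard (hR : IsCohenLenstraRing R) (hX : ∀ n, IsRandomModule (X n))
    {G : FiniteModule R} {L : ℝ} (hL : 0 ≤ L)
    (h : Tendsto (fun n => ∫⁻ ω, (surCard (X n ω) G : ℝ≥0∞) ∂(P n)) atTop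
      (𝓝 (ENNReal.ofReal L))) :
    MomentLimit P X (fun H => (surCard H G : ℝ)) L := by
  have hm : ∀ n, Measurable fun ω => (surCard (X n ω) G : ℝ) := fun n =>
    measurable_of_isRandomModule hR (hX n) (g := fun H => (surCard H G : ℝ))
      fun H H' hH => by rw [surCard_congr hH]
  have heq : ∀ n, ∫⁻ ω, ENNReal.ofReal (surCard (X n ω) G : ℝ) ∂(P n) =
      ∫⁻ ω, (surCard (X n ω) G : ℝ≥0∞) ∂(P n) := fun n =>
    lintegral_congr fun ω => ENNReal.ofReal_natCast _
  refine ⟨?_, ?_⟩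
  · filter_upwards [h.eventually_lt_const ENNReal.ofReal_lt_top] with n hn
    refine ⟨(hm n).aestronglyMeasurable, ?_⟩
    rw [hasFiniteIntegral_iff_ofReal (Eventually.of_forall fun ω => Nat.cast_nonneg _), heq]
    exact hn
  · have h1 := (ENNReal.tendsto_toReal ENNReal.ofReal_ne_top).comp h
    rw [ENNReal.toReal_ofReal hL] at h1
    refine h1.congr fun n => ?_
    rw [integral_eq_lintegral_of_nonneg_ae (Eventually.of_forall fun ω => Nat.cast_nonneg _)
      (hm n).aestronglyMeasurable, heq]
    rfl

end Limits

/-! ### Moments of the kernels of surjections -/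

section KernelMoments

variable {R : Type u} [Ring R] {Ω : ℕ → Type*} [∀ n, MeasurableSpace (Ω n)]
  {P : ∀ n, Measure (Ω n)} {X : ∀ n, Ω n → FiniteModule R} {W : FiniteModule R → ℝ}

instance fintypeSurjective (G H : FiniteModule R) :
    Fintype {φ : G →ₗ[R] H // Function.Surjective φ} := Fintype.ofFinite _

theorem surCard_ofFinite (G : FiniteModule R) (E : Type*) [AddCommGroup E] [Module R E] [Finite E] :
    surCard G (ofFinite R E) = Nat.card {θ : G →ₗ[R] E // Function.Surjective θ} :=
  Nat.card_congr
    { toFun := fun θ => ⟨(ofFiniteEquiv E).toLinearMap ∘ₗ θ.1, by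
        rw [LinearMap.coe_comp]; exact (ofFiniteEquiv E).surjective.comp θ.2⟩
      invFun := fun θ => ⟨(ofFiniteEquiv E).symm.toLinearMap ∘ₗ θ.1, by
        rw [LinearMap.coe_comp]; exact (ofFiniteEquiv E).symm.surjective.comp θ.2⟩
      left_inv := fun θ => by ext; simp
      right_inv := fun θ => by ext; simp }

instance finite_hom_free {d : ℕ} {M : Type*} [AddCommGroup M] [Module R M] [Finite M] :
    Finite ((Fin d → R) →ₗ[R] M) :=
  Finite.of_equiv _ ((Pi.basisFun R (Fin d)).constr ℕ).toEquiv

/-- The moments of the kernels of surjections to `F` against semisimple modules. -/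
theorem momentLimit_kernel (hR : IsCohenLenstraRing R) (hW : IsWeight W)
    (hmom : ∀ G, MomentLimit P X (fun H => (surCard H G : ℝ)) (1 / W G)) (F : FiniteModule R)
    {ι : Type*} {K : ι → FiniteModule R} (hK : ∀ i, IsSimpleModule R (K i)) (l : List ι) :
    MomentLimit P X (fun G => ∑ φ : {φ : G →ₗ[R] F // Function.Surjective φ},
      (Nat.card {ψ : LinearMap.ker φ.1 →ₗ[R] sumOfList K l // Function.Surjective ψ} : ℝ))
      (1 / (W F * W (sumOfList K l))) := by
  obtain ⟨p, hp⟩ := exists_surjective_card (R := R) F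
  have hquot : Finite ((Fin (Nat.card F) → R) ⧸ LinearMap.ker p) :=
    Finite.of_equiv _ (p.quotKerEquivOfSurjective hp).symm.toEquiv
  -- The number of maps `η` equals the factor `|Hom(Q, M)|` of the counting identity, so the two
  -- cancel. The property `card_hom` of the ring enters here.
  have hcard : Nat.card (LinearMap.ker p →ₗ[R] sumOfList K l) =
      Nat.card ((Fin (Nat.card F) → R) →ₗ[R] sumOfList K l) := by
    rw [card_hom_sumOfList, card_hom_sumOfList]
    congr 1
    exact List.map_congr_left fun i _ => hR.card_hom (K i) (hK i) _ _ hquot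
  have hpos : 0 < Nat.card ((Fin (Nat.card F) → R) →ₗ[R] sumOfList K l) := Nat.card_pos
  have : Finite (LinearMap.ker p →ₗ[R] sumOfList K l) :=
    Nat.finite_of_card_ne_zero (hcard ▸ hpos.ne')
  have := Fintype.ofFinite (LinearMap.ker p →ₗ[R] sumOfList K l)
  have hfin := fun η : LinearMap.ker p →ₗ[R] sumOfList K l => Pushout.finite hp η
  have h1 : MomentLimit P X (fun G => ∑ η : LinearMap.ker p →ₗ[R] sumOfList K l,
      (surCard G (ofFinite R (Pushout p η)) : ℝ))
      (∑ η : LinearMap.ker p →ₗ[R] sumOfList K l, 1 / (W F * W (sumOfList K l))) := by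
    refine MomentLimit.sum _ fun η _ => ?_
    rw [← hW.pushout hp η]
    exact hmom _
  have hne : (Nat.card ((Fin (Nat.card F) → R) →ₗ[R] sumOfList K l) : ℝ) ≠ 0 :=
    Nat.cast_ne_zero.mpr hpos.ne'
  refine (h1.const_mul (Nat.card ((Fin (Nat.card F) → R) →ₗ[R] sumOfList K l) : ℝ)⁻¹).congr
    (fun G => ?_) ?_
  · rw [inv_mul_eq_iff_eq_mul₀ hne, mul_comm]
    simp_rw [surCard_ofFinite]
    exact_mod_cast sum_card_surjective_pushout (X := G) (M := sumOfList K l) hp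
  · rw [Finset.sum_const, Finset.card_univ, ← Nat.card_eq_fintype_card, hcard, nsmul_eq_mul,
      inv_mul_cancel_left₀ hne]

theorem exists_list_count {ι : Type*} [Fintype ι] [DecidableEq ι] (d : ι → ℕ) :
    ∃ l : List ι, ∀ i, l.count i = d i := by
  refine ⟨(Finsupp.toMultiset (Finsupp.equivFunOnFinite.symm d)).toList, fun i => ?_⟩
  rw [← Multiset.coe_count, Multiset.coe_toList, Finsupp.count_toMultiset]
  rfl

variable [Fintype (SimpleClass R)]

/-- The expectation of the product of the `sieveTerm`s of the kernels. -/
theorem momentLimit_sieveTerm (hR : IsCohenLenstraRing R) (hW : IsWeight W)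
    (hmom : ∀ G, MomentLimit P X (fun H => (surCard H G : ℝ)) (1 / W G)) (F : FiniteModule R)
    (d : SimpleClass R → ℕ) :
    MomentLimit P X (fun G => ∑ φ : {φ : G →ₗ[R] F // Function.Surjective φ},
      ∏ i : SimpleClass R, sieveTerm (endCard R i.rep) (Nat.card (LinearMap.ker φ.1 →ₗ[R] i.rep)) (d i))
      (1 / W F * ∏ i : SimpleClass R, limitTerm (endCard R i.rep) (1 / W i.rep) (d i)) := by
  classical
  obtain ⟨l, hl⟩ := exists_list_count d
  have h1 := momentLimit_kernel hR hW hmom F (K := SimpleClass.rep)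
    SimpleClass.isSimpleModule l
  -- For `M` the direct sum of the `K_i ^ d i`, the number `|Sur(ker φ, M)|` is the product of the
  -- numerators of the sieve terms. Only their constant denominators have to be divided out.
  refine (h1.const_mul (∏ i : SimpleClass R, ∏ j ∈ Finset.range (d i),
    ((endCard R i.rep : ℝ) ^ (j + 1) - 1))⁻¹).congr (fun G => ?_) ?_
  · rw [Finset.mul_sum]
    refine Finset.sum_congr rfl fun φ _ => ?_
    rw [card_surjective_sumOfList SimpleClass.isSimpleModule SimpleClass.eq_of_iso, inv_mul_eq_div,
      ← Finset.prod_div_distrib]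
    refine Finset.prod_congr rfl fun i _ => ?_
    rw [hl, sieveTerm, Finset.prod_div_distrib]
  · rw [hW.sumOfList, inv_mul_eq_div, one_div, mul_inv, ← Finset.prod_inv_distrib, mul_div_assoc,
      ← Finset.prod_div_distrib, one_div]
    congr 1
    refine Finset.prod_congr rfl fun i _ => ?_
    rw [hl, limitTerm, Finset.prod_div_distrib]
    simp

end KernelMoments

/-! ### Detecting isomorphisms by the sieve -/

section Isomorphisms

variable {R : Type u} [Ring R]

theorem autCard_pos (G : FiniteModule R) : 0 < autCard G := by
  have : Finite (G ≃ₗ[R] G) := Finite.of_injective _ (LinearEquiv.toLinearMap_injective)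
  have : Nonempty (G ≃ₗ[R] G) := ⟨LinearEquiv.refl R G⟩
  exact Nat.card_pos

theorem autCard_congr {G H : FiniteModule R} (h : Iso G H) : autCard G = autCard H := by
  obtain ⟨f⟩ := h
  refine Nat.card_congr
    { toFun := fun g => (f.symm.trans g).trans f
      invFun := fun g => (f.trans g).trans f.symm
      left_inv := fun g => by ext; simp
      right_inv := fun g => by ext; simp }

open Classical in
theorem sum_surjective_ker_eq_bot (G F : FiniteModule R) :
    (∑ φ : {φ : G →ₗ[R] F // Function.Surjective φ},
      if LinearMap.ker φ.1 = ⊥ then (1 : ℝ) else 0) = if Iso G F then (autCard F : ℝ) else 0 := by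
  rw [Finset.sum_boole]
  split_ifs with h
  · obtain ⟨f⟩ := h
    congr 1
    rw [← Fintype.card_subtype, ← Nat.card_eq_fintype_card]
    exact Nat.card_congr
      { toFun := fun φ => f.symm.trans (LinearEquiv.ofBijective φ.1.1
          ⟨LinearMap.ker_eq_bot.mp φ.2, φ.1.2⟩)
        invFun := fun g => ⟨⟨(f.trans g).toLinearMap, (f.trans g).surjective⟩, LinearEquiv.ker _⟩
        left_inv := fun φ => by
          ext x
          exact congrArg φ.1.1 (f.symm_apply_apply x)
        right_inv := fun g => by
          ext x
          exact congrArg g (f.apply_symm_apply x) }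
  · rw [Finset.filter_false_of_mem, Finset.card_empty, Nat.cast_zero]
    exact fun φ _ hφ => h ⟨LinearEquiv.ofBijective φ.1 ⟨LinearMap.ker_eq_bot.mp hφ, φ.2⟩⟩

theorem subsingleton_of_card_hom_eq_one (M : Type) [AddCommGroup M] [Module R M] [Finite M]
    (h : ∀ i : SimpleClass R, Nat.card (M →ₗ[R] i.rep) = 1) : Subsingleton M := by
  by_contra hM
  rw [not_subsingleton_iff_nontrivial] at hM
  obtain ⟨m, hm⟩ := IsCoatomic.exists_coatom (Submodule R M)
  have : IsSimpleModule R (M ⧸ m) := isSimpleModule_iff_isCoatom.mpr hm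
  have : Finite (M ⧸ m) := Finite.of_surjective _ m.mkQ_surjective
  obtain ⟨i, ⟨g⟩⟩ := exists_simpleClass (R := R) (M ⧸ m)
  have := (Nat.card_eq_one_iff_unique.mp (h i)).1
  have h0 : g.toLinearMap ∘ₗ m.mkQ = 0 := Subsingleton.elim _ _
  refine hm.1 (eq_top_iff.mpr fun x _ => ?_)
  simpa using LinearMap.congr_fun h0 x

variable [Fintype (SimpleClass R)]

open Classical in
/-- The indicator function of an isomorphism class is approximated by the sieve. -/
theorem abs_iso_sub_sum_sieveSum_le (G F : FiniteModule R) (D : ℕ) :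
    |(if Iso G F then (autCard F : ℝ) else 0) -
      ∑ φ : {φ : G →ₗ[R] F // Function.Surjective φ}, ∏ i : SimpleClass R,
        sieveSum (endCard R i.rep) (Nat.card (LinearMap.ker φ.1 →ₗ[R] i.rep)) D| ≤
      ∑ φ : {φ : G →ₗ[R] F // Function.Surjective φ}, (∏ i : SimpleClass R,
        (1 + sieveTerm (endCard R i.rep) (Nat.card (LinearMap.ker φ.1 →ₗ[R] i.rep)) (D + 1)) - 1) := by
  rw [← sum_surjective_ker_eq_bot, ← Finset.sum_sub_distrib]
  refine (Finset.abs_sum_le_sum_abs _ _).trans (Finset.sum_le_sum fun φ _ => ?_)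
  have hS := fun i : SimpleClass R => i.isSimpleModule
  choose r hr using fun i : SimpleClass R =>
    exists_card_hom_eq_pow (R := R) (X := LinearMap.ker φ.1) (K := i.rep)
  have hq : ∀ i : SimpleClass R, (1 : ℝ) < endCard R i.rep := fun i =>
    Nat.one_lt_cast.mpr (one_lt_endCard (R := R) (K := i.rep))
  have hind : (if LinearMap.ker φ.1 = ⊥ then (1 : ℝ) else 0) =
      ∏ i : SimpleClass R, if r i = 0 then (1 : ℝ) else 0 := by
    have hiff : LinearMap.ker φ.1 = ⊥ ↔ ∀ i ∈ Finset.univ, r i = 0 := by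
      refine ⟨fun h i _ => ?_, fun h => ?_⟩
      · have : Subsingleton (LinearMap.ker φ.1) := Submodule.subsingleton_iff_eq_bot.mpr h
        have h1 : Nat.card (LinearMap.ker φ.1 →ₗ[R] i.rep) = 1 := by
          have : Subsingleton (LinearMap.ker φ.1 →ₗ[R] i.rep) :=
            ⟨fun f g => LinearMap.ext fun x => by rw [Subsingleton.elim x 0, map_zero, map_zero]⟩
          exact Nat.card_unique
        rw [hr] at h1
        by_contra h0
        exact (Nat.one_lt_pow h0 (Nat.one_lt_cast.mp (hq i))).ne' h1
      · rw [← Submodule.subsingleton_iff_eq_bot]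
        exact subsingleton_of_card_hom_eq_one _ fun i => by
          rw [hr, h i (Finset.mem_univ _), pow_zero]
    rw [Finset.prod_ite_zero, Finset.prod_const_one]
    by_cases h : LinearMap.ker φ.1 = ⊥
    · rw [if_pos h, if_pos (hiff.mp h)]
    · rw [if_neg h, if_neg fun h' => h (hiff.mpr h')]
  rw [hind]
  refine (abs_prod_sub_prod_le Finset.univ (fun i _ => ?_) fun i _ => ?_).1
  · split_ifs <;> simp
  · rw [hr, Nat.cast_pow]
    exact abs_indicator_sub_sieveSum_le (hq i) (r i) D

end Isomorphisms

/-- Exchange of limits: `D` is fixed first, with limiting error and limiting discrepancy small, and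
only then does `n` grow. -/
theorem tendsto_of_abs_sub_le {a : ℕ → ℝ} {b e : ℕ → ℕ → ℝ} {β η : ℕ → ℝ} {L : ℝ}
    (h : ∀ D, ∀ᶠ n in atTop, |a n - b D n| ≤ e D n)
    (hb : ∀ D, Tendsto (b D) atTop (𝓝 (β D))) (he : ∀ D, Tendsto (e D) atTop (𝓝 (η D)))
    (hβ : Tendsto β atTop (𝓝 L)) (hη : Tendsto η atTop (𝓝 0)) : Tendsto a atTop (𝓝 L) := by
  rw [Metric.tendsto_atTop']
  intro ε hε
  have h1 : Tendsto (fun D => η D + |β D - L|) atTop (𝓝 0) := by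
    simpa using hη.add (hβ.sub_const L).abs
  obtain ⟨D, hD⟩ := (h1.eventually_lt_const hε).exists
  have h2 : Tendsto (fun n => e D n + |b D n - L|) atTop (𝓝 (η D + |β D - L|)) :=
    (he D).add ((hb D).sub_const L).abs
  obtain ⟨N, hN⟩ := ((h D).and (h2.eventually_lt_const hD)).exists_forall_of_atTop
  refine ⟨N, fun n hn => ?_⟩
  obtain ⟨h3, h4⟩ := hN n hn.le
  rw [Real.dist_eq]
  linarith [abs_sub_le (a n) (b D n) L]

/-! ### Convergence of the probabilities of isomorphism classes -/

section Limits

variable {R : Type u} [Ring R] {Ω : ℕ → Type*} [∀ n, MeasurableSpace (Ω n)]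
  {P : ∀ n, Measure (Ω n)} {X : ∀ n, Ω n → FiniteModule R} {W : FiniteModule R → ℝ}
  [Fintype (SimpleClass R)]

/-- Expanding the product over simple classes gives a finite combination of products of sieve terms.
The coefficients are left free so that this serves for both the sieve and its error. -/
theorem momentLimit_prod_sum_sieveTerm (hR : IsCohenLenstraRing R) (hW : IsWeight W)
    (hmom : ∀ G, MomentLimit P X (fun H => (surCard H G : ℝ)) (1 / W G)) (F : FiniteModule R)
    (t : Finset ℕ) (c : ℕ → ℝ) :
    MomentLimit P X (fun G => ∑ φ : {φ : G →ₗ[R] F // Function.Surjective φ},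
      ∏ i : SimpleClass R, ∑ d ∈ t, c d *
        sieveTerm (endCard R i.rep) (Nat.card (LinearMap.ker φ.1 →ₗ[R] i.rep)) d)
      (1 / W F * ∏ i : SimpleClass R, ∑ d ∈ t, c d *
        limitTerm (endCard R i.rep) (1 / W i.rep) d) := by
  classical
  have h1 := MomentLimit.sum (Fintype.piFinset fun _ : SimpleClass R => t) fun d _ =>
    (momentLimit_sieveTerm hR hW hmom F d).const_mul (∏ i, c (d i))
  refine h1.congr (fun G => ?_) ?_
  · simp_rw [Finset.mul_sum]
    rw [Finset.sum_comm]
    refine Finset.sum_congr rfl fun φ _ => ?_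
    rw [Finset.prod_univ_sum]
    exact Finset.sum_congr rfl fun d _ => Finset.prod_mul_distrib.symm
  · rw [Finset.prod_univ_sum, Finset.mul_sum]
    refine Finset.sum_congr rfl fun d _ => ?_
    rw [mul_left_comm, Finset.prod_mul_distrib]

variable [∀ n, IsProbabilityMeasure (P n)]

/-- The probabilities of the isomorphism classes converge. -/
theorem exists_tendsto_iso (hR : IsCohenLenstraRing R) (hW : IsWeight W)
    (hX : ∀ n, IsRandomModule (X n))
    (hmom : ∀ G, MomentLimit P X (fun H => (surCard H G : ℝ)) (1 / W G)) :
    ∃ c : ℝ, 0 < c ∧ ∀ F, Tendsto (fun n => (P n).real {ω | Iso (X n ω) F}) atTop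
      (𝓝 (c * (1 / (W F * autCard F)))) := by
  classical
  have hS := fun i : SimpleClass R => i.isSimpleModule
  have hq : ∀ i : SimpleClass R, (2 : ℝ) ≤ endCard R i.rep := fun i => by
    exact_mod_cast one_lt_endCard (R := R) (K := i.rep)
  have hx : ∀ i : SimpleClass R, 0 < 1 / W i.rep := fun i => one_div_pos.mpr (hW.pos _)
  have hx1 : ∀ i : SimpleClass R, 1 / W i.rep ≤ 1 := fun i =>
    (div_le_one (hW.pos _)).mpr (hW.one_le _)
  choose c hc0 hc using fun i : SimpleClass R =>
    exists_pos_tendsto_sum_limitTerm (hq i) (hx i) (hx1 i)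
  refine ⟨∏ i, c i, Finset.prod_pos fun i _ => hc0 i, fun F => ?_⟩
  have hb := fun D : ℕ => momentLimit_prod_sum_sieveTerm hR hW hmom F (Finset.range (D + 1))
    fun d => (-1) ^ d
  have he : ∀ D : ℕ, MomentLimit P X (fun G => ∑ φ : {φ : G →ₗ[R] F // Function.Surjective φ},
      (∏ i : SimpleClass R, (1 + sieveTerm (endCard R i.rep)
        (Nat.card (LinearMap.ker φ.1 →ₗ[R] i.rep)) (D + 1)) - 1))
      (1 / W F * (∏ i : SimpleClass R, (1 + limitTerm (endCard R i.rep) (1 / W i.rep) (D + 1)) - 1)) := by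
    intro D
    -- The term of index `0` is `1`, so the index set `{0, D + 1}` gives the factors `1 + sieveTerm`
    -- and `{0}` gives the constant to subtract.
    refine ((momentLimit_prod_sum_sieveTerm hR hW hmom F {0, D + 1} fun _ => 1).sub
      (momentLimit_prod_sum_sieveTerm hR hW hmom F {0} fun _ => 1)).congr (fun G => ?_) ?_
    · rw [← Finset.sum_sub_distrib]
      refine Finset.sum_congr rfl fun φ _ => ?_
      congr 1
      · refine Finset.prod_congr rfl fun i _ => ?_
        rw [Finset.sum_pair (Nat.succ_ne_zero D).symm, one_mul, one_mul, sieveTerm,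
          Finset.prod_range_zero]
      · refine Finset.prod_eq_one fun i _ => ?_
        rw [Finset.sum_singleton, one_mul, sieveTerm, Finset.prod_range_zero]
    · rw [← mul_sub]
      congr 2
      · refine Finset.prod_congr rfl fun i _ => ?_
        rw [Finset.sum_pair (Nat.succ_ne_zero D).symm, one_mul, one_mul, limitTerm,
          Finset.prod_range_zero]
      · refine Finset.prod_eq_one fun i _ => ?_
        rw [Finset.sum_singleton, one_mul, limitTerm, Finset.prod_range_zero]
  have hβ : Tendsto (fun D => 1 / W F * ∏ i : SimpleClass R, ∑ d ∈ Finset.range (D + 1),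
      (-1) ^ d * limitTerm (endCard R i.rep) (1 / W i.rep) d) atTop (𝓝 (1 / W F * ∏ i, c i)) :=
    (tendsto_finsetProd _ fun i _ => hc i).const_mul _
  have hη : Tendsto (fun D : ℕ => 1 / W F * (∏ i : SimpleClass R,
      (1 + limitTerm (endCard R i.rep) (1 / W i.rep) (D + 1)) - 1)) atTop (𝓝 0) := by
    have h1 : Tendsto (fun D : ℕ => ∏ i : SimpleClass R,
        (1 + limitTerm (endCard R i.rep) (1 / W i.rep) (D + 1))) atTop
        (𝓝 (∏ _i : SimpleClass R, (1 + 0))) :=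
      tendsto_finsetProd _ fun i _ =>
        ((tendsto_add_atTop_iff_nat 1).mpr (tendsto_limitTerm (hq i) (hx i) (hx1 i))).const_add 1
    simpa using (h1.sub_const 1).const_mul (1 / W F)
  have hmeas : ∀ n, MeasurableSet {ω | Iso (X n ω) F} := fun n => hX n F
  have hint : ∀ n, Integrable (fun ω => if Iso (X n ω) F then (autCard F : ℝ) else 0) (P n) :=
    fun n => (integrable_const (autCard F : ℝ)).indicator (hmeas n)
  have h1 : Tendsto (fun n => ∫ ω, (if Iso (X n ω) F then (autCard F : ℝ) else 0) ∂P n) atTop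
      (𝓝 (1 / W F * ∏ i, c i)) := by
    refine tendsto_of_abs_sub_le (fun D => ?_) (fun D => (hb D).2) (fun D => (he D).2) hβ hη
    filter_upwards [(hb D).1, (he D).1] with n hbn hen
    rw [← integral_sub (hint n) hbn]
    refine (abs_integral_le_integral_abs).trans (integral_mono ((hint n).sub hbn).abs hen fun ω => ?_)
    exact abs_iso_sub_sum_sieveSum_le (X n ω) F D
  have hpos : (0 : ℝ) < autCard F := Nat.cast_pos.mpr (autCard_pos F)
  have h2 := h1.const_mul (autCard F : ℝ)⁻¹
  convert h2 using 2 with n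
  · rename_i n
    have : (fun ω => if Iso (X n ω) F then (autCard F : ℝ) else 0) =
        Set.indicator {ω | Iso (X n ω) F} fun _ => (autCard F : ℝ) := rfl
    rw [this, integral_indicator_const _ (hmeas n), smul_eq_mul, mul_comm, mul_assoc,
      mul_inv_cancel₀ hpos.ne', mul_one]
  · have := (hW.pos F).ne'
    field_simp

end Limits

/-! ### A dichotomy that controls the escape of mass -/

section Surjections

variable {R : Type u} [Ring R]

theorem card_hom_le_surCard_add_one (G K : FiniteModule R) [IsSimpleModule R K] :
    Nat.card (G →ₗ[R] K) ≤ surCard G K + 1 := by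
  classical
  rw [surCard, ← Finite.card_option]
  refine Nat.card_le_card_of_injective (fun f : G →ₗ[R] K =>
    if h : Function.Surjective f then some (⟨f, h⟩ : {f : G →ₗ[R] K // Function.Surjective f})
    else none) fun f g hfg => ?_
  have h0 : ∀ f : G →ₗ[R] K, ¬ Function.Surjective f → f = 0 := fun f hf =>
    f.surjective_or_eq_zero.resolve_left hf
  by_cases hf : Function.Surjective f <;> by_cases hg : Function.Surjective g
  · simpa [hf, hg] using hfg
  · simp [hf, hg] at hfg
  · simp [hf, hg] at hfg
  · rw [h0 f hf, h0 g hg]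

theorem autCard_le_surCard {G F : FiniteModule R} (f : G →ₗ[R] F) (hf : Function.Surjective f) :
    autCard F ≤ surCard G F := by
  refine Nat.card_le_card_of_injective (fun g : F ≃ₗ[R] F =>
    (⟨g.toLinearMap ∘ₗ f, by
      rw [LinearMap.coe_comp]; exact g.surjective.comp hf⟩ :
      {f : G →ₗ[R] F // Function.Surjective f})) fun g g' h => ?_
  ext x
  obtain ⟨y, rfl⟩ := hf x
  exact LinearMap.congr_fun (Subtype.ext_iff.mp h) y

/-- A module that is not killed by `a` has a quotient killed by `a * N` but not by `a`. -/
theorem exists_quotient_of_not_smul_eq_zero {N : ℤ}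
    (hN : ∀ Y : FiniteModule R, (∀ y : Y, ∃ y' : Y, N • y' = y) → Subsingleton Y)
    (G : FiniteModule R) {a : ℤ} (hG : ¬ ∀ x : G, a • x = 0) :
    ∃ (F : FiniteModule R) (f : G →ₗ[R] F), Function.Surjective f ∧
      (∀ y : F, (a * N) • y = 0) ∧ ¬ ∀ y : F, a • y = 0 := by
  let U : Submodule R G := LinearMap.range ((a * N) • (LinearMap.id : G →ₗ[R] G))
  have : Finite (G ⧸ U) := Finite.of_surjective _ U.mkQ_surjective
  refine ⟨⟨G ⧸ U⟩, U.mkQ, U.mkQ_surjective, fun y => ?_, fun h => hG ?_⟩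
  · obtain ⟨x, rfl⟩ := U.mkQ_surjective y
    rw [← map_zsmul, Submodule.mkQ_apply, Submodule.Quotient.mk_eq_zero]
    exact ⟨x, rfl⟩
  -- If `a` killed `G / a N G`, then `a G = N (a G)`, and the Nakayama-type hypothesis `hN` would
  -- give `a G = 0`.
  · let M : Submodule R G := LinearMap.range (a • (LinearMap.id : G →ₗ[R] G))
    have hM : Subsingleton M := by
      refine hN ⟨M⟩ ?_
      rintro ⟨_, x, rfl⟩
      have h1 := h (U.mkQ x)
      rw [← map_zsmul, Submodule.mkQ_apply, Submodule.Quotient.mk_eq_zero] at h1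
      obtain ⟨x', hx'⟩ := h1
      refine ⟨⟨a • x', x', rfl⟩, Subtype.ext ?_⟩
      change N • a • x' = a • x
      rw [smul_smul, mul_comm]
      exact hx'
    intro x
    have h2 : (⟨a • x, x, rfl⟩ : M) = 0 := Subsingleton.elim _ _
    exact Subtype.ext_iff.mp h2

variable [Fintype (SimpleClass R)]

theorem homCount_congr {G H : FiniteModule R} (h : Iso G H) : homCount R G = homCount R H :=
  (homCount_le_of_surjective h.some.symm.surjective).antisymm
    (homCount_le_of_surjective h.some.surjective)

theorem homCount_le_sum_surCard (G : FiniteModule R) :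
    homCount R G ≤ ∑ i : SimpleClass R, (surCard G i.rep + 1) :=
  Finset.sum_le_sum fun i _ => have := i.isSimpleModule; card_hom_le_surCard_add_one G i.rep

open Classical in
/-- A finite module either lies in a given finite set of isomorphism classes, or has many maps to
simple modules, or surjects onto a module in another given finite set. -/
theorem one_le_sum_iso_add {a N : ℤ}
    (hN : ∀ Y : FiniteModule R, (∀ y : Y, ∃ y' : Y, N • y' = y) → Subsingleton Y) (T : ℕ)
    {𝒢 𝓕 : Finset (IsoClass R)}
    (h𝒢 : ∀ c : IsoClass R, homCount R c.rep ≤ T → (∀ x : c.rep, a • x = 0) → c ∈ 𝒢)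
    (h𝓕 : ∀ c : IsoClass R, homCount R c.rep ≤ T → (∀ x : c.rep, (a * N) • x = 0) →
      (¬ ∀ x : c.rep, a • x = 0) → c ∈ 𝓕) (G : FiniteModule R) :
    1 ≤ (∑ c ∈ 𝒢, (if Iso G c.rep then (1 : ℝ) else 0) +
      (T + 1 : ℝ)⁻¹ * ∑ i : SimpleClass R, ((surCard G i.rep : ℝ) + 1)) +
      ∑ c ∈ 𝓕, (autCard c.rep : ℝ)⁻¹ * surCard G c.rep := by
  have haut : ∀ F : FiniteModule R, (0 : ℝ) < autCard F := fun F => Nat.cast_pos.mpr (autCard_pos F)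
  have hT0 : (0 : ℝ) < T + 1 := by positivity
  have n1 : 0 ≤ ∑ c ∈ 𝒢, (if Iso G c.rep then (1 : ℝ) else 0) :=
    Finset.sum_nonneg fun c _ => by split_ifs <;> norm_num
  have n2 : 0 ≤ (T + 1 : ℝ)⁻¹ * ∑ i : SimpleClass R, ((surCard G i.rep : ℝ) + 1) := by positivity
  have n3 : 0 ≤ ∑ c ∈ 𝓕, (autCard c.rep : ℝ)⁻¹ * surCard G c.rep := by positivity
  by_cases hGT : homCount R G ≤ T
  · by_cases hGa : ∀ x : G, a • x = 0
    · have hmem : isoClass G ∈ 𝒢 := by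
        obtain ⟨f⟩ := iso_rep_isoClass G
        refine h𝒢 _ ((homCount_congr ⟨f⟩).trans_le hGT) fun x => f.injective ?_
        rw [map_zsmul, hGa, map_zero]
      have h1 : (1 : ℝ) ≤ ∑ c ∈ 𝒢, (if Iso G c.rep then (1 : ℝ) else 0) := by
        refine le_trans ?_ (Finset.single_le_sum (fun c _ => ?_) hmem)
        · rw [if_pos (iso_rep_isoClass G).symm]
        · split_ifs <;> norm_num
      linarith
    · obtain ⟨F, f, hf, h1, h2⟩ := exists_quotient_of_not_smul_eq_zero hN G hGa
      obtain ⟨g⟩ := iso_rep_isoClass F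
      have hmem : isoClass F ∈ 𝓕 := by
        refine h𝓕 _ ((homCount_congr ⟨g⟩).trans_le ((homCount_le_of_surjective hf).trans hGT))
          (fun x => g.injective ?_) fun h => h2 fun y => g.symm.injective ?_
        · rw [map_zsmul, h1, map_zero]
        · rw [map_zsmul, h, map_zero]
      have h3 : (1 : ℝ) ≤ ∑ c ∈ 𝓕, (autCard c.rep : ℝ)⁻¹ * surCard G c.rep := by
        refine le_trans ?_ (Finset.single_le_sum (fun c _ => ?_) hmem)
        · rw [inv_mul_eq_div, one_le_div (haut _)]
          exact_mod_cast autCard_le_surCard (g.symm.toLinearMap ∘ₗ f) (by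
            rw [LinearMap.coe_comp]; exact g.symm.surjective.comp hf)
        · positivity
      linarith
  · have h1 : (T + 1 : ℝ) ≤ ∑ i : SimpleClass R, ((surCard G i.rep : ℝ) + 1) := by
      exact_mod_cast (Nat.succ_le_of_lt (not_le.mp hGT)).trans (homCount_le_sum_surCard G)
    have h2 : (1 : ℝ) ≤ (T + 1 : ℝ)⁻¹ * ∑ i : SimpleClass R, ((surCard G i.rep : ℝ) + 1) := by
      rwa [inv_mul_eq_div, one_le_div hT0]
    linarith

end Surjections

/-! ### Conservation of mass and the limiting distribution -/

section Limits

variable {R : Type u} [Ring R] {Ω : ℕ → Type*} [∀ n, MeasurableSpace (Ω n)]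
  {P : ∀ n, Measure (Ω n)} {X : ∀ n, Ω n → FiniteModule R} {W : FiniteModule R → ℝ}

theorem MomentLimit.add {g g' : FiniteModule R → ℝ} {L L' : ℝ} (h : MomentLimit P X g L)
    (h' : MomentLimit P X g' L') : MomentLimit P X (fun G => g G + g' G) (L + L') := by
  refine ⟨by filter_upwards [h.1, h'.1] with n hn hn' using hn.add hn', ?_⟩
  refine (h.2.add h'.2).congr' ?_
  filter_upwards [h.1, h'.1] with n hn hn'
  rw [integral_add hn hn']

variable [∀ n, IsProbabilityMeasure (P n)]

theorem MomentLimit.one_le {g : FiniteModule R → ℝ} {L : ℝ} (h : MomentLimit P X g L)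
    (hg : ∀ G, 1 ≤ g G) : 1 ≤ L := by
  refine ge_of_tendsto h.2 ?_
  filter_upwards [h.1] with n hn
  calc (1 : ℝ) = ∫ _, (1 : ℝ) ∂P n := by simp
    _ ≤ _ := integral_mono (integrable_const _) hn fun ω => hg _

theorem momentLimit_const (c : ℝ) : MomentLimit P X (fun _ => c) c :=
  ⟨Eventually.of_forall fun _ => integrable_const _, by simp⟩

open Classical in
theorem momentLimit_iso (hX : ∀ n, IsRandomModule (X n)) {F : FiniteModule R} {L : ℝ}
    (h : Tendsto (fun n => (P n).real {ω | Iso (X n ω) F}) atTop (𝓝 L)) :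
    MomentLimit P X (fun G => if Iso G F then 1 else 0) L := by
  have heq : ∀ n, (fun ω => if Iso (X n ω) F then (1 : ℝ) else 0) =
      Set.indicator {ω | Iso (X n ω) F} fun _ => (1 : ℝ) := fun n => rfl
  refine ⟨Eventually.of_forall fun n => ?_, h.congr fun n => ?_⟩
  · rw [heq]
    exact (integrable_const _).indicator (hX n F)
  · rw [heq, integral_indicator_const _ (hX n F), smul_eq_mul, mul_one]

/-- The limits of the probabilities have total mass at most one. -/
theorem sum_limit_le_one (hX : ∀ n, IsRandomModule (X n)) {L : IsoClass R → ℝ}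
    (h : ∀ c, Tendsto (fun n => (P n).real {ω | Iso (X n ω) c.rep}) atTop (𝓝 (L c)))
    (s : Finset (IsoClass R)) : ∑ c ∈ s, L c ≤ 1 := by
  refine le_of_tendsto' (tendsto_finsetSum _ fun c _ => h c) fun n => ?_
  rw [← measureReal_biUnion_finset]
  · exact measureReal_le_one
  · intro c _ c' _ hcc'
    refine Set.disjoint_left.mpr fun ω h1 h2 => hcc' ?_
    rw [← isoClass_rep c, ← isoClass_rep c']
    exact isoClass_eq_iff.mpr (Iso.trans (Iso.symm h1) h2)
  · exact fun c _ => hX n c.rep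

/-- No mass is lost in the limit. -/
theorem hasSum_one_of_tendsto (hR : IsCohenLenstraRing R) (hW : IsWeight W)
    (hX : ∀ n, IsRandomModule (X n))
    (hmom : ∀ G, MomentLimit P X (fun H => (surCard H G : ℝ)) (1 / W G)) {C : ℝ} (hC : 0 < C)
    (hlim : ∀ F, Tendsto (fun n => (P n).real {ω | Iso (X n ω) F}) atTop
      (𝓝 (C * (1 / (W F * autCard F))))) :
    HasSum (fun c : IsoClass R => C * (1 / (W c.rep * autCard c.rep))) 1 := by
  classical
  have := hR.finite_simpleClass
  have := Fintype.ofFinite (SimpleClass R)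
  have haut : ∀ F : FiniteModule R, (0 : ℝ) < autCard F := fun F => Nat.cast_pos.mpr (autCard_pos F)
  obtain ⟨w, hw⟩ : ∃ w : IsoClass R → ℝ, ∀ c, w c = 1 / (W c.rep * autCard c.rep) := ⟨_, fun _ => rfl⟩
  simp_rw [← hw]
  have hlim' : ∀ c : IsoClass R, Tendsto (fun n => (P n).real {ω | Iso (X n ω) c.rep}) atTop
      (𝓝 (C * w c)) := fun c => hw c ▸ hlim c.rep
  have hw0 : ∀ c, 0 ≤ w c := fun c => hw c ▸ (one_div_pos.mpr (mul_pos (hW.pos _) (haut _))).le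
  have hle : ∀ s : Finset (IsoClass R), ∑ c ∈ s, C * w c ≤ 1 :=
    sum_limit_le_one hX hlim'
  have hsum : Summable fun c => C * w c :=
    summable_of_sum_le (fun c => mul_nonneg hC.le (hw0 c)) hle
  have hsumw : Summable w := (summable_mul_left_iff hC.ne').mp hsum
  refine (hsum.hasSum_iff).mpr (le_antisymm (hsum.tsum_le_of_sum_le hle) ?_)
  obtain ⟨N, hN0, -, hN⟩ := hR.exists_radical
  obtain ⟨H, hH⟩ : ∃ H : ℝ, H = ∑ i : SimpleClass R, (1 / W i.rep + 1) := ⟨_, rfl⟩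
  have hH0 : 0 ≤ H := hH ▸ Finset.sum_nonneg fun i _ => by have := hW.pos i.rep; positivity
  refine le_of_forall_pos_le_add fun ε hε => ?_
  -- `H` is the limiting expectation of the bound on `homCount`, so this `T` makes the Markov term
  -- `H / (T + 1)` at most `ε / 2`.
  obtain ⟨T, hT⟩ := exists_nat_gt (H / (ε / 2))
  obtain ⟨s, hs⟩ := summable_iff_vanishing.mp hsumw (Set.Iio (ε / 2))
    (Iio_mem_nhds (half_pos hε))
  -- The product of the orders kills every module in `s`. Classes not killed by `a` are therefore
  -- outside `s`, where the total weight of any finite set is less than `ε / 2`.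
  obtain ⟨a, ha0, has⟩ : ∃ a : ℤ, a ≠ 0 ∧ ∀ c ∈ s, ∀ x : c.rep, a • x = 0 :=
    ⟨∏ c ∈ s, (Nat.card c.rep : ℤ), Finset.prod_ne_zero_iff.mpr fun c _ =>
      Nat.cast_ne_zero.mpr (Nat.card_pos (α := c.rep)).ne', fun c hc x => by
      rw [← Finset.prod_erase_mul _ _ hc, mul_smul, natCast_zsmul, card_nsmul_eq_zero', smul_zero]⟩
  obtain ⟨𝒢, h𝒢⟩ : ∃ 𝒢 : Finset (IsoClass R), ∀ c : IsoClass R, homCount R c.rep ≤ T →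
      (∀ x : c.rep, a • x = 0) → c ∈ 𝒢 :=
    ⟨(hR.finite_homCount_le ha0 T).toFinset, fun c h h' => (Set.Finite.mem_toFinset _).mpr ⟨h, h'⟩⟩
  obtain ⟨𝓕, h𝓕, hdisj⟩ : ∃ 𝓕 : Finset (IsoClass R), (∀ c : IsoClass R, homCount R c.rep ≤ T →
      (∀ x : c.rep, (a * N) • x = 0) → (¬ ∀ x : c.rep, a • x = 0) → c ∈ 𝓕) ∧ Disjoint 𝓕 s :=
    ⟨(hR.finite_homCount_le (mul_ne_zero ha0 hN0) T).toFinset.filter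
      fun c => ¬ ∀ x : c.rep, a • x = 0, fun c h h' h'' =>
        Finset.mem_filter.mpr ⟨(Set.Finite.mem_toFinset _).mpr ⟨h, h'⟩, h''⟩,
      Finset.disjoint_left.mpr fun c hc hcs => (Finset.mem_filter.mp hc).2 (has c hcs)⟩
  have hF := hs 𝓕 hdisj
  have hT0 : (0 : ℝ) < T + 1 := by positivity
  have key : MomentLimit P X (fun G => (∑ c ∈ 𝒢, (if Iso G c.rep then (1 : ℝ) else 0) +
      (T + 1 : ℝ)⁻¹ * ∑ i : SimpleClass R, ((surCard G i.rep : ℝ) + 1)) +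
      ∑ c ∈ 𝓕, (autCard c.rep : ℝ)⁻¹ * surCard G c.rep)
      ((∑ c ∈ 𝒢, C * w c + (T + 1 : ℝ)⁻¹ * H) + ∑ c ∈ 𝓕, (autCard c.rep : ℝ)⁻¹ * (1 / W c.rep)) :=
    hH ▸ ((MomentLimit.sum _ fun c _ => momentLimit_iso hX (hlim' c)).add
      ((MomentLimit.sum _ fun i _ => (hmom _).add (momentLimit_const 1)).const_mul _)).add
      (MomentLimit.sum _ fun c _ => (hmom _).const_mul _)
  -- Taking limiting expectations in the pointwise bound gives `1 ≤ ∑_𝒢 C w + H / (T + 1) + ∑_𝓕 w`.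
  -- Dividing the surjections to `c` by `|Aut c|` is what makes the last sum one of the weights `w`.
  have hone := key.one_le fun G => one_le_sum_iso_add hN T
    h𝒢 h𝓕 G
  have h1 : ∑ c ∈ 𝒢, C * w c ≤ ∑' c, C * w c :=
    hsum.sum_le_tsum _ fun c _ => mul_nonneg hC.le (hw0 c)
  have h2 : (T + 1 : ℝ)⁻¹ * H ≤ ε / 2 := by
    rw [inv_mul_eq_div, div_le_iff₀ hT0]
    rw [div_lt_iff₀ (half_pos hε)] at hT
    nlinarith
  have h3 : ∑ c ∈ 𝓕, (autCard c.rep : ℝ)⁻¹ * (1 / W c.rep) = ∑ c ∈ 𝓕, w c :=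
    Finset.sum_congr rfl fun c _ => by
      rw [hw, one_div, one_div, mul_inv, mul_comm]
  have h4 : ∑ c ∈ 𝓕, w c < ε / 2 := hF
  rw [h3] at hone
  linarith

/-- The moments determine the limiting distribution. -/
theorem tendsto_iso_of_moments (hR : IsCohenLenstraRing R) (hW : IsWeight W)
    (hX : ∀ n, IsRandomModule (X n))
    (hmom : ∀ G, MomentLimit P X (fun H => (surCard H G : ℝ)) (1 / W G)) :
    Summable (fun c : IsoClass R => 1 / (W c.rep * autCard c.rep)) ∧
    ∀ G, Tendsto (fun n => (P n).real {ω | Iso (X n ω) G}) atTop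
      (𝓝 (1 / (autCard G * W G * ∑' c : IsoClass R, 1 / (W c.rep * autCard c.rep)))) := by
  have := hR.finite_simpleClass
  have := Fintype.ofFinite (SimpleClass R)
  obtain ⟨C, hC, hlim⟩ := exists_tendsto_iso hR hW hX hmom
  have h1 := hasSum_one_of_tendsto hR hW hX hmom hC hlim
  refine ⟨(summable_mul_left_iff hC.ne').mp h1.summable, fun G => ?_⟩
  have h2 := h1.tsum_eq
  rw [tsum_mul_left] at h2
  convert hlim G using 2
  rw [eq_inv_of_mul_eq_one_left h2]
  simp only [one_div, mul_inv]
  ring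

end Limits

/-! ### The distribution determined by the ratios -/

section Distribution

variable {R : Type u} [Ring R] {W : FiniteModule R → ℝ}

/-- The distributions with the given ratios. -/
theorem ratio_iff (hW : IsWeight W)
    (hs : Summable (fun c : IsoClass R => 1 / (W c.rep * autCard c.rep))) (p : PMF (IsoClass R)) :
    (∀ G₁ G₂ : FiniteModule R, (p (isoClass G₁)).toReal / (p (isoClass G₂)).toReal =
      (W G₂ * autCard G₂) / (W G₁ * autCard G₁)) ↔
    ∀ G, (p (isoClass G)).toReal =
      1 / (autCard G * W G * ∑' c : IsoClass R, 1 / (W c.rep * autCard c.rep)) := by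
  have hpos : ∀ G : FiniteModule R, 0 < W G * autCard G := fun G =>
    mul_pos (hW.pos _) (Nat.cast_pos.mpr (autCard_pos G))
  set Z := ∑' c : IsoClass R, 1 / (W c.rep * autCard c.rep) with hZ
  have hZ0 : 0 < Z := hs.tsum_pos (fun c => (one_div_pos.mpr (hpos _)).le) (isoClass ⟨PUnit⟩)
    (one_div_pos.mpr (hpos _))
  constructor
  · intro h G
    -- The ratio condition for the pair `(G, G)` rules out zero probabilities, since `0 / 0 = 0`
    -- while the other side is `1`.
    have h0 : (p (isoClass G)).toReal ≠ 0 := fun h0 => by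
      have := h G G
      rw [h0, zero_div, div_self (hpos G).ne'] at this
      exact zero_ne_one this
    have h1 : ∀ c : IsoClass R, (p c).toReal =
        (p (isoClass G)).toReal * (W G * autCard G) * (1 / (W c.rep * autCard c.rep)) := fun c => by
      have := h c.rep G
      rw [isoClass_rep, div_eq_iff h0] at this
      rw [this]
      ring
    have h2 : ∑' c, (p c).toReal = 1 := by
      rw [← ENNReal.tsum_toReal_eq fun c => p.apply_ne_top c, p.tsum_coe, ENNReal.toReal_one]
    rw [tsum_congr h1, tsum_mul_left, ← hZ] at h2
    rw [eq_div_iff (mul_pos ((mul_comm _ _).trans_gt (hpos G)) hZ0).ne', ← h2]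
    ring
  · intro h G₁ G₂
    rw [h, h]
    have := (hpos G₁).ne'
    have := (hpos G₂).ne'
    have := hZ0.ne'
    rw [mul_comm (autCard G₁ : ℝ), mul_comm (autCard G₂ : ℝ)]
    field_simp

theorem existsUnique_pmf_ratio (hW : IsWeight W)
    (hs : Summable (fun c : IsoClass R => 1 / (W c.rep * autCard c.rep))) :
    ∃! p : PMF (IsoClass R), ∀ G₁ G₂ : FiniteModule R,
      (p (isoClass G₁)).toReal / (p (isoClass G₂)).toReal =
        (W G₂ * autCard G₂) / (W G₁ * autCard G₁) := by
  simp_rw [ratio_iff hW hs]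
  have hpos : ∀ G : FiniteModule R, 0 < W G * autCard G := fun G =>
    mul_pos (hW.pos _) (Nat.cast_pos.mpr (autCard_pos G))
  set Z := ∑' c : IsoClass R, 1 / (W c.rep * autCard c.rep) with hZ
  have hZ0 : 0 < Z := hs.tsum_pos (fun c => (one_div_pos.mpr (hpos _)).le) (isoClass ⟨PUnit⟩)
    (one_div_pos.mpr (hpos _))
  have hnn : ∀ c : IsoClass R, 0 ≤ Z⁻¹ * (1 / (W c.rep * autCard c.rep)) := fun c =>
    mul_nonneg (inv_pos.mpr hZ0).le (one_div_pos.mpr (hpos _)).le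
  have hsum : ∑' c : IsoClass R, ENNReal.ofReal (Z⁻¹ * (1 / (W c.rep * autCard c.rep))) = 1 := by
    rw [← ENNReal.ofReal_tsum_of_nonneg hnn (hs.mul_left _), tsum_mul_left, ← hZ,
      inv_mul_cancel₀ hZ0.ne', ENNReal.ofReal_one]
  refine ⟨⟨fun c => ENNReal.ofReal (Z⁻¹ * (1 / (W c.rep * autCard c.rep))),
    hsum ▸ ENNReal.summable.hasSum⟩, fun G => ?_, fun p hp => ?_⟩
  · refine (ENNReal.toReal_ofReal (hnn _)).trans ?_
    rw [hW.congr (iso_rep_isoClass G), autCard_congr (iso_rep_isoClass G)]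
    simp only [one_div, mul_inv]
    ring
  · ext c
    refine (ENNReal.toReal_eq_toReal_iff' (p.apply_ne_top c) ENNReal.ofReal_ne_top).mp ?_
    rw [ENNReal.toReal_ofReal (hnn _), ← isoClass_rep c, hp, isoClass_rep]
    simp only [one_div, mul_inv]
    ring

end Distribution

/-! ### Maximal orders satisfy the axioms -/

section MaximalOrder

variable {A : Type u} [Ring A] [Algebra ℚ A] {S : Set Nat.Primes} {O : Subalgebra (ZS S) A}

theorem exists_smul_eq_one_of_mem_awayFrom (O : Subalgebra (ZS S) A) {s : ℤ}
    (hs : s ∈ awayFrom S) : ∃ v : O, v * ((s : ℤ) : O) = 1 := by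
  obtain ⟨v, hv⟩ := (isUnit_intCast_ZS hs).exists_left_inv
  refine ⟨algebraMap (ZS S) O v, ?_⟩
  rw [← map_intCast (algebraMap (ZS S) O), ← map_mul, hv, map_one]

/-- A prime number that kills a nonzero element of an `O`-module belongs to `S`. -/
theorem mem_of_smul_eq_zero {Y : Type*} [AddCommGroup Y] [Module O Y] (p : Nat.Primes) {y : Y}
    (hy : y ≠ 0) (h : (p : ℕ) • y = 0) : p ∈ S := by
  by_contra hp
  have hs : (((p : ℕ) : ℤ)) ∈ awayFrom S := by
    refine ⟨Nat.cast_ne_zero.mpr p.2.ne_zero, fun q hq hqp => hp ?_⟩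
    have h1 : (q : ℕ) = p := (Nat.prime_dvd_prime_iff_eq q.2 p.2).mp (Int.natCast_dvd_natCast.mp hqp)
    rwa [← Subtype.ext h1]
  obtain ⟨v, hv⟩ := exists_smul_eq_one_of_mem_awayFrom O hs
  refine hy ?_
  rw [← one_smul O y, ← hv, mul_smul, Int.cast_smul_eq_zsmul, natCast_zsmul, h, smul_zero]

/-- A nontrivial finite `O`-module has a nonzero element that is killed by a prime in `S`. -/
theorem exists_mem_smul_eq_zero (Y : Type*) [AddCommGroup Y] [Module O Y] [Finite Y]
    [Nontrivial Y] : ∃ p ∈ S, ∃ y : Y, y ≠ 0 ∧ (p : ℕ) • y = 0 := by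
  obtain ⟨p, hp, hpY⟩ := Nat.exists_prime_and_dvd (Finite.one_lt_card (α := Y)).ne'
  have := Fact.mk hp
  obtain ⟨y, hy⟩ := exists_prime_addOrderOf_dvd_card' p hpY
  have hy0 : y ≠ 0 := fun h => hp.ne_one (by rw [← hy, h, addOrderOf_zero])
  have hpy : p • y = 0 := by rw [← hy, addOrderOf_nsmul_eq_zero]
  exact ⟨⟨p, hp⟩, mem_of_smul_eq_zero (O := O) ⟨p, hp⟩ hy0 hpy, y, hy0, hpy⟩

/-- The integer required by `exists_radical` is the product of the primes in `S`. Every nonzero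
finite module has torsion at some `p ∈ S`. Such a `p` kills a simple module, and on any nonzero
finite module the torsion prevents the product from acting injectively, hence surjectively. -/
theorem IsMaximalOrder.isCohenLenstraRing [FiniteDimensional ℚ A] [IsSemisimpleRing A]
    (hS : S.Finite) (hO : IsMaximalOrder O) : IsCohenLenstraRing O where
  finite_of_smul n hn Y _ _ _ h := finite_of_fg_of_smul_eq_zero hO.prop.fg hn h
  card_hom K hK d N hN := card_hom_eq_of_finite_quotient hO N
  exists_radical := by
    refine ⟨∏ p ∈ hS.toFinset, ((p : ℕ) : ℤ),
      Finset.prod_ne_zero_iff.mpr fun p _ => Nat.cast_ne_zero.mpr p.2.ne_zero,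
      fun K hK k => ?_, fun Y hY => ?_⟩
    · have := IsSimpleModule.nontrivial O K
      obtain ⟨p, hp, y, hy, hpy⟩ := exists_mem_smul_eq_zero (O := O) K
      have h1 : (p : ℕ) • k = 0 := by
        have h2 : k ∈ Submodule.span O {y} := by
          rw [IsSimpleModule.span_singleton_eq_top O hy]; trivial
        obtain ⟨r, rfl⟩ := Submodule.mem_span_singleton.mp h2
        rw [smul_comm, hpy, smul_zero]
      rw [← Finset.prod_erase_mul _ _ (hS.mem_toFinset.mpr hp), mul_smul, natCast_zsmul, h1,
        smul_zero]
    · by_contra hns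
      rw [not_subsingleton_iff_nontrivial] at hns
      obtain ⟨p, hp, y, hy, hpy⟩ := exists_mem_smul_eq_zero (O := O) Y
      have hsurj : Function.Surjective fun y : Y => (∏ p ∈ hS.toFinset, ((p : ℕ) : ℤ)) • y := hY
      refine hy (Finite.injective_iff_surjective.mpr hsurj ?_)
      rw [← Finset.prod_erase_mul _ _ (hS.mem_toFinset.mpr hp), mul_smul, natCast_zsmul, hpy,
        smul_zero, smul_zero]

end MaximalOrder

/-! ### Multiplicativity of `|G|^u` -/

section PowU

/-- Passing to the image of an idempotent is exact. In the middle, if `a • y = ι x`, then `a • y = a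
• (a • y) = ι (a • x)`, so the preimage can be taken in the image of `a`. -/
theorem card_range_smul_eq_mul {R M E F : Type*} [Ring R] [AddCommGroup M] [Module R M]
    [AddCommGroup E] [Module R E] [AddCommGroup F] [Module R F] {a : R} (ha : a * a = a)
    {ι : M →ₗ[R] E} {π : E →ₗ[R] F} (hι : Function.Injective ι) (hπ : Function.Surjective π)
    (h : LinearMap.range ι = LinearMap.ker π) :
    Nat.card (Set.range fun x : E => a • x) =
      Nat.card (Set.range fun x : F => a • x) * Nat.card (Set.range fun x : M => a • x) := by
  let f : (DistribSMul.toAddMonoidHom E a).range →+ (DistribSMul.toAddMonoidHom F a).range :=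
    { toFun := fun x => ⟨π x.1, by
        obtain ⟨_, y, rfl⟩ := x
        exact ⟨π y, (map_smul π a y).symm⟩⟩
      map_zero' := Subtype.ext (map_zero π)
      map_add' := fun x y => Subtype.ext (map_add π _ _) }
  have hf : Function.Surjective f := by
    rintro ⟨_, y, rfl⟩
    obtain ⟨x, rfl⟩ := hπ y
    exact ⟨⟨a • x, x, rfl⟩, Subtype.ext (map_smul π a x)⟩
  have hker : Nat.card f.ker = Nat.card (Set.range fun x : M => a • x) := by
    symm
    refine Nat.card_congr (Equiv.ofBijective (fun x => ⟨⟨ι x.1, by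
        obtain ⟨_, y, rfl⟩ := x
        exact ⟨ι y, (map_smul ι a y).symm⟩⟩, Subtype.ext ?_⟩) ⟨fun x y hxy => ?_, ?_⟩)
    · have : ι x.1 ∈ LinearMap.ker π := h ▸ LinearMap.mem_range_self ι x.1
      exact this
    · exact Subtype.ext (hι (congrArg (fun z => z.1.1) hxy))
    · rintro ⟨⟨_, y, rfl⟩, hy⟩
      have hy' : a • y ∈ LinearMap.range ι := h ▸ Subtype.ext_iff.mp hy
      obtain ⟨x, hx⟩ := hy'
      refine ⟨⟨a • x, x, rfl⟩, Subtype.ext (Subtype.ext ?_)⟩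
      change ι (a • x) = a • y
      rw [map_smul, hx, smul_smul, ha]
  rw [← hker]
  have h1 := AddSubgroup.card_eq_card_quotient_mul_card_addSubgroup f.ker
  rw [Nat.card_congr (QuotientAddGroup.quotientKerEquivOfSurjective f hf).toEquiv] at h1
  exact h1

variable {A : Type*} [Ring A] [Algebra ℚ A] {S : Set Nat.Primes} {O : Subalgebra (ZS S) A}

theorem isWeight_powU (hO : IsMaximalOrder O) {m : ℕ} (e : Fin m ≃ irreducibleCentralIdempotents A)
    {u : Fin m → ℚ} (hu : ∀ i, 0 ≤ u i) : IsWeight (powU hO e u) where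
  one_le G := by
    refine Finset.one_le_prod fun i _ => Real.one_le_rpow ?_ (by exact_mod_cast hu i)
    have : Nonempty (Set.range fun g : G =>
      (⟨(e i : A), hO.mem_of_central (e i).2.idem (e i).2.central⟩ : O) • g) := ⟨⟨_, 0, rfl⟩⟩
    exact_mod_cast Nat.card_pos
  mul M E F ι π hι hπ h := by
    rw [powU, powU, powU, ← Finset.prod_mul_distrib]
    refine Finset.prod_congr rfl fun i _ => ?_
    have ha : (⟨(e i : A), hO.mem_of_central (e i).2.idem (e i).2.central⟩ : O) *
        ⟨(e i : A), hO.mem_of_central (e i).2.idem (e i).2.central⟩ =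
        ⟨(e i : A), hO.mem_of_central (e i).2.idem (e i).2.central⟩ := Subtype.ext (e i).2.idem
    rw [← Real.mul_rpow (Nat.cast_nonneg _) (Nat.cast_nonneg _), ← Nat.cast_mul,
      card_range_smul_eq_mul ha hι hπ h]

end PowU

end CLM

end

theorem mainTheorem3
    {A : Type*} [Ring A] [Algebra ℚ A] [FiniteDimensional ℚ A] [IsSemisimpleRing A]
    {m : ℕ} (e : Fin m ≃ CLM.irreducibleCentralIdempotents A)
    (S : Set Nat.Primes) (hS : S.Finite)
    (O : Subalgebra (CLM.ZS S) A) (hO : CLM.IsMaximalOrder O)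
    (u : Fin m → ℚ) (hu : ∀ i, 0 ≤ u i)
    {Ω : ℕ → Type*} [∀ n, MeasurableSpace (Ω n)]
    (P : ∀ n, Measure (Ω n)) [∀ n, IsProbabilityMeasure (P n)]
    (X : ∀ n, Ω n → CLM.FiniteModule O) (hX : ∀ n, CLM.IsRandomModule (X n))
    (hmom : ∀ G : CLM.FiniteModule O,
      Tendsto (fun n => ∫⁻ ω, (CLM.surCard (X n ω) G : ℝ≥0∞) ∂(P n)) atTop
        (𝓝 (ENNReal.ofReal (1 / CLM.powU hO e u G)))) :
    Summable (fun c : CLM.IsoClass O => 1 / (CLM.powU hO e u c.rep * CLM.autCard c.rep)) ∧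
    (∀ G : CLM.FiniteModule O,
      Tendsto (fun n => (P n).real {ω | CLM.Iso (X n ω) G}) atTop
        (𝓝 (1 / (CLM.autCard G * CLM.powU hO e u G * CLM.Z hO e u)))) ∧
    (∃! p : PMF (CLM.IsoClass O), CLM.IsCohenLenstraMartinet hO e u p) ∧
    (∀ p : PMF (CLM.IsoClass O), CLM.IsCohenLenstraMartinet hO e u p →
      ∀ G : CLM.FiniteModule O,
        Tendsto (fun n => (P n).real {ω | CLM.Iso (X n ω) G}) atTop
          (𝓝 (p (CLM.isoClass G)).toReal)) := by
  have hR := hO.isCohenLenstraRing hS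
  have hW := CLM.isWeight_powU hO e hu
  obtain ⟨hs, hlim⟩ := CLM.tendsto_iso_of_moments hR hW hX fun G =>
    CLM.momentLimit_surCard hR hX (one_div_pos.mpr (hW.pos G)).le (hmom G)
  refine ⟨hs, hlim, CLM.existsUnique_pmf_ratio hW hs, fun p hp G => ?_⟩
  rw [(CLM.ratio_iff hW hs p).mp hp G]
  exact hlim G
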